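/- For each $n$ let $\hat M=M+E$, where $M=M_n$ is a deterministic symmetric $n\times n$ real matrix of rank $k=k_n\ge1$ and $E=E^{(n)}$ is a random symmetric $n\times n$ matrix. Write $M=U\Lambda U^\top$, where $U\in\mathbb R^{n\times k}$ has orthonormal columns and $\Lambda=\mathrm{diag}(\lambda_1,\dots,\lambda_k)$ contains the nonzero eigenvalues with $|\lambda_1|\ge\dots\ge|\lambda_k|>0$; put $\psi=|\lambda_1/\lambda_k|$ and $S_n=\|M\|$ (spectral norm). Here $a_n\lesssim b_n$ (or $b_n\gtrsim a_n$) means that $a_n\le c\,b_n$ for all but finitely many $n$, with a constant $c$ not depending on $n$; $\|\cdot\|_{\max}$ is the largest absolute value of an entry, $\|\cdot\|_{2\to\infty}$ the largest Euclidean norm of a row. Assume the following. (i) There are a constant $\beta_\Delta>0$ and noise levels $E_n$ with $S_n/E_n\gtrsim n^{\beta_\Delta}$ such that, for all sufficiently large $n$, $\mathbb P(\|E\|\le E_n)\ge1-n^{-6}$. (ii) There are constants $\delta>1$ and $C_{2\to\infty}<\infty$ such that, for all sufficiently large $n$, every positive integer $h\le\log n$ and every vector $u\in\mathbb R^n$ not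 depending on $E$, with probability at least $1-n^{-8}$, $$\max_{i\le n}|e_i^\top E^hu|\le C_{2\to\infty}E_n^h(\log n)^{\delta h}\|u\|_{\max}.$$ (iii) $k$ and $\psi$ are bounded as $n\to\infty$. Let $\tilde k=\tilde k_n\ge k$, let $C>0$ be a constant and let $a_n\ge\lceil C\tilde k^{-1}\log n\rceil$ be integers. Let $G_1,\dots,G_{a_n}$ be independent $n\times\tilde k$ matrices with independent standard normal entries, independent of $E$. Fix an integer $g\ge1+(2\beta_\Delta)^{-1}$, choose $\tilde a\in\{1,\dots,a_n\}$ maximizing the $k$-th largest singular value of $\hat M^gG_a$ over $a$, and let $\hat U_g\in\mathbb R^{n\times k}$ be the matrix of $k$ leading left singular vectors of $\hat M^gG_{\tilde a}$ (with ties broken arbitrarily). Put $\vartheta=\max\{1,\tilde k^{-1/2}\log^{1/2}n\}$ and $$\Theta_n=(\log n)^{\delta^*}\,\vartheta\,\psi^g\,k^{1/2},$$ where $\delta^*=\delta$ if $g>1+(2\beta_\Delta)^{-1}$ or if $\|U\|_{2\to\infty}\gtrsim n^{-\beta_c/2}$ for some $\beta_c\in[0,1)$, and $\delta^*=\delta g+\tfrac12$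 otherwise. Then there is a constant $c$ not depending on $n$ such that, for all sufficiently large $n$, with probability at least $1-n^{-5}$, $$\|\hat U_g\hat U_g^\top\hat M-M\|_{\max}\le c\,\Theta_nE_n\|U\|_{2\to\infty}^2 .$$ Moreover $\Theta_n\lesssim(\log n)^{\delta}\vartheta$ if $g>1+(2\beta_\Delta)^{-1}$, and $\Theta_n\lesssim(\log n)^{\delta g+1/2}\vartheta$ otherwise. -/

import Mathlib

open MeasureTheory ProbabilityTheory Filter

namespace RSRSVD

/-- `f n ≲ h n`: there is a constant `c`, not depending on `n`, such that `f n ≤ c * h n` for all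
but finitely many `n`. -/
def Lesssim (f h : ℕ → ℝ) : Prop :=
  ∃ c : ℝ, 0 < c ∧ ∀ᶠ n in atTop, f n ≤ c * h n

/-- "The event `s` happens with probability at least `p`": `s` contains a measurable event of
probability at least `p`.  For a measurable `s` this says `p ≤ P s`, see
`holdsWithProb_iff_of_measurableSet`; in general it is the inner probability that is bounded. -/
def HoldsWithProb {Ω : Type*} [MeasurableSpace Ω] (P : Measure Ω) (p : ℝ) (s : Set Ω) : Prop :=
  ∃ A : Set Ω, MeasurableSet A ∧ A ⊆ s ∧ p ≤ P.real A

theorem holdsWithProb_iff_of_measurableSet {Ω : Type*} [MeasurableSpace Ω] (P : Measure Ω)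
    [IsFiniteMeasure P] (p : ℝ) {s : Set Ω} (hs : MeasurableSet s) :
    HoldsWithProb P p s ↔ p ≤ P.real s :=
  ⟨fun ⟨_, _, hA, hp⟩ => hp.trans (measureReal_mono hA), fun h => ⟨s, hs, subset_rfl, h⟩⟩

/-- The spectral norm of a square matrix. -/
noncomputable def specNorm {n : ℕ} (A : Matrix (Fin n) (Fin n) ℝ) : ℝ :=
  ‖Matrix.toEuclideanCLM (n := Fin n) (𝕜 := ℝ) A‖

/-- The largest absolute value of an entry. -/
noncomputable def maxNorm {m p : ℕ} (A : Matrix (Fin m) (Fin p) ℝ) : ℝ :=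
  ⨆ i, ⨆ j, |A i j|

/-- The largest Euclidean norm of a row. -/
noncomputable def twoInftyNorm {m p : ℕ} (A : Matrix (Fin m) (Fin p) ℝ) : ℝ :=
  ⨆ i, Real.sqrt (∑ j, (A i j) ^ 2)

/-- `M = U Λ Uᵀ` where `U` has orthonormal columns and `Λ = diag lam` contains all the nonzero
eigenvalues of `M`, ordered by decreasing magnitude.  In particular `M` is symmetric and its rank
is the number `k` of columns of `U`. -/
structure IsSignalDecomposition {n k : ℕ} (M : Matrix (Fin n) (Fin n) ℝ)
    (U : Matrix (Fin n) (Fin k) ℝ) (lam : Fin k → ℝ) : Prop where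
  orthonormal : U.transpose * U = 1
  decomp : M = U * Matrix.diagonal lam * U.transpose
  ne_zero : ∀ i, lam i ≠ 0
  ordered : Antitone fun i => |lam i|

/-- The condition number `|lam₁| / |lam_k|`: largest over smallest magnitude. -/
noncomputable def condNumber {k : ℕ} (lam : Fin k → ℝ) : ℝ :=
  (⨆ i, |lam i|) / (⨅ i, |lam i|)

/-- Signal-to-noise assumption with exponent `β`: `S_n / E_n ≳ n ^ β`, where `S_n` is the spectral
norm of the signal, and the spectral norm of the noise is at most the noise level `E_n = Elev n`
with probability at least `1 - n⁻⁶`, for all large `n`. -/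
def SNRAssumption {Ω : ℕ → Type*} [∀ n, MeasurableSpace (Ω n)] (P : ∀ n, Measure (Ω n))
    (M : ∀ n : ℕ, Matrix (Fin n) (Fin n) ℝ) (E : ∀ n, Ω n → Matrix (Fin n) (Fin n) ℝ)
    (Elev : ℕ → ℝ) (β : ℝ) : Prop :=
  Lesssim (fun n => (n : ℝ) ^ β) (fun n => specNorm (M n) / Elev n) ∧
    ∀ᶠ n : ℕ in atTop,
      HoldsWithProb (P n) (1 - 1 / (n : ℝ) ^ 6) {ω | specNorm (E n ω) ≤ Elev n}

/-- Row-wise fluctuation assumption with exponent `δ`: for all large `n`, all positive integers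
`h ≤ log n` and all (non-random) vectors `u`, with probability at least `1 - n⁻⁸` all coordinates
of `E ^ h u` are at most `C E_n ^ h (log n) ^ (δ h) ‖u‖_max` in absolute value
(the norm of `Fin n → ℝ` is the maximum norm). -/
def RowAssumption {Ω : ℕ → Type*} [∀ n, MeasurableSpace (Ω n)] (P : ∀ n, Measure (Ω n))
    (E : ∀ n, Ω n → Matrix (Fin n) (Fin n) ℝ) (Elev : ℕ → ℝ) (δ : ℝ) : Prop :=
  ∃ C : ℝ, 0 < C ∧ ∀ᶠ n : ℕ in atTop, ∀ h : ℕ, 1 ≤ h → (h : ℝ) ≤ Real.log n →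
    ∀ u : Fin n → ℝ, HoldsWithProb (P n) (1 - 1 / (n : ℝ) ^ 8)
      {ω | ∀ i, |((E n ω) ^ h).mulVec u i| ≤
        C * Elev n ^ h * Real.log n ^ (δ * h) * ‖u‖}

/-- The `a` matrices `G 0, …, G (a - 1)` are independent standard Gaussian `n × p` matrices:
all their entries together are independent standard normal variables. -/
def IsGaussianSketch {Ω : Type*} [MeasurableSpace Ω] (P : Measure Ω) {a n p : ℕ}
    (G : Fin a → Ω → Matrix (Fin n) (Fin p) ℝ) : Prop :=
  HasLaw (fun ω (q : Fin a × Fin n × Fin p) => G q.1 ω q.2.1 q.2.2)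
    (Measure.pi fun _ => gaussianReal 0 1) P

/-- `Y = W Σ Vᵀ` is a (full) singular value decomposition of the `m × p` matrix `Y`: `W` and `V`
are orthogonal and `Σ` is the rectangular diagonal matrix with the non-increasing nonnegative
diagonal entries `σ 0 ≥ σ 1 ≥ …`; the values `σ i` for `i ≥ min m p` play no role. -/
structure IsSVD {m p : ℕ} (Y : Matrix (Fin m) (Fin p) ℝ) (W : Matrix (Fin m) (Fin m) ℝ)
    (σ : ℕ → ℝ) (V : Matrix (Fin p) (Fin p) ℝ) : Prop where
  left_orth : W.transpose * W = 1
  right_orth : V.transpose * V = 1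
  nonneg : ∀ i, 0 ≤ σ i
  ordered : Antitone σ
  decomp : Y = W * Matrix.of (fun (i : Fin m) (j : Fin p) => if (i : ℕ) = (j : ℕ) then σ i else 0)
    * V.transpose

/-- `Uhat` is an output of randomized SVD with repeated sampling, applied to `Mhat` with target
rank `k`, power `g` and sketching matrices `G 0, …, G (a - 1)`: the exact singular value
decompositions of all the matrices `Mhat ^ g * G b` are computed, an index `t` is chosen which
maximizes the `k`-th largest singular value, and the columns of `Uhat` are the `k` leading left
singular vectors of `Mhat ^ g * G t`.  Singular vectors and maximizers need not be unique: every
choice is an output. -/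
def IsOutput {n p a k : ℕ} (Mhat : Matrix (Fin n) (Fin n) ℝ) (g : ℕ)
    (G : Fin a → Matrix (Fin n) (Fin p) ℝ) (Uhat : Matrix (Fin n) (Fin k) ℝ) : Prop :=
  ∃ (W : Fin a → Matrix (Fin n) (Fin n) ℝ) (σ : Fin a → ℕ → ℝ)
    (V : Fin a → Matrix (Fin p) (Fin p) ℝ) (t : Fin a),
    (∀ b, IsSVD (Mhat ^ g * G b) (W b) (σ b) (V b)) ∧
    (∀ b, σ b (k - 1) ≤ σ t (k - 1)) ∧
    ∀ (i l : Fin n) (j : Fin k), (l : ℕ) = (j : ℕ) → Uhat i j = W t i l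

/-- `ϑ = max {1, p^{-1/2} (log n)^{1/2}}`, where `p` is the sketching dimension. -/
noncomputable def vartheta (p n : ℕ) : ℝ :=
  max 1 (Real.sqrt (Real.log n) / Real.sqrt p)

open Classical in
/-- The exponent `δ*` of the logarithm: `δ` if `g > 1 + (2β)⁻¹`, or if
`‖U‖_{2→∞} ≳ n ^ (-βc / 2)` for some `βc ∈ [0, 1)`; and `δ g + 1/2` otherwise. -/
noncomputable def deltaStar {k : ℕ → ℕ} (U : ∀ n : ℕ, Matrix (Fin n) (Fin (k n)) ℝ)
    (β δ : ℝ) (g : ℕ) : ℝ :=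
  if (g : ℝ) > 1 + (2 * β)⁻¹ ∨
      ∃ βc : ℝ, 0 ≤ βc ∧ βc < 1 ∧
        Lesssim (fun n => (n : ℝ) ^ (-βc / 2)) (fun n => twoInftyNorm (U n))
  then δ else δ * g + 1 / 2

/-- `Θ_n = (log n)^{δ*} ϑ ψ^g k^{1/2}`. -/
noncomputable def Theta {k : ℕ → ℕ} (U : ∀ n : ℕ, Matrix (Fin n) (Fin (k n)) ℝ)
    (lam : ∀ n, Fin (k n) → ℝ) (kt : ℕ → ℕ) (β δ : ℝ) (g : ℕ) (n : ℕ) : ℝ :=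
  Real.log n ^ deltaStar U β δ g * vartheta (kt n) n * condNumber (lam n) ^ g *
    Real.sqrt (k n)

end RSRSVD

/-! Write `M̂ = M + E`, `L = |λ₁|`, `e` for the noise level, `ρ = e / L`, `u` for the largest row
norm of `U`, `ℓ = (log n)^δ` and `θ = ϑ`. The output is `Û = M̂^g G_t F`, where `F` inverts the
leading singular values and so has size at most `1/s` once the `k`-th singular value is at least
`s`. By `add_pow_telescope`, `M̂^g` is the sum of `E^h M M̂^(g-1-h)` over `h < g`, plus `E^g`. Hence
`Û = U D₀ + Err`, where `Err` consists of the terms `E^h U D_h` with `1 ≤ h < g` and the remainder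
`E^g G_t F`. Noise powers meet `U` only through its deterministic columns, where the row-wise
assumption applies; the dependence of `Û` on `E` sits in the `k × k` matrices `D_h`, for which norm
bounds of order `θ / L^h` suffice. The remainder needs only the spectral norm: its rows are of order
`ρ^g θ`, and since `√n ρ^(g-1)` is bounded (this is the lower bound on `g`) and `u ≥ n^(-1/2)`, they
are of order `ρ θ u`.

As `Û` has orthonormal columns and `Err` is small, `D₀` is well conditioned. The error equals `Û (E
Û)ᵀ - W (U Λ)ᵀ` with `W = (1 - Û Ûᵀ) U = -(1 - Û Ûᵀ) Err D₀⁻¹`, and Cauchy–Schwarz on rows bounds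
each entry by a multiple of `ℓ θ e u²`. This is `abs_proj_mul_sub_le`.

The probabilistic part provides `s` of order `L^g T / θ`, where `T` bounds the stretching of the
relevant directions by every sketch. The selected sketch depends on all the data, so `T²` contains
the logarithm of the number `N` of sketches, which has no upper bound; `exists_expanding_sketch`
shows that the best sketch keeps pace with `T`. Given `E`, `exists_orthonormal_rows_factor` writes
`Uᵀ M̂^g = R O` with orthonormal rows in `O`, rotation invariance makes the `O G_a` independent
Gaussian matrices, and `IsSVD.le_of_expandsBy` transfers the estimate to the singular values.

The bound obtained always carries `(log n)^δ ϑ`. The quantity `Θ_n` enters only because it dominates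
this product: `δ ≤ δ*`, `ψ ≥ 1` and `k ≥ 1`. -/

namespace RSRSVD

/-! ### Rotation invariance and regrouping of standard Gaussian vectors -/

section Gaussian

variable {ι κ : Type*} [Fintype ι] [Fintype κ]

variable (ι) in
/-- The standard Gaussian measure on `ι → ℝ`. -/
noncomputable abbrev stdPi : Measure (ι → ℝ) := Measure.pi fun _ : ι => gaussianReal 0 1

theorem charFun_map_toLp_stdPi (t : EuclideanSpace ℝ ι) :
    charFun ((stdPi ι).map (WithLp.toLp 2)) t = Complex.exp (-‖t‖ ^ 2 / 2) := by
  rw [map_pi_eq_stdGaussian, charFun_stdGaussian]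

/-- A linear map with orthonormal rows maps standard Gaussian vectors to standard Gaussian
vectors. -/
theorem map_mulVec_stdPi [DecidableEq κ] (A : Matrix κ ι ℝ) (hA : A * A.transpose = 1) :
    (stdPi ι).map A.mulVec = stdPi κ := by
  have hm : Measurable A.mulVec := by
    refine measurable_pi_lambda _ fun i => ?_
    simp only [Matrix.mulVec, dotProduct]
    fun_prop
  have key : ((stdPi ι).map A.mulVec).map (WithLp.toLp 2) = (stdPi κ).map (WithLp.toLp 2) := by
    apply Measure.ext_of_charFun (E := EuclideanSpace ℝ κ)
    ext t
    rw [charFun_map_toLp_stdPi, Measure.map_map (by fun_prop) hm, charFun_apply,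
      integral_map (by fun_prop) (Measurable.aestronglyMeasurable (by fun_prop))]
    have h2 := charFun_map_toLp_stdPi (WithLp.toLp 2 (A.transpose.mulVec t.ofLp))
    rw [charFun_apply, integral_map (by fun_prop)
      (Measurable.aestronglyMeasurable (by fun_prop))] at h2
    have hin : ∀ x : ι → ℝ, inner ℝ ((WithLp.toLp 2 ∘ A.mulVec) x : EuclideanSpace ℝ κ) t =
        inner ℝ (WithLp.toLp 2 x : EuclideanSpace ℝ ι)
          (WithLp.toLp 2 (A.transpose.mulVec t.ofLp)) := by
      intro x
      simp only [EuclideanSpace.inner_eq_star_dotProduct, Function.comp, star_trivial]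
      rw [Matrix.mulVec_transpose, ← Matrix.dotProduct_mulVec]
    -- The Gaussian characteristic function depends on the norm of its argument only, and `Aᵀ` is an
    -- isometry.
    have hn : ‖(WithLp.toLp 2 (A.transpose.mulVec t.ofLp) : EuclideanSpace ℝ ι)‖ ^ 2 = ‖t‖ ^ 2 := by
      rw [← real_inner_self_eq_norm_sq, ← real_inner_self_eq_norm_sq]
      simp only [EuclideanSpace.inner_eq_star_dotProduct, star_trivial]
      rw [Matrix.mulVec_transpose, ← Matrix.dotProduct_mulVec, ← Matrix.mulVec_transpose,
        Matrix.mulVec_mulVec, hA, Matrix.one_mulVec]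
    simp only [hin]
    rw [h2]
    congr 3
    exact_mod_cast hn
  have hid : ∀ ν : Measure (κ → ℝ), (ν.map (WithLp.toLp 2)).map (WithLp.ofLp (p := 2)) = ν := by
    intro ν
    rw [Measure.map_map (by fun_prop) (by fun_prop)]
    exact Measure.map_id
  rw [← hid ((stdPi ι).map A.mulVec), key, hid]

/-- The standard Gaussian measure on a product index set, regrouped. -/
theorem map_curry_stdPi : (stdPi (ι × κ)).map Function.curry = Measure.pi fun _ : ι => stdPi κ := by
  symm
  have h : (Measure.pi fun _ : ι => stdPi κ).map Function.uncurry = stdPi (ι × κ) := by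
    symm
    refine Measure.pi_eq fun s hs => ?_
    rw [Measure.map_apply measurable_uncurry (MeasurableSet.univ_pi hs)]
    have : Function.uncurry ⁻¹' (Set.univ.pi s) =
        Set.univ.pi fun i : ι => Set.univ.pi fun j : κ => s (i, j) := by
      ext f
      simp [Set.mem_pi, Function.uncurry]
    rw [this, Measure.pi_pi]
    simp only [Measure.pi_pi]
    rw [Fintype.prod_prod_type]
  rw [← h, Measure.map_map measurable_curry measurable_uncurry]
  exact Measure.map_id.symm

/-- The one-dimensional Gaussian density is at most `1`, so the comparison holds on boxes, and the
product outer measure is the largest one with given bounds on boxes. This carries Lebesgue null sets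
over to the Gaussian measure. -/
theorem stdPi_le_volume (s : Set (ι → ℝ)) (hs : MeasurableSet s) : stdPi ι s ≤ volume s := by
  have hg : ∀ t : Set ℝ, gaussianReal 0 1 t ≤ volume t := by
    intro t
    rw [gaussianReal_apply 0 one_ne_zero]
    calc ∫⁻ x in t, gaussianPDF 0 1 x ≤ ∫⁻ x in t, 1 := by
          refine lintegral_mono fun x => ?_
          rw [gaussianPDF_def, gaussianPDFReal_def]
          refine ENNReal.ofReal_le_one.2 ?_
          refine mul_le_one₀ (inv_le_one_of_one_le₀ ?_) (Real.exp_nonneg _)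
            (Real.exp_le_one_iff.2 ?_)
          · rw [Real.one_le_sqrt]
            have := Real.pi_gt_three
            simp; linarith
          · rw [neg_div]
            exact neg_nonpos.2 (by positivity)
      _ = volume t := by simp
  have h := (OuterMeasure.le_pi (m := fun _ : ι => (volume : Measure ℝ).toOuterMeasure)
    (n := (stdPi ι).toOuterMeasure)).2 (by
      intro t _
      show stdPi ι (Set.univ.pi t) ≤ _
      rw [Measure.pi_pi]
      exact Finset.prod_le_prod' fun i _ => hg _)
  calc stdPi ι s ≤ OuterMeasure.pi (fun _ : ι => (volume : Measure ℝ).toOuterMeasure) s := h s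
    _ = volume s := by
      rw [volume_pi, Measure.pi, toMeasure_apply _ _ hs]

end Gaussian

/-! ### Upper tail of the squared length of a Gaussian vector -/

section ChiSquare

/-- The integral is exactly `√2`; the cruder value `e` makes the moment of a `d`-dimensional vector
at most `exp d`. -/
theorem integrable_exp_sq_div_four_and_integral_le :
    Integrable (fun x : ℝ => Real.exp (x * x / 4)) (gaussianReal 0 1) ∧
      ∫ x, Real.exp (x * x / 4) ∂(gaussianReal 0 1) ≤ Real.exp 1 := by
  have hpdf : ∀ x : ℝ, gaussianPDFReal 0 1 x * Real.exp (x * x / 4) =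
      (Real.sqrt (2 * Real.pi))⁻¹ * Real.exp (-(1 / 4) * x ^ 2) := by
    intro x
    rw [gaussianPDFReal_def]
    simp only [NNReal.coe_one, mul_one, sub_zero]
    rw [mul_assoc, ← Real.exp_add]
    congr 2
    ring
  have hint : Integrable (fun x : ℝ => (Real.sqrt (2 * Real.pi))⁻¹ *
      Real.exp (-(1 / 4) * x ^ 2)) :=
    (integrable_exp_neg_mul_sq (by norm_num)).const_mul _
  constructor
  · rw [gaussianReal_of_var_ne_zero 0 one_ne_zero,
      integrable_withDensity_iff (measurable_gaussianPDF 0 1)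
        (Eventually.of_forall fun _ => gaussianPDF_lt_top)]
    refine hint.congr (Eventually.of_forall fun x => ?_)
    simp only [toReal_gaussianPDF]
    rw [← hpdf, mul_comm]
  · rw [integral_gaussianReal_eq_integral_smul one_ne_zero]
    simp only [smul_eq_mul, hpdf]
    rw [integral_const_mul, integral_gaussian, ← Real.sqrt_inv, ← Real.sqrt_mul (by positivity)]
    have : (2 * Real.pi)⁻¹ * (Real.pi / (1 / 4)) = 2 := by
      have := Real.pi_ne_zero
      field_simp
      norm_num
    rw [this]
    have h1 : Real.sqrt 2 ≤ 2 := by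
      rw [Real.sqrt_le_left (by norm_num)]; norm_num
    have := Real.add_one_le_exp (1 : ℝ)
    linarith

/-- Upper tail of the chi-square distribution. -/
theorem stdPi_chiSquare_tail {κ : Type*} [Fintype κ] (L : ℝ) :
    stdPi κ {z | 4 * ((Fintype.card κ : ℝ) + L) ≤ z ⬝ᵥ z} ≤ ENNReal.ofReal (Real.exp (-L)) := by
  obtain ⟨h1, h2⟩ := integrable_exp_sq_div_four_and_integral_le
  have hexp : ∀ z : κ → ℝ, Real.exp (z ⬝ᵥ z / 4) = ∏ i, Real.exp (z i * z i / 4) := by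
    intro z
    rw [← Real.exp_sum, dotProduct, Finset.sum_div]
  have hint : Integrable (fun z : κ → ℝ => Real.exp (z ⬝ᵥ z / 4)) (stdPi κ) := by
    simp only [hexp]
    exact Integrable.fintype_prod (f := fun _ x => Real.exp (x * x / 4)) fun _ => h1
  have hle : ∫ z, Real.exp (z ⬝ᵥ z / 4) ∂(stdPi κ) ≤ Real.exp (Fintype.card κ) := by
    simp only [hexp]
    rw [integral_fintype_prod_eq_prod (f := fun _ x => Real.exp (x * x / 4))]
    rw [Finset.prod_const, Finset.card_univ]
    refine (pow_le_pow_left₀ (integral_nonneg fun x => Real.exp_nonneg _) h2 _).trans ?_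
    rw [← Real.exp_nat_mul, mul_one]
  -- Markov's inequality for `exp(|z|²/4)` at level `exp(d + L)`, where `d` is the dimension: the
  -- moment `exp d` cancels and `exp(-L)` remains.
  have hmk := mul_meas_ge_le_integral_of_nonneg
    (Eventually.of_forall fun z => (Real.exp_nonneg (z ⬝ᵥ z / 4) : (0 : ℝ) ≤ _)) hint
    (Real.exp ((Fintype.card κ : ℝ) + L))
  have hset : {z : κ → ℝ | 4 * ((Fintype.card κ : ℝ) + L) ≤ z ⬝ᵥ z} =
      {z | Real.exp ((Fintype.card κ : ℝ) + L) ≤ Real.exp (z ⬝ᵥ z / 4)} := by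
    ext z
    simp only [Set.mem_ofPred_eq, Real.exp_le_exp]
    constructor <;> intro h <;> linarith
  rw [hset]
  rw [← ofReal_measureReal]
  refine ENNReal.ofReal_le_ofReal ?_
  have h3 := hmk.trans hle
  rw [show ∀ r : ℝ, Real.exp ((Fintype.card κ : ℝ) + L) * r =
    Real.exp (Fintype.card κ : ℝ) * (Real.exp L * r) from fun r => by rw [Real.exp_add, mul_assoc]]
    at h3
  have h4 := le_of_mul_le_mul_left (h3.trans_eq (mul_one _).symm) (Real.exp_pos _)
  rw [Real.exp_neg, ← one_div, le_div_iff₀ (Real.exp_pos _), mul_comm]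
  exact h4

end ChiSquare

/-! ### Cauchy–Schwarz bounds for matrices acting on vectors -/

section Frobenius

theorem dotProduct_self_nonneg {ι : Type*} [Fintype ι] (x : ι → ℝ) : 0 ≤ x ⬝ᵥ x :=
  Finset.sum_nonneg fun i _ => mul_self_nonneg (x i)

variable {ι κ : Type*} [Fintype ι] [Fintype κ]

theorem dotProduct_mulVec_self_le (A : Matrix κ ι ℝ) (y : ι → ℝ) :
    A.mulVec y ⬝ᵥ A.mulVec y ≤ (∑ i, ∑ j, A i j ^ 2) * (y ⬝ᵥ y) := by
  rw [dotProduct, Finset.sum_mul]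
  refine Finset.sum_le_sum fun i _ => ?_
  have := Finset.sum_mul_sq_le_sq_mul_sq Finset.univ (A i) y
  rw [← pow_two, Matrix.mulVec, dotProduct]
  refine this.trans_eq ?_
  simp only [dotProduct, pow_two]

/-- The Frobenius bound is applied to the inverse; adding `1` to its squared norm keeps the constant
well defined when the index type is empty. -/
theorem exists_lower_bound_of_det_ne_zero [DecidableEq ι] (Z : Matrix ι ι ℝ) (hZ : Z.det ≠ 0) :
    ∃ c : ℝ, 0 < c ∧ ∀ x : ι → ℝ, c * (x ⬝ᵥ x) ≤ Z.mulVec x ⬝ᵥ Z.mulVec x := by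
  set F := ∑ i, ∑ j, Z⁻¹ i j ^ 2 with hF
  have hF0 : 0 ≤ F := Finset.sum_nonneg fun i _ => Finset.sum_nonneg fun j _ => sq_nonneg _
  refine ⟨(F + 1)⁻¹, by positivity, fun x => ?_⟩
  rw [inv_mul_le_iff₀ (by positivity)]
  have h := dotProduct_mulVec_self_le Z⁻¹ (Z.mulVec x)
  rw [Matrix.mulVec_mulVec, Matrix.nonsing_inv_mul _ (Ne.isUnit hZ), Matrix.one_mulVec] at h
  have h0 : 0 ≤ Z.mulVec x ⬝ᵥ Z.mulVec x := dotProduct_self_nonneg _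
  nlinarith

end Frobenius

/-! ### Smallest singular value of a square Gaussian matrix: lower and upper tails -/

section SquareBlocks

variable {ι : Type*} [Fintype ι]

/-- `Z` satisfies `t |x|² ≤ |Zᵀ x|²` for all `x`, i.e. its smallest singular value squared is at
least `t`. -/
def ExpandsBy {κ : Type*} [Fintype κ] (t : ℝ) (Z : Matrix ι κ ℝ) : Prop :=
  ∀ x : ι → ℝ, t * (x ⬝ᵥ x) ≤ Z.transpose.mulVec x ⬝ᵥ Z.transpose.mulVec x

theorem isClosed_expandsBy {κ X : Type*} [Fintype κ] [TopologicalSpace X] (t : ℝ)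
    (f : X → Matrix ι κ ℝ) (hf : Continuous f) : IsClosed {z | ExpandsBy t (f z)} := by
  simp only [ExpandsBy, Set.ofPred_forall]
  refine isClosed_iInter fun x => isClosed_le continuous_const ?_
  have h : Continuous fun z => (f z).transpose.mulVec x :=
    hf.matrix_transpose.matrix_mulVec continuous_const
  exact h.dotProduct h

theorem ExpandsBy.mono {κ : Type*} [Fintype κ] {s t : ℝ} {Z : Matrix ι κ ℝ} (h : ExpandsBy t Z)
    (hst : s ≤ t) : ExpandsBy s Z := fun x =>
  (mul_le_mul_of_nonneg_right hst (dotProduct_self_nonneg x)).trans (h x)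

/-- The square matrix with the given entries. -/
def ofPairs {κ : Type*} (z : ι × κ → ℝ) : Matrix ι κ ℝ := Matrix.of fun i j => z (i, j)

theorem continuous_ofPairs {ι κ : Type*} : Continuous (ofPairs : (ι × κ → ℝ) → Matrix ι κ ℝ) := by
  unfold ofPairs
  exact continuous_matrix fun i j => continuous_apply _

variable [DecidableEq ι]

/-- Along each line `Z + t • 1` the determinant is the characteristic polynomial of `-Z` at `t`,
with finitely many roots. By Fubini almost every translate of the singular set is null, and
translation invariance removes the shift. -/
theorem volume_det_eq_zero :
    volume {z : ι × ι → ℝ | (ofPairs z).det = 0} = 0 := by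
  set S : Set (ι × ι → ℝ) := {z | (ofPairs z).det = 0}
  set d : ι × ι → ℝ := fun q => if q.1 = q.2 then 1 else 0
  have hSc : IsClosed S :=
    isClosed_eq (continuous_ofPairs.matrix_det) continuous_const
  have hd : ∀ (z : ι × ι → ℝ) (t : ℝ), ofPairs (z + t • d) = t • (1 : Matrix ι ι ℝ) -
      -ofPairs z := by
    intro z t
    ext i j
    simp [ofPairs, d, Matrix.one_apply, add_comm]
  set T : Set ((ι × ι → ℝ) × ℝ) := {q | q.1 + q.2 • d ∈ S}
  have hT : MeasurableSet T := (hSc.preimage (by fun_prop)).measurableSet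
  have hT0 : (volume.prod volume) T = 0 := by
    rw [Measure.measure_prod_null hT]
    refine Eventually.of_forall fun z => ?_
    refine Set.Finite.measure_zero ?_ _
    refine (Polynomial.finite_setOfPred_isRoot
      (Matrix.charpoly_monic (-ofPairs z)).ne_zero).subset fun t ht => ?_
    have ht' : (ofPairs (z + t • d)).det = 0 := ht
    simp only [Set.mem_ofPred_eq, Polynomial.IsRoot.def]
    rw [Matrix.eval_charpoly, ← ht', hd]
    congr 2
    ext i j
    simp [Matrix.scalar_apply, Matrix.diagonal_apply, Matrix.one_apply]
  have hT1 : ∀ᵐ t : ℝ, volume {z : ι × ι → ℝ | z + t • d ∈ S} = 0 := by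
    have := Measure.measurePreserving_swap (μ := (volume : Measure ℝ))
      (ν := (volume : Measure (ι × ι → ℝ)))
    have h2 := this.measure_preimage hT.nullMeasurableSet
    rw [hT0] at h2
    exact Measure.measure_ae_null_of_prod_null h2
  obtain ⟨t, ht⟩ := hT1.exists
  rwa [show {z : ι × ι → ℝ | z + t • d ∈ S} = (fun z => z + t • d) ⁻¹' S from rfl,
    measure_preimage_add_right] at ht

theorem stdPi_det_eq_zero : stdPi (ι × ι) {z | (ofPairs z).det = 0} = 0 := by
  have hSc : IsClosed {z : ι × ι → ℝ | (ofPairs z).det = 0} :=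
    isClosed_eq (continuous_ofPairs.matrix_det) continuous_const
  exact le_antisymm ((stdPi_le_volume _ hSc.measurableSet).trans_eq volume_det_eq_zero) bot_le

/-- Small ball estimate: the smallest singular value of a square Gaussian matrix is rarely small. -/
theorem exists_stdPi_not_expandsBy_le (ι : Type*) [Fintype ι] [DecidableEq ι] {q : ℝ}
    (hq : 0 < q) : ∃ η : ℝ, 0 < η ∧
      stdPi (ι × ι) {z | ¬ ExpandsBy η (ofPairs z)} ≤ ENNReal.ofReal q := by
  -- These sets decrease, and their intersection contains only singular matrices, so continuity from
  -- above yields a level `η` without any explicit estimate.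
  set B : ℕ → Set (ι × ι → ℝ) := fun m => {z | ¬ ExpandsBy (1 / ((m : ℝ) + 1)) (ofPairs z)} with hB
  have hBm : ∀ m, MeasurableSet (B m) := fun m =>
    (isClosed_expandsBy _ _ continuous_ofPairs).measurableSet.compl
  have hanti : Antitone B := by
    intro m m' hmm z hz hz'
    refine hz (hz'.mono ?_)
    exact one_div_le_one_div_of_le (by positivity) (by simpa using hmm)
  have hinter : stdPi (ι × ι) (⋂ m, B m) = 0 := by
    refine measure_mono_null (fun z hz => ?_) (stdPi_det_eq_zero (ι := ι))
    by_contra hdet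
    have hdet' : (ofPairs z).transpose.det ≠ 0 := by rwa [Matrix.det_transpose]
    obtain ⟨c, hc, hcx⟩ := exists_lower_bound_of_det_ne_zero _ hdet'
    obtain ⟨m, hm⟩ := exists_nat_one_div_lt hc
    have hzm := Set.mem_iInter.1 hz m
    exact hzm (ExpandsBy.mono (t := c) hcx hm.le)
  have ht := tendsto_measure_iInter_atTop (μ := stdPi (ι × ι))
    (fun m => (hBm m).nullMeasurableSet) hanti ⟨0, measure_ne_top _ _⟩
  rw [hinter] at ht
  have := (ENNReal.tendsto_atTop_zero.1 ht) (ENNReal.ofReal q) (by simpa using hq)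
  obtain ⟨m, hm⟩ := this
  exact ⟨1 / ((m : ℝ) + 1), by positivity, hm m le_rfl⟩

/-- On an interval of length one the density is at least its value at the right end point, and
`(2π)^(-1/2) ≥ e^(-2)`. -/
theorem gaussianReal_Icc_ge {a : ℝ} (ha : 0 ≤ a) :
    ENNReal.ofReal (Real.exp (-((a + 1) ^ 2 / 2 + 2))) ≤ gaussianReal 0 1 (Set.Icc a (a + 1)) := by
  rw [gaussianReal_apply 0 one_ne_zero]
  calc ENNReal.ofReal (Real.exp (-((a + 1) ^ 2 / 2 + 2)))
      = ∫⁻ _ in Set.Icc a (a + 1), ENNReal.ofReal (Real.exp (-((a + 1) ^ 2 / 2 + 2))) := by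
        simp
    _ ≤ _ := by
      refine setLIntegral_mono (measurable_gaussianPDF 0 1) fun x hx => ?_
      rw [gaussianPDF_def, gaussianPDFReal_def]
      refine ENNReal.ofReal_le_ofReal ?_
      simp only [NNReal.coe_one, mul_one, sub_zero]
      have h1 : Real.exp (-2) ≤ (Real.sqrt (2 * Real.pi))⁻¹ := by
        rw [Real.exp_neg]
        refine inv_anti₀ (by positivity) ?_
        rw [Real.sqrt_le_left (Real.exp_nonneg _)]
        have := Real.add_one_le_exp (2 : ℝ)
        have := Real.pi_lt_four
        nlinarith
      rw [neg_add, Real.exp_add, mul_comm]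
      refine mul_le_mul h1 (Real.exp_le_exp.2 ?_) (Real.exp_nonneg _) (by positivity)
      have : x ^ 2 ≤ (a + 1) ^ 2 := pow_le_pow_left₀ (ha.trans hx.1) hx.2 2
      linarith

/-- The deviation from `X • 1` has Frobenius norm at most `k ≤ |X| / 2`, so it can destroy at most
half of the stretching by `X`. -/
theorem expandsBy_of_near_scalar {X : ℝ} {k : ℝ} (hk : (Fintype.card ι : ℝ) ≤ k)
    (hX : 4 * k ^ 2 ≤ X ^ 2) (Z : Matrix ι ι ℝ)
    (hZ : ∀ i j, |Z i j - if i = j then X else 0| ≤ 1) : ExpandsBy (X ^ 2 / 4) Z := by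
  intro x
  set R : Matrix ι ι ℝ := Z.transpose - X • 1 with hR
  have hR1 : ∀ i j, R i j ^ 2 ≤ 1 := by
    intro i j
    have := hZ j i
    rw [sq_le_one_iff_abs_le_one]
    simpa [hR, Matrix.one_apply, eq_comm] using this
  have hF : ∑ i, ∑ j, R i j ^ 2 ≤ k ^ 2 := by
    calc ∑ i, ∑ j, R i j ^ 2 ≤ ∑ i : ι, ∑ j : ι, (1 : ℝ) :=
          Finset.sum_le_sum fun i _ => Finset.sum_le_sum fun j _ => hR1 i j
      _ = (Fintype.card ι : ℝ) ^ 2 := by simp [pow_two]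
      _ ≤ k ^ 2 := pow_le_pow_left₀ (by positivity) hk 2
  have hr := dotProduct_mulVec_self_le R x
  set y := Z.transpose.mulVec x
  set r := R.mulVec x
  have hxy : ∀ i, X * x i = y i - r i := by
    intro i
    have : r = y - X • x := by
      simp only [r, y, hR, Matrix.sub_mulVec, Matrix.smul_mulVec, Matrix.one_mulVec]
    rw [this]
    simp
  have h1 : X ^ 2 * (x ⬝ᵥ x) ≤ 2 * (y ⬝ᵥ y) + 2 * (r ⬝ᵥ r) := by
    simp only [dotProduct, Finset.mul_sum, ← Finset.sum_add_distrib]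
    refine Finset.sum_le_sum fun i _ => ?_
    have := hxy i
    have h2 : X ^ 2 * (x i * x i) = (y i - r i) ^ 2 := by rw [← this]; ring
    rw [h2]
    nlinarith [sq_nonneg (y i + r i)]
  have h0 : 0 ≤ x ⬝ᵥ x := dotProduct_self_nonneg x
  have h2 : r ⬝ᵥ r ≤ k ^ 2 * (x ⬝ᵥ x) := hr.trans (mul_le_mul_of_nonneg_right hF h0)
  nlinarith

/-- Lower bound for the upper tail of the smallest singular value of a square Gaussian matrix. -/
theorem stdPi_expandsBy_ge {K : ℝ} (hK : 1 ≤ K) (hι : (Fintype.card ι : ℝ) ≤ K) {l : ℝ}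
    (hl : 16 * K ^ 4 ≤ l) :
    ENNReal.ofReal (Real.exp (-(l / 2))) ≤
      stdPi (ι × ι) {z | ExpandsBy (l / (16 * K ^ 2)) (ofPairs z)} := by
  have hK4 : K ^ 2 ≤ K ^ 4 := pow_le_pow_right₀ hK (by norm_num)
  have hl0 : 0 ≤ l := le_trans (by positivity) hl
  -- The event used is a box: diagonal entries in `[X, X + 1]`, the others in `[0, 1]`. Each of the
  -- at most `K²` entries costs at most `X² + 3` in the exponent; since `K² X² = l/4` and `3 K² ≤
  -- l/4`, the total is at most `l/2`.
  set X := Real.sqrt (l / (4 * K ^ 2)) with hXdef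
  have hX0 : 0 ≤ X := Real.sqrt_nonneg _
  have hX2 : X ^ 2 = l / (4 * K ^ 2) := Real.sq_sqrt (by positivity)
  have hXK : X ^ 2 * K ^ 2 = l / 4 := by rw [hX2]; field_simp
  have h4 : 4 * K ^ 2 ≤ X ^ 2 := by
    rw [hX2, le_div_iff₀ (by positivity)]
    nlinarith
  set a : ι × ι → ℝ := fun q => if q.1 = q.2 then X else 0 with ha
  have ha0 : ∀ q, 0 ≤ a q := by intro q; simp only [ha]; split_ifs <;> simp [hX0]
  have haX : ∀ q, a q ≤ X := by intro q; simp only [ha]; split_ifs <;> simp [hX0]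
  have hsub : (Set.univ.pi fun q => Set.Icc (a q) (a q + 1)) ⊆
      {z | ExpandsBy (l / (16 * K ^ 2)) (ofPairs z)} := by
    intro z hz
    have := expandsBy_of_near_scalar (ι := ι) hι h4 (ofPairs z) (by
      intro i j
      have h := hz (i, j) (Set.mem_univ _)
      simp only [ha, Set.mem_Icc] at h
      simp only [ofPairs, Matrix.of_apply]
      rw [abs_le]
      constructor <;> linarith [h.1, h.2])
    refine this.mono (le_of_eq ?_)
    rw [hX2]
    field_simp
    norm_num
  refine le_trans ?_ (measure_mono hsub)
  rw [Measure.pi_pi]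
  calc ENNReal.ofReal (Real.exp (-(l / 2)))
      ≤ ENNReal.ofReal (Real.exp (-((X + 1) ^ 2 / 2 + 2))) ^ Fintype.card (ι × ι) := by
        rw [← ENNReal.ofReal_pow (Real.exp_nonneg _), ← Real.exp_nat_mul]
        refine ENNReal.ofReal_le_ofReal (Real.exp_le_exp.2 ?_)
        have hc : ((Fintype.card (ι × ι) : ℕ) : ℝ) ≤ K ^ 2 := by
          rw [Fintype.card_prod, Nat.cast_mul, pow_two]
          exact mul_le_mul hι hι (by positivity) (by positivity)
        have h5 : (X + 1) ^ 2 / 2 + 2 ≤ X ^ 2 + 3 := by nlinarith [sq_nonneg (X - 1)]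
        have h6 : ((Fintype.card (ι × ι) : ℕ) : ℝ) * ((X + 1) ^ 2 / 2 + 2) ≤ K ^ 2 * (X ^ 2 + 3) :=
          mul_le_mul hc h5 (by positivity) (by positivity)
        nlinarith
    _ = ∏ _q : ι × ι, ENNReal.ofReal (Real.exp (-((X + 1) ^ 2 / 2 + 2))) := by
        rw [Finset.prod_const, Finset.card_univ]
    _ ≤ _ := by
        refine Finset.prod_le_prod' fun q _ => le_trans ?_ (gaussianReal_Icc_ge (ha0 q))
        refine ENNReal.ofReal_le_ofReal (Real.exp_le_exp.2 (neg_le_neg ?_))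
        have := pow_le_pow_left₀ (by linarith [ha0 q]) (add_le_add_left (haX q) 1) 2
        linarith

end SquareBlocks

/-! ### Independent square blocks inside the projected sketches -/

section Blocks

variable {α β ι ν π : Type*} [Fintype α] [Fintype β] [Fintype ι] [Fintype ν] [Fintype π]
  [DecidableEq α] [DecidableEq β] [DecidableEq ι] [DecidableEq π]

/-- The `a`-th matrix of a family given by all its entries. -/
def sketch (G : α × ν × π → ℝ) (a : α) : Matrix ν π ℝ := Matrix.of fun l s => G (a, l, s)

/-- Square blocks of the matrices `O * sketch G a`, the columns being chosen by `emb`. -/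
def blocks (O : Matrix ι ν ℝ) (emb : β × ι → π) (G : α × ν × π → ℝ) (c : α × β) (q : ι × ι) : ℝ :=
  (O * sketch G c.1) q.1 (emb (c.2, q.2))

omit [Fintype α] [Fintype β] [Fintype ι] [Fintype π] [DecidableEq α] [DecidableEq β]
  [DecidableEq ι] [DecidableEq π] in
theorem measurable_blocks (O : Matrix ι ν ℝ) (emb : β × ι → π) :
    Measurable (blocks (α := α) O emb) := by
  refine measurable_pi_lambda _ fun c => measurable_pi_lambda _ fun q => ?_
  simp only [blocks, Matrix.mul_apply, sketch, Matrix.of_apply]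
  fun_prop

/-- All block entries together are one linear image of all sketch entries. The rows of this map are
orthonormal, because those of `O` are and distinct block columns use distinct sketch columns, so
rotation invariance gives independence of the blocks. -/
theorem map_blocks_stdPi (O : Matrix ι ν ℝ) (hO : O * O.transpose = 1) (emb : β × ι → π)
    (hemb : Function.Injective emb) :
    (stdPi (α × ν × π)).map (blocks O emb) = Measure.pi fun _ : α × β => stdPi (ι × ι) := by
  set A : Matrix ((α × β) × (ι × ι)) (α × ν × π) ℝ := Matrix.of fun r s =>
    if r.1.1 = s.1 then (if emb (r.1.2, r.2.2) = s.2.2 then O r.2.1 s.2.1 else 0) else 0 with hA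
  have hA1 : A * A.transpose = 1 := by
    ext ⟨⟨a, b⟩, ⟨i, j⟩⟩ ⟨⟨a', b'⟩, ⟨i', j'⟩⟩
    have hOO := congrFun (congrFun hO i) i'
    simp only [Matrix.mul_apply, Matrix.transpose_apply] at hOO
    simp only [Matrix.mul_apply, Matrix.transpose_apply, hA, Matrix.of_apply,
      Fintype.sum_prod_type, Matrix.one_apply, Prod.mk.injEq, ite_mul, zero_mul, mul_ite, mul_zero]
    rw [Finset.sum_eq_single a (by
      intro x _ hx
      simp [Ne.symm hx]) (by simp)]
    by_cases ha : a' = a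
    · subst ha
      by_cases hbj : emb (b', j') = emb (b, j)
      · have hbj' := hemb hbj
        rw [Prod.mk.injEq] at hbj'
        obtain ⟨rfl, rfl⟩ := hbj'
        simp [hOO, Matrix.one_apply]
      · have : ¬ (b = b' ∧ j = j') := by rintro ⟨rfl, rfl⟩; exact hbj rfl
        rw [if_neg (by tauto)]
        simp [Ne.symm hbj]
    · simp [ha, Ne.symm ha]
  have hcomp : blocks (α := α) O emb = Function.curry ∘ A.mulVec := by
    funext G ⟨a, b⟩ ⟨i, j⟩
    simp only [blocks, Matrix.mul_apply, sketch, Matrix.of_apply, Function.comp, Function.curry,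
      Matrix.mulVec, dotProduct, hA, Fintype.sum_prod_type, ite_mul, zero_mul]
    rw [Finset.sum_eq_single a (by
      intro x _ hx
      simp [Ne.symm hx]) (by simp)]
    simp
  have hm : Measurable A.mulVec := by
    refine measurable_pi_lambda _ fun i => ?_
    simp only [Matrix.mulVec, dotProduct]
    fun_prop
  rw [hcomp, ← Measure.map_map measurable_curry hm, map_mulVec_stdPi A hA1, map_curry_stdPi]

-- The quantity `|Zᵀ x|²` is a sum over columns. The blocks occupy disjoint sets of columns, so each
-- expanding block contributes `t |x|²` and the rest contribute nonnegative terms.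
open Classical in
omit [DecidableEq α] [DecidableEq β] [DecidableEq ι] [DecidableEq π] [Fintype α] in
theorem expandsBy_of_blocks (O : Matrix ι ν ℝ) (emb : β × ι → π)
    (hemb : Function.Injective emb) (G : α × ν × π → ℝ) (a : α) (t : ℝ) :
    ExpandsBy ((Finset.univ.filter fun b : β => ExpandsBy t (ofPairs (blocks O emb G (a, b)))).card
      * t) (O * sketch G a) := by
  intro x
  set y := (O * sketch G a).transpose.mulVec x with hy
  have hblk : ∀ b j, (ofPairs (blocks O emb G (a, b))).transpose.mulVec x j = y (emb (b, j)) := by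
    intro b j
    simp only [hy, Matrix.mulVec, dotProduct, ofPairs, blocks, Matrix.transpose_apply,
      Matrix.of_apply]
  calc _ = ∑ b ∈ Finset.univ.filter fun b : β => ExpandsBy t (ofPairs (blocks O emb G (a, b))),
        t * (x ⬝ᵥ x) := by simp [mul_assoc]
    _ ≤ ∑ b ∈ Finset.univ.filter fun b : β => ExpandsBy t (ofPairs (blocks O emb G (a, b))),
        ∑ j, y (emb (b, j)) * y (emb (b, j)) := by
        refine Finset.sum_le_sum fun b hb => ?_
        have := (Finset.mem_filter.1 hb).2 x
        simpa only [dotProduct, hblk] using this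
    _ ≤ ∑ b, ∑ j, y (emb (b, j)) * y (emb (b, j)) :=
        Finset.sum_le_sum_of_subset_of_nonneg (Finset.filter_subset _ _) fun _ _ _ =>
          Finset.sum_nonneg fun _ _ => mul_self_nonneg _
    _ = ∑ s ∈ Finset.univ.map ⟨emb, hemb⟩, y s * y s := by
        rw [Finset.sum_map, Fintype.sum_prod_type]
        rfl
    _ ≤ y ⬝ᵥ y :=
        Finset.sum_le_sum_of_subset_of_nonneg (Finset.subset_univ _) fun _ _ _ => mul_self_nonneg _

end Blocks

open Classical in
/-- Among independent events of small probability, rarely at least half of them occur. -/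
theorem pi_half_mem_le {κ X : Type*} [Fintype κ] [MeasurableSpace X] (μ : Measure X)
    [IsProbabilityMeasure μ] (B : Set X) {q : ℝ} (hq0 : 0 ≤ q) (hq1 : q ≤ 1)
    (hB : μ B ≤ ENNReal.ofReal (q ^ 2)) :
    (Measure.pi fun _ : κ => μ)
      {z | Fintype.card κ ≤ 2 * (Finset.univ.filter fun c => z c ∈ B).card} ≤
        ENNReal.ofReal ((2 * q) ^ Fintype.card κ) := by
  -- Union bound over the set `S` of occurring indices: at most `2^|κ|` choices, each of probability
  -- at most `(q²)^|S| ≤ q^|κ|` by independence.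
  set D : Finset (Finset κ) := Finset.univ.filter fun S => Fintype.card κ ≤ 2 * S.card
  have hsub : {z : κ → X | Fintype.card κ ≤ 2 * (Finset.univ.filter fun c => z c ∈ B).card} ⊆
      ⋃ S ∈ D, (S : Set κ).pi fun _ => B := by
    intro z hz
    simp only [Set.mem_iUnion]
    refine ⟨Finset.univ.filter fun c => z c ∈ B, by simpa [D] using hz, ?_⟩
    intro c hc
    simpa using hc
  refine (measure_mono hsub).trans ((measure_biUnion_finset_le _ _).trans ?_)
  have hS : ∀ S ∈ D, (Measure.pi fun _ : κ => μ) ((S : Set κ).pi fun _ => B) ≤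
      ENNReal.ofReal (q ^ Fintype.card κ) := by
    intro S hS
    have hS' : Fintype.card κ ≤ 2 * S.card := (Finset.mem_filter.1 hS).2
    rw [Measure.pi_pi_finset]
    rw [Finset.prod_const]
    calc μ B ^ S.card ≤ ENNReal.ofReal (q ^ 2) ^ S.card := pow_le_pow_left' hB _
      _ = ENNReal.ofReal (q ^ (2 * S.card)) := by
          rw [← ENNReal.ofReal_pow (by positivity), pow_mul]
      _ ≤ _ := ENNReal.ofReal_le_ofReal (pow_le_pow_of_le_one hq0 hq1 hS')
  refine (Finset.sum_le_sum hS).trans ?_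
  rw [Finset.sum_const, nsmul_eq_mul, mul_pow, ENNReal.ofReal_mul (by positivity)]
  gcongr
  rw [← ENNReal.ofReal_natCast]
  refine ENNReal.ofReal_le_ofReal ?_
  have : D.card ≤ 2 ^ Fintype.card κ := by
    refine (Finset.card_le_univ D).trans_eq ?_
    simp
  exact_mod_cast this

/-! ### The best of many sketches has a large `k`-th singular value -/

section Sketches

variable {n N p k : ℕ}

/-- Each projected sketch contains `m` independent square blocks. If at least half of them expand by
`η`, the sketch expands by `m η / 2`; if no sketch does, at least half of all `N m` independent
blocks are bad. -/
theorem stdPi_no_expanding_sketch_le_of_small_ball (O : Matrix (Fin k) (Fin n) ℝ)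
    (hO : O * O.transpose = 1) {m : ℕ} (hm : m * k ≤ p) {η q : ℝ} (hη : 0 ≤ η) (hq0 : 0 ≤ q)
    (hq1 : q ≤ 1)
    (hq : stdPi (Fin k × Fin k) {z | ¬ ExpandsBy η (ofPairs z)} ≤ ENNReal.ofReal (q ^ 2)) :
    stdPi (Fin N × Fin n × Fin p) {G | ¬ ∃ a, ExpandsBy (m / 2 * η) (O * sketch G a)} ≤
      ENNReal.ofReal ((2 * q) ^ (N * m)) := by
  classical
  set emb : Fin m × Fin k → Fin p := fun r => Fin.castLE hm (finProdFinEquiv r)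
  have hemb : Function.Injective emb :=
    (Fin.castLE_injective hm).comp finProdFinEquiv.injective
  have h1 := pi_half_mem_le (κ := Fin N × Fin m) (stdPi (Fin k × Fin k))
    {z | ¬ ExpandsBy η (ofPairs z)} hq0 hq1 hq
  rw [← map_blocks_stdPi O hO emb hemb] at h1
  have h2 := (le_trans (Measure.le_map_apply (measurable_blocks O emb).aemeasurable _) h1)
  rw [Fintype.card_prod, Fintype.card_fin, Fintype.card_fin] at h2
  refine le_trans (measure_mono fun G hG => ?_) h2
  have hG' : ∀ a, ¬ ExpandsBy (m / 2 * η) (O * sketch G a) := by simpa using hG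
  suffices h : N * m ≤ 2 * (Finset.univ.filter fun c =>
      ¬ ExpandsBy η (ofPairs (blocks O emb G c))).card by
    simpa only [Set.mem_preimage, Set.mem_ofPred_eq] using h
  have hbad : ∀ a : Fin N, m ≤ 2 * (Finset.univ.filter fun b : Fin m =>
      ¬ ExpandsBy η (ofPairs (blocks O emb G (a, b)))).card := by
    intro a
    by_contra hcon
    push Not at hcon
    refine hG' a ((expandsBy_of_blocks O emb hemb G a η).mono ?_)
    refine mul_le_mul_of_nonneg_right ?_ hη
    have hsum := Finset.card_filter_add_card_filter_not (s := (Finset.univ : Finset (Fin m)))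
      (fun b => ExpandsBy η (ofPairs (blocks O emb G (a, b))))
    rw [Finset.card_univ, Fintype.card_fin] at hsum
    have : m ≤ 2 * (Finset.univ.filter fun b : Fin m =>
      ExpandsBy η (ofPairs (blocks O emb G (a, b)))).card := by omega
    have h3 : (m : ℝ) ≤ 2 * ((Finset.univ.filter fun b : Fin m =>
      ExpandsBy η (ofPairs (blocks O emb G (a, b)))).card : ℝ) := by exact_mod_cast this
    linarith
  calc N * m = ∑ _a : Fin N, m := by simp
    _ ≤ ∑ a : Fin N, 2 * (Finset.univ.filter fun b : Fin m =>
      ¬ ExpandsBy η (ofPairs (blocks O emb G (a, b)))).card := Finset.sum_le_sum fun a _ => hbad a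
    _ = _ := by
      rw [← Finset.mul_sum]
      congr 1
      simp only [Finset.card_filter]
      rw [Fintype.sum_prod_type]

/-- One block per sketch suffices when `N` is huge. A block reaches the level of order `log N` with
probability at least `N^(-1/2)`, and `N` independent trials all fail with probability at most
`exp(-N · N^(-1/2))`. -/
theorem stdPi_no_expanding_sketch_le_of_large_ball (O : Matrix (Fin k) (Fin n) ℝ)
    (hO : O * O.transpose = 1) (hkp : k ≤ p) {K : ℝ} (hK : 1 ≤ K) (hkK : (k : ℝ) ≤ K)
    (hN : 16 * K ^ 4 ≤ Real.log N) :
    stdPi (Fin N × Fin n × Fin p)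
      {G | ¬ ∃ a, ExpandsBy (Real.log N / (16 * K ^ 2)) (O * sketch G a)} ≤
      ENNReal.ofReal (Real.exp (-Real.sqrt N)) := by
  classical
  have hlogpos : 0 < Real.log N := lt_of_lt_of_le (by positivity) hN
  have hN0 : (0 : ℝ) < N := by
    rcases Nat.eq_zero_or_pos N with h | h
    · rw [h] at hlogpos; simp at hlogpos
    · exact_mod_cast h
  set t := Real.log N / (16 * K ^ 2)
  set emb : Unit × Fin k → Fin p := fun r => Fin.castLE hkp r.2
  have hemb : Function.Injective emb := by
    rintro ⟨_, i⟩ ⟨_, j⟩ h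
    have := Fin.castLE_injective hkp h
    simp_all
  set Q : Set (Fin k × Fin k → ℝ) := {z | ExpandsBy t (ofPairs z)}
  have hQm : MeasurableSet Q := (isClosed_expandsBy _ _ continuous_ofPairs).measurableSet
  have hQ := stdPi_expandsBy_ge (ι := Fin k) hK (by simpa using hkK) hN
  have hQc : stdPi (Fin k × Fin k) Qᶜ ≤ ENNReal.ofReal (Real.exp (-Real.exp (-(Real.log N / 2)))) := by
    rw [prob_compl_eq_one_sub hQm]
    refine (tsub_le_tsub_left hQ 1).trans ?_
    rw [← ENNReal.ofReal_one, ← ENNReal.ofReal_sub _ (Real.exp_nonneg _)]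
    exact ENNReal.ofReal_le_ofReal (Real.one_sub_le_exp_neg _)
  have hpi : (Measure.pi fun _ : Fin N × Unit => stdPi (Fin k × Fin k))
      (Set.univ.pi fun _ => Qᶜ) ≤ ENNReal.ofReal (Real.exp (-Real.sqrt N)) := by
    rw [Measure.pi_pi, Finset.prod_const, Finset.card_univ, Fintype.card_prod, Fintype.card_fin,
      Fintype.card_unit, mul_one]
    refine (pow_le_pow_left' hQc _).trans ?_
    rw [← ENNReal.ofReal_pow (Real.exp_nonneg _), ← Real.exp_nat_mul]
    refine ENNReal.ofReal_le_ofReal (Real.exp_le_exp.2 (le_of_eq ?_))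
    rw [mul_neg, neg_inj, Real.exp_neg, Real.exp_half, Real.exp_log hN0, ← div_eq_mul_inv,
      Real.div_sqrt]
  rw [← map_blocks_stdPi O hO emb hemb] at hpi
  refine le_trans (measure_mono fun G hG => ?_)
    (le_trans (Measure.le_map_apply (measurable_blocks O emb).aemeasurable _) hpi)
  have hG' : ∀ a, ¬ ExpandsBy t (O * sketch G a) := by simpa using hG
  rintro ⟨a, b⟩ _ hab
  refine hG' a ((expandsBy_of_blocks O emb hemb G a t).mono ?_)
  have : (Finset.univ.filter fun b : Unit =>
      ExpandsBy t (ofPairs (blocks O emb G (a, b)))).card = 1 := by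
    rw [Finset.filter_true_of_mem, Finset.card_univ, Fintype.card_unit]
    intro b' _
    exact hab
  rw [this]
  simp

theorem exists_uniform_small_ball (K : ℕ) {q : ℝ} (hq : 0 < q) : ∃ η : ℝ, 0 < η ∧ ∀ k ≤ K,
    stdPi (Fin k × Fin k) {z | ¬ ExpandsBy η (ofPairs z)} ≤ ENNReal.ofReal q := by
  induction K with
  | zero =>
    obtain ⟨η, h1, h2⟩ := exists_stdPi_not_expandsBy_le (Fin 0) hq
    refine ⟨η, h1, fun k hk => ?_⟩
    obtain rfl : k = 0 := by omega
    exact h2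
  | succ K ih =>
    obtain ⟨η, h1, h2⟩ := ih
    obtain ⟨η', h1', h2'⟩ := exists_stdPi_not_expandsBy_le (Fin (K + 1)) hq
    refine ⟨min η η', lt_min h1 h1', fun k hk => ?_⟩
    rcases Nat.lt_or_ge K k with h | h
    · obtain rfl : k = K + 1 := by omega
      refine le_trans (measure_mono ?_) h2'
      exact fun z hz hz' => hz (hz'.mono (min_le_right _ _))
    · refine le_trans (measure_mono ?_) (h2 k h)
      exact fun z hz hz' => hz (hz'.mono (min_le_left _ _))

/-- The squared radius `4 (p + log N + 9 log n)` that bounds the squared lengths of the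
projections of `N` sketches. -/
noncomputable def sketchRadiusSq (n N p : ℕ) : ℝ :=
  4 * ((p : ℝ) + (Real.log N + 9 * Real.log n))

theorem vartheta_sq (p n : ℕ) (hn : 1 ≤ n) : vartheta p n ^ 2 = max 1 (Real.log n / p) := by
  have hl : 0 ≤ Real.log n := Real.log_nonneg (by exact_mod_cast hn)
  have h := (pow_left_monotoneOn (M₀ := ℝ) (n := 2)).map_max
    (Set.mem_ofPred.2 zero_le_one) (show Real.sqrt (Real.log n) / Real.sqrt p ∈ {a : ℝ | 0 ≤ a} from
      div_nonneg (Real.sqrt_nonneg _) (Real.sqrt_nonneg _))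
  rw [vartheta, h, one_pow, div_pow, Real.sq_sqrt hl, Real.sq_sqrt (Nat.cast_nonneg p)]

/-- With overwhelming probability one of the sketches, projected by a matrix with `k` orthonormal
rows, has a large `k`-th singular value, compared with the size of all of them. -/
theorem exists_expanding_sketch (K : ℕ) (hK : 1 ≤ K) {C : ℝ} (hC : 0 < C) :
    ∃ c : ℝ, 0 < c ∧ ∀ᶠ n : ℕ in atTop, ∀ k N p : ℕ, 1 ≤ k → k ≤ K → k ≤ p →
      C * (p : ℝ)⁻¹ * Real.log n ≤ N → ∀ O : Matrix (Fin k) (Fin n) ℝ, O * O.transpose = 1 →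
        stdPi (Fin N × Fin n × Fin p)
          {G | ¬ ∃ a, ExpandsBy (c * (sketchRadiusSq n N p / vartheta p n ^ 2)) (O * sketch G a)} ≤
          ENNReal.ofReal (1 / (n : ℝ) ^ 7) := by
  have hKr : (1 : ℝ) ≤ K := by exact_mod_cast hK
  -- Chosen so that `2 q = exp(-γ)` and, as the number of blocks is at least `C log n / (2K)`, the
  -- failure probability is at most `exp(-7 log n)`.
  set γ : ℝ := 14 * K / C with hγ
  have hγ0 : 0 < γ := by positivity
  set q : ℝ := Real.exp (-γ) / 2 with hqdef
  have hq0 : 0 < q := by positivity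
  have hq1 : q ≤ 1 := by
    have : Real.exp (-γ) ≤ 1 := Real.exp_le_one_iff.2 (by linarith)
    linarith
  obtain ⟨η, hη, hsmall⟩ := exists_uniform_small_ball K (q := q ^ 2) (by positivity)
  -- One entry for each regime below: the squared radius is at most `48 p ϑ²` in the first, with `p
  -- ≤ 2 K m`, and at most `26 log N` in the second.
  set c := min (η / (192 * K)) (1 / (26 * (16 * (K : ℝ) ^ 2))) with hc
  have hc0 : 0 < c := lt_min (by positivity) (by positivity)
  refine ⟨c, hc0, ?_⟩
  have hlog : Tendsto (fun n : ℕ => Real.log n) atTop atTop :=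
    Real.tendsto_log_atTop.comp tendsto_natCast_atTop_atTop
  have hlin : ∀ᶠ n : ℕ in atTop, 7 * Real.log n ≤ n := by
    have h := (Real.isLittleO_log_id_atTop.comp_tendsto tendsto_natCast_atTop_atTop).bound
      (show (0 : ℝ) < 1 / 7 by norm_num)
    filter_upwards [h, eventually_ge_atTop 1] with n h h1
    have h2 : 0 ≤ Real.log n := Real.log_nonneg (by exact_mod_cast h1)
    simp only [Function.comp, id, Real.norm_eq_abs, abs_of_nonneg h2, Nat.abs_cast] at h
    linarith
  filter_upwards [hlog.eventually_ge_atTop (8 * (K : ℝ) ^ 4), hlin, eventually_ge_atTop 2]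
    with n hn1 hn2 hn3 k N p hk hkK hkp hN O hO
  have hnr : (2 : ℝ) ≤ n := by exact_mod_cast hn3
  have hn0 : (0 : ℝ) < n := by linarith
  have hl0 : 0 < Real.log n := Real.log_pos (by linarith)
  have hp0 : (0 : ℝ) < p := by
    have : 1 ≤ p := hk.trans hkp
    exact_mod_cast this
  have hn7 : Real.exp (-(7 * Real.log n)) = 1 / (n : ℝ) ^ 7 := by
    rw [Real.exp_neg, show (7 : ℝ) * Real.log n = ((7 : ℕ) : ℝ) * Real.log n by norm_num,
      Real.exp_nat_mul, Real.exp_log hn0, one_div]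
  have hth := vartheta_sq p n (by omega)
  have hth1 : 1 ≤ vartheta p n ^ 2 := by rw [hth]; exact le_max_left _ _
  have hth2 : Real.log n ≤ p * vartheta p n ^ 2 := by
    rw [hth]
    calc Real.log n = p * (Real.log n / p) := by field_simp
      _ ≤ _ := mul_le_mul_of_nonneg_left (le_max_right _ _) hp0.le
  have hNpos : (0 : ℝ) < N := lt_of_lt_of_le (by positivity) hN
  have hN1 : (1 : ℝ) ≤ N := by exact_mod_cast (Nat.succ_le_of_lt (by exact_mod_cast hNpos))
  -- If `log N` is dominated by `log n` or by `p`, the squared radius is of order `p ϑ²`, and a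
  -- typical singular value squared, of order `p`, is enough.
  by_cases hreg : (N : ℝ) ≤ (n : ℝ) ^ 2 ∨ Real.log N ≤ p
  · set m := p / k with hm
    have hmk : m * k ≤ p := Nat.div_mul_le_self p k
    have hm1 : 1 ≤ m := Nat.div_pos hkp hk
    have hm2 : (p : ℝ) ≤ 2 * K * m := by
      have h1 : p < m * k + k := by
        rw [hm]
        have := Nat.lt_div_mul_add (a := p) (b := k) hk
        omega
      have h2 : p ≤ 2 * K * m := by nlinarith
      exact_mod_cast h2
    have hmain := stdPi_no_expanding_sketch_le_of_small_ball (N := N) O hO hmk hη.le hq0.le hq1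
      (hsmall k hkK)
    have hR : sketchRadiusSq n N p ≤ 48 * p * vartheta p n ^ 2 := by
      have hpt : (p : ℝ) ≤ p * vartheta p n ^ 2 := le_mul_of_one_le_right hp0.le hth1
      rw [sketchRadiusSq]
      rcases hreg with h | h
      · have : Real.log N ≤ 2 * Real.log n := by
          have := Real.log_le_log hNpos h
          rwa [Real.log_pow] at this
        nlinarith
      · nlinarith
    refine le_trans (measure_mono ?_) (hmain.trans ?_)
    · intro G hG hG'
      obtain ⟨a, ha⟩ := hG'
      refine hG ⟨a, ha.mono ?_⟩
      have h1 : sketchRadiusSq n N p / vartheta p n ^ 2 ≤ 48 * p := by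
        rwa [div_le_iff₀ (by positivity)]
      calc c * (sketchRadiusSq n N p / vartheta p n ^ 2)
          ≤ (η / (192 * K)) * (48 * (2 * K * m)) := by
            refine (mul_le_mul_of_nonneg_left h1 hc0.le).trans ?_
            refine mul_le_mul (min_le_left _ _) (by linarith) (by positivity) (by positivity)
        _ = m / 2 * η := by field_simp; norm_num
    · refine ENNReal.ofReal_le_ofReal ?_
      rw [← hn7, show 2 * q = Real.exp (-γ) by rw [hqdef]; ring, ← Real.exp_nat_mul]
      refine Real.exp_le_exp.2 ?_
      push_cast
      have h1 : C * Real.log n ≤ N * p := by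
        have := mul_le_mul_of_nonneg_right hN hp0.le
        calc C * Real.log n = C * (p : ℝ)⁻¹ * Real.log n * p := by field_simp
          _ ≤ _ := this
      have h2 : C * Real.log n ≤ N * (2 * K * m) :=
        h1.trans (mul_le_mul_of_nonneg_left hm2 hNpos.le)
      have h3 : γ * (N * m) = 7 / C * (N * (2 * K * m)) := by rw [hγ]; field_simp; ring
      have h4 : 7 * Real.log n = 7 / C * (C * Real.log n) := by field_simp
      have h5 : 7 / C * (C * Real.log n) ≤ 7 / C * (N * (2 * K * m)) :=
        mul_le_mul_of_nonneg_left h2 (by positivity)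
      nlinarith
  -- Now the squared radius is of order `log N`, which an exceptional sketch attains; `√N ≥ n ≥ 7
  -- log n` makes failure unlikely enough.
  · push Not at hreg
    obtain ⟨hreg1, hreg2⟩ := hreg
    have hlogN : 2 * Real.log n ≤ Real.log N := by
      have := Real.log_le_log (by positivity) hreg1.le
      rwa [Real.log_pow] at this
    have hmain := stdPi_no_expanding_sketch_le_of_large_ball (N := N) O hO hkp hKr
      (by exact_mod_cast hkK) (by linarith)
    refine le_trans (measure_mono ?_) (hmain.trans ?_)
    · intro G hG hG'
      obtain ⟨a, ha⟩ := hG'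
      refine hG ⟨a, ha.mono ?_⟩
      have hR : sketchRadiusSq n N p ≤ 26 * Real.log N := by
        rw [sketchRadiusSq]; linarith
      have hR2 : sketchRadiusSq n N p / vartheta p n ^ 2 ≤ 26 * Real.log N := by
        rw [div_le_iff₀ (by positivity)]
        refine hR.trans (le_mul_of_one_le_right (by linarith) hth1)
      calc c * (sketchRadiusSq n N p / vartheta p n ^ 2)
          ≤ (1 / (26 * (16 * (K : ℝ) ^ 2))) * (26 * Real.log N) := by
            refine (mul_le_mul_of_nonneg_left hR2 hc0.le).trans ?_
            exact mul_le_mul_of_nonneg_right (min_le_right _ _) (by linarith)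
        _ = _ := by field_simp
    · refine ENNReal.ofReal_le_ofReal ?_
      rw [← hn7]
      refine Real.exp_le_exp.2 (neg_le_neg (hn2.trans ?_))
      exact Real.le_sqrt_of_sq_le hreg1.le

end Sketches

/-! ### Euclidean, Frobenius and row norms -/

section Norms

variable {ι κ τ : Type*} [Fintype ι] [Fintype κ] [Fintype τ]

/-- The Euclidean norm. -/
noncomputable def nrm (v : ι → ℝ) : ℝ := ‖(WithLp.toLp 2 v : EuclideanSpace ℝ ι)‖

theorem nrm_nonneg (v : ι → ℝ) : 0 ≤ nrm v := norm_nonneg _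

theorem nrm_sq (v : ι → ℝ) : nrm v ^ 2 = v ⬝ᵥ v := by
  rw [nrm, EuclideanSpace.real_norm_sq_eq, dotProduct]
  simp [pow_two]

theorem nrm_eq_sqrt (v : ι → ℝ) : nrm v = Real.sqrt (v ⬝ᵥ v) := by
  rw [← nrm_sq, Real.sqrt_sq (nrm_nonneg v)]

theorem nrm_add_le (v w : ι → ℝ) : nrm (v + w) ≤ nrm v + nrm w := by
  rw [nrm, WithLp.toLp_add]
  exact norm_add_le _ _

theorem nrm_neg (v : ι → ℝ) : nrm (-v) = nrm v := by
  rw [nrm, WithLp.toLp_neg, norm_neg, nrm]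

theorem nrm_sub_le (v w : ι → ℝ) : nrm (v - w) ≤ nrm v + nrm w := by
  rw [sub_eq_add_neg, ← nrm_neg w]
  exact nrm_add_le _ _

theorem nrm_sum_le {α : Type*} (s : Finset α) (f : α → ι → ℝ) :
    nrm (∑ a ∈ s, f a) ≤ ∑ a ∈ s, nrm (f a) := by
  simp only [nrm, WithLp.toLp_sum]
  exact norm_sum_le _ _

theorem nrm_le_of_sq_le {v : ι → ℝ} {c : ℝ} (hc : 0 ≤ c) (h : v ⬝ᵥ v ≤ c ^ 2) : nrm v ≤ c := by
  rw [nrm_eq_sqrt]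
  exact Real.sqrt_le_iff.2 ⟨hc, h⟩

theorem abs_dotProduct_le (v w : ι → ℝ) : |v ⬝ᵥ w| ≤ nrm v * nrm w := by
  have := abs_real_inner_le_norm (WithLp.toLp 2 w : EuclideanSpace ℝ ι) (WithLp.toLp 2 v)
  rw [EuclideanSpace.inner_eq_star_dotProduct] at this
  simpa [nrm, mul_comm] using this

theorem abs_apply_le_nrm (v : ι → ℝ) (i : ι) : |v i| ≤ nrm v := by
  rw [nrm_eq_sqrt]
  refine Real.abs_le_sqrt ?_
  rw [pow_two, dotProduct]
  exact Finset.single_le_sum (f := fun i => v i * v i) (fun j _ => mul_self_nonneg _)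
    (Finset.mem_univ i)

/-- The Frobenius norm. -/
noncomputable def fro (A : Matrix ι κ ℝ) : ℝ := nrm fun q : ι × κ => A q.1 q.2

theorem fro_nonneg (A : Matrix ι κ ℝ) : 0 ≤ fro A := nrm_nonneg _

theorem fro_sq (A : Matrix ι κ ℝ) : fro A ^ 2 = ∑ i, nrm (A i) ^ 2 := by
  simp only [fro, nrm_sq, dotProduct, Fintype.sum_prod_type]

theorem fro_transpose (A : Matrix ι κ ℝ) : fro A.transpose = fro A := by
  have : fro A.transpose ^ 2 = fro A ^ 2 := by
    simp only [fro, nrm_sq, dotProduct, Fintype.sum_prod_type, Matrix.transpose_apply]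
    exact Finset.sum_comm
  exact (pow_left_inj₀ (fro_nonneg _) (fro_nonneg _) two_ne_zero).1 this

theorem fro_add_le (A B : Matrix ι κ ℝ) : fro (A + B) ≤ fro A + fro B :=
  nrm_add_le (fun q : ι × κ => A q.1 q.2) fun q => B q.1 q.2

theorem fro_sum_le {α : Type*} (s : Finset α) (f : α → Matrix ι κ ℝ) :
    fro (∑ a ∈ s, f a) ≤ ∑ a ∈ s, fro (f a) := by
  have := nrm_sum_le s fun a (q : ι × κ) => f a q.1 q.2
  have h : (fun q : ι × κ => (∑ a ∈ s, f a) q.1 q.2) = ∑ a ∈ s, fun q => f a q.1 q.2 := by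
    ext q
    simp [Matrix.sum_apply]
  rwa [← h] at this

theorem nrm_mulVec_le (A : Matrix ι κ ℝ) (y : κ → ℝ) : nrm (A.mulVec y) ≤ fro A * nrm y := by
  refine nrm_le_of_sq_le (mul_nonneg (fro_nonneg _) (nrm_nonneg _)) ?_
  refine (dotProduct_mulVec_self_le A y).trans_eq ?_
  rw [mul_pow, fro_sq, nrm_sq]
  simp only [fun i => nrm_sq (A i), dotProduct, pow_two]

theorem nrm_vecMul_le (y : ι → ℝ) (A : Matrix ι κ ℝ) : nrm (Matrix.vecMul y A) ≤ nrm y * fro A := by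
  rw [← Matrix.mulVec_transpose, mul_comm, ← fro_transpose]
  exact nrm_mulVec_le _ _

theorem fro_le_of_rows {A : Matrix ι κ ℝ} {c : ℝ} (hc : 0 ≤ c) (h : ∀ i, nrm (A i) ≤ c) :
    fro A ≤ Real.sqrt (Fintype.card ι) * c := by
  refine (pow_le_pow_iff_left₀ (fro_nonneg _) (by positivity) two_ne_zero).1 ?_
  rw [fro_sq, mul_pow, Real.sq_sqrt (Nat.cast_nonneg _)]
  calc ∑ i, nrm (A i) ^ 2 ≤ ∑ _i : ι, c ^ 2 :=
        Finset.sum_le_sum fun i _ => pow_le_pow_left₀ (nrm_nonneg _) (h i) 2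
    _ = _ := by simp

omit [Fintype ι] in
theorem nrm_mul_row_le (A : Matrix ι κ ℝ) (B : Matrix κ τ ℝ) (i : ι) :
    nrm ((A * B) i) ≤ nrm (A i) * fro B := by
  rw [Matrix.mul_apply_eq_vecMul]
  exact nrm_vecMul_le _ _

theorem fro_mul_le (A : Matrix ι κ ℝ) (B : Matrix κ τ ℝ) : fro (A * B) ≤ fro A * fro B := by
  refine (pow_le_pow_iff_left₀ (fro_nonneg _)
    (mul_nonneg (fro_nonneg _) (fro_nonneg _)) two_ne_zero).1 ?_
  rw [mul_pow, fro_sq, fro_sq A, Finset.sum_mul]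
  refine Finset.sum_le_sum fun i _ => ?_
  rw [← mul_pow]
  exact pow_le_pow_left₀ (nrm_nonneg _) (nrm_mul_row_le A B i) 2

theorem nrm_mulVec_of_orthonormal [DecidableEq κ] {U : Matrix ι κ ℝ} (hU : U.transpose * U = 1)
    (x : κ → ℝ) : nrm (U.mulVec x) = nrm x := by
  rw [nrm_eq_sqrt, nrm_eq_sqrt]
  congr 1
  rw [Matrix.dotProduct_mulVec, ← Matrix.mulVec_transpose, Matrix.mulVec_mulVec, hU,
    Matrix.one_mulVec]

theorem fro_of_orthonormal [DecidableEq κ] {U : Matrix ι κ ℝ} (hU : U.transpose * U = 1) :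
    fro U = Real.sqrt (Fintype.card κ) := by
  rw [← fro_transpose, ← Real.sqrt_sq (fro_nonneg _), fro_sq]
  congr 1
  have : ∀ j, nrm (U.transpose j) ^ 2 = 1 := by
    intro j
    have := congrFun (congrFun hU j) j
    rw [Matrix.one_apply_eq] at this
    rw [nrm_sq, ← this]
    rfl
  simp [this]

theorem fro_le_of_mulVec [DecidableEq κ] {A : Matrix ι κ ℝ} {c : ℝ} (hc : 0 ≤ c)
    (h : ∀ x, nrm (A.mulVec x) ≤ c * nrm x) : fro A ≤ Real.sqrt (Fintype.card κ) * c := by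
  rw [← fro_transpose]
  refine fro_le_of_rows hc fun j => ?_
  have := h (Pi.single j 1)
  have h1 : nrm (Pi.single j (1 : ℝ)) = 1 := by
    rw [nrm_eq_sqrt]
    simp
  rw [h1, mul_one, Matrix.mulVec_single_one] at this
  exact this

end Norms

/-- The telescoping expansion of a power of a noncommutative sum. -/
theorem add_pow_telescope {R : Type*} [Ring R] (x y : R) (g : ℕ) :
    (x + y) ^ g = ∑ h ∈ Finset.range g, y ^ h * x * (x + y) ^ (g - 1 - h) + y ^ g := by
  induction g with
  | zero => simp
  | succ g ih =>
    rw [Finset.sum_range_succ', pow_succ', add_mul]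
    nth_rewrite 2 [ih]
    rw [mul_add, Finset.mul_sum, ← pow_succ']
    have : ∀ h ∈ Finset.range g, y * (y ^ h * x * (x + y) ^ (g - 1 - h)) =
        y ^ (h + 1) * x * (x + y) ^ (g + 1 - 1 - (h + 1)) := by
      intro h _
      rw [show g + 1 - 1 - (h + 1) = g - 1 - h by omega, pow_succ' y h]
      simp only [mul_assoc]
    rw [Finset.sum_congr rfl this]
    simp only [pow_zero, one_mul, Nat.add_sub_cancel, Nat.sub_zero]
    abel

/-! ### Deterministic entrywise bound from the telescoping expansion -/

section Entrywise

variable {n k p g : ℕ}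

set_option maxHeartbeats 1000000 in
/-- The entrywise error bound for the projection onto the range of `Uhat = Mhat ^ g * G * F`, given
row-wise bounds for the terms of the expansion of `Mhat ^ g`. -/
theorem abs_proj_mul_sub_le {U Uhat : Matrix (Fin n) (Fin k) ℝ} {lam : Fin k → ℝ}
    {M E : Matrix (Fin n) (Fin n) ℝ} {G : Matrix (Fin n) (Fin p) ℝ} {F : Matrix (Fin p) (Fin k) ℝ}
    (hg : 1 ≤ g)
    (hU : U.transpose * U = 1) (hM : M = U * Matrix.diagonal lam * U.transpose)
    (hE : E.IsSymm) (hUhat : Uhat = (M + E) ^ g * G * F) (hUo : Uhat.transpose * Uhat = 1)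
    {L e ℓ u θ A : ℝ} (hL : 0 < L) (he : 0 < e) (hℓ : 1 ≤ ℓ) (hu : 0 < u) (hθ : 1 ≤ θ) (hA : 1 ≤ A)
    (hlam : ∀ j, |lam j| ≤ L) (hkA : Real.sqrt k ≤ A) (hrow : ∀ i, nrm (U i) ≤ u)
    (hEU : ∀ h, 1 ≤ h → h ≤ g → ∀ i, nrm ((E ^ h * U) i) ≤ A * e ^ h * ℓ ^ h * u)
    (hEUfro : ∀ h, fro (E ^ h * U) ≤ A * e ^ h)
    (hD : ∀ h < g, fro (Matrix.diagonal lam * U.transpose * (M + E) ^ (g - 1 - h) * G * F) ≤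
      A * θ / L ^ h)
    (hEG : ∀ i, nrm ((E ^ g * G * F) i) ≤ A * (e / L) ^ g * θ)
    (hEG' : ∀ i, nrm ((E ^ (g + 1) * G * F) i) ≤ A * e * (e / L) ^ g * θ)
    (hρu : (e / L) ^ (g - 1) ≤ A * u) (hρn : Real.sqrt n * (e / L) ^ (g - 1) ≤ A)
    (hsmall : g * A ^ 2 * (e / L * ℓ * θ) ≤ 1 / 2) (i j : Fin n) :
    |(Uhat * Uhat.transpose * (M + E) - M) i j| ≤ 17 * g * A ^ 5 * (ℓ * θ * e * u ^ 2) := by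
  set ρ := e / L with hρ
  have hρ0 : 0 < ρ := div_pos he hL
  have hgr : (1 : ℝ) ≤ g := by exact_mod_cast hg
  have hA0 : 0 < A := by linarith
  have hA2 : 1 ≤ A ^ 2 := one_le_pow₀ hA
  have hθ0 : 0 < θ := by linarith
  have hℓ0 : 0 < ℓ := by linarith
  have hρℓθ : ρ * ℓ * θ ≤ 1 / 2 := by
    have : 1 ≤ g * A ^ 2 := by nlinarith
    have h0 : 0 < ρ * ℓ * θ := by positivity
    nlinarith
  have hρℓ : ρ * ℓ ≤ 1 := by
    have : ρ * ℓ ≤ ρ * ℓ * θ := le_mul_of_one_le_right (by positivity) hθ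
    linarith
  have hρ1 : ρ ≤ 1 := by
    have : ρ ≤ ρ * ℓ := le_mul_of_one_le_right (by positivity) hℓ
    linarith
  set D : ℕ → Matrix (Fin k) (Fin k) ℝ := fun h =>
    Matrix.diagonal lam * U.transpose * (M + E) ^ (g - 1 - h) * G * F with hDdef
  set Err : Matrix (Fin n) (Fin k) ℝ :=
    ∑ h ∈ Finset.Ico 1 g, E ^ h * U * D h + E ^ g * G * F with hErr
  -- The term `h = 0` is the signal part: it carries no noise power in front of `U`.
  have hdec : Uhat = U * D 0 + Err := by
    rw [hUhat, add_pow_telescope, Matrix.add_mul, Matrix.add_mul, hErr, ← add_assoc]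
    congr 1
    rw [Matrix.sum_mul, Matrix.sum_mul, Finset.range_eq_Ico, Finset.sum_eq_sum_Ico_succ_bot hg]
    have hterm : ∀ h, E ^ h * M * (M + E) ^ (g - 1 - h) * G * F = E ^ h * U * D h := by
      intro h
      have : E ^ h * M = E ^ h * U * Matrix.diagonal lam * U.transpose := by
        rw [hM]; simp only [Matrix.mul_assoc]
      rw [this]
      simp only [hDdef, Matrix.mul_assoc]
    rw [Finset.sum_congr rfl fun h _ => hterm h, hterm 0, pow_zero, Matrix.one_mul]
  -- Multiplication by `E` only raises each exponent by one. Since `h + 1 ≤ g`, the row bounds still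
  -- apply, and the remainder needs the separate bound for `E ^ (g + 1)`.
  have hEErr : E * Err = ∑ h ∈ Finset.Ico 1 g, E ^ (h + 1) * U * D h + E ^ (g + 1) * G * F := by
    rw [hErr, Matrix.mul_add, Matrix.mul_sum]
    congr 1
    · refine Finset.sum_congr rfl fun h _ => ?_
      rw [pow_succ']; simp only [Matrix.mul_assoc]
    · rw [pow_succ']; simp only [Matrix.mul_assoc]
  have hpow : ∀ h, 1 ≤ h → (ρ * ℓ) ^ h ≤ ρ * ℓ := fun h hh =>
    (pow_le_pow_of_le_one (by positivity) hρℓ hh).trans_eq (pow_one _)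
  have hpowρ : ∀ h, 1 ≤ h → ρ ^ h ≤ ρ := fun h hh =>
    (pow_le_pow_of_le_one (by positivity) hρ1 hh).trans_eq (pow_one _)
  have hρg : ρ ^ g = ρ * ρ ^ (g - 1) := by
    rw [← pow_succ']; congr 1; omega
  -- This absorbs the remainder, which has no row-wise delocalization of its own, into the size of
  -- the other error terms.
  have hρgu : ρ ^ g ≤ ρ * ℓ * (A * u) := by
    rw [hρg, mul_assoc]
    refine mul_le_mul_of_nonneg_left (hρu.trans ?_) hρ0.le
    exact le_mul_of_one_le_left (by positivity) hℓ
  have hcard : ((Finset.Ico 1 g).card : ℝ) = g - 1 := by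
    rw [Nat.card_Ico, Nat.cast_sub hg, Nat.cast_one]
  have hErow : ∀ i, nrm (Err i) ≤ g * A ^ 2 * (ρ * ℓ * θ) * u := by
    intro i
    have h1 : nrm (Err i) ≤ ∑ h ∈ Finset.Ico 1 g, nrm ((E ^ h * U * D h) i) +
        nrm ((E ^ g * G * F) i) := by
      have : Err i = ∑ h ∈ Finset.Ico 1 g, (E ^ h * U * D h) i + (E ^ g * G * F) i := by
        rw [hErr]; ext c; simp [Matrix.sum_apply]
      rw [this]
      exact (nrm_add_le _ _).trans (add_le_add (nrm_sum_le _ _) le_rfl)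
    have h2 : ∀ h ∈ Finset.Ico 1 g, nrm ((E ^ h * U * D h) i) ≤ A ^ 2 * (ρ * ℓ * θ) * u := by
      intro h hh
      rw [Finset.mem_Ico] at hh
      refine (nrm_mul_row_le _ _ _).trans ?_
      calc nrm ((E ^ h * U) i) * fro (D h) ≤ (A * e ^ h * ℓ ^ h * u) * (A * θ / L ^ h) :=
            mul_le_mul (hEU h hh.1 hh.2.le i) (hD h hh.2) (fro_nonneg _) (by positivity)
        _ = A ^ 2 * ((ρ * ℓ) ^ h * θ) * u := by rw [hρ, mul_pow, div_pow]; field_simp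
        _ ≤ _ := by gcongr; exact hpow h hh.1
    have h3 := Finset.sum_le_sum h2
    rw [Finset.sum_const, nsmul_eq_mul, hcard] at h3
    have h4 : A * ρ ^ g * θ ≤ A ^ 2 * (ρ * ℓ * θ) * u := by
      calc A * ρ ^ g * θ ≤ A * (ρ * ℓ * (A * u)) * θ := by gcongr
        _ = _ := by ring
    have h5 := hEG i
    linarith
  have hEfro : fro Err ≤ g * A ^ 2 * (ρ * θ) := by
    have h1 := (fro_add_le (∑ h ∈ Finset.Ico 1 g, E ^ h * U * D h) (E ^ g * G * F)).trans
      (add_le_add (fro_sum_le _ _) le_rfl)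
    have h2 : ∀ h ∈ Finset.Ico 1 g, fro (E ^ h * U * D h) ≤ A ^ 2 * (ρ * θ) := by
      intro h hh
      rw [Finset.mem_Ico] at hh
      refine (fro_mul_le _ _).trans ?_
      calc fro (E ^ h * U) * fro (D h) ≤ (A * e ^ h) * (A * θ / L ^ h) :=
            mul_le_mul (hEUfro h) (hD h hh.2) (fro_nonneg _) (by positivity)
        _ = A ^ 2 * (ρ ^ h * θ) := by rw [hρ, div_pow]; field_simp
        _ ≤ _ := by gcongr; exact hpowρ h hh.1
    have h3 := Finset.sum_le_sum h2
    rw [Finset.sum_const, nsmul_eq_mul, hcard] at h3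
    have h4 : fro (E ^ g * G * F) ≤ A ^ 2 * (ρ * θ) := by
      refine (fro_le_of_rows (by positivity) hEG).trans ?_
      rw [Fintype.card_fin]
      calc Real.sqrt n * (A * ρ ^ g * θ) = A * ρ * θ * (Real.sqrt n * ρ ^ (g - 1)) := by
            rw [hρg]; ring
        _ ≤ A * ρ * θ * A := by gcongr
        _ = _ := by ring
    linarith
  have hEErow : ∀ i, nrm ((E * Err) i) ≤ e * ℓ * (g * A ^ 2 * (ρ * ℓ * θ)) * u := by
    intro i
    have h1 : nrm ((E * Err) i) ≤ ∑ h ∈ Finset.Ico 1 g, nrm ((E ^ (h + 1) * U * D h) i) +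
        nrm ((E ^ (g + 1) * G * F) i) := by
      have : (E * Err) i =
          ∑ h ∈ Finset.Ico 1 g, (E ^ (h + 1) * U * D h) i + (E ^ (g + 1) * G * F) i := by
        rw [hEErr]; ext c; simp [Matrix.sum_apply]
      rw [this]
      exact (nrm_add_le _ _).trans (add_le_add (nrm_sum_le _ _) le_rfl)
    have h2 : ∀ h ∈ Finset.Ico 1 g, nrm ((E ^ (h + 1) * U * D h) i) ≤
        e * ℓ * (A ^ 2 * (ρ * ℓ * θ)) * u := by
      intro h hh
      rw [Finset.mem_Ico] at hh
      refine (nrm_mul_row_le _ _ _).trans ?_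
      calc nrm ((E ^ (h + 1) * U) i) * fro (D h)
          ≤ (A * e ^ (h + 1) * ℓ ^ (h + 1) * u) * (A * θ / L ^ h) :=
            mul_le_mul (hEU (h + 1) (by omega) (by omega) i) (hD h hh.2) (fro_nonneg _)
              (by positivity)
        _ = e * ℓ * (A ^ 2 * ((ρ * ℓ) ^ h * θ)) * u := by
            rw [hρ, mul_pow, div_pow, pow_succ, pow_succ]; field_simp
        _ ≤ _ := by gcongr; exact hpow h hh.1
    have h3 := Finset.sum_le_sum h2
    rw [Finset.sum_const, nsmul_eq_mul, hcard] at h3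
    have h4 : A * e * ρ ^ g * θ ≤ e * ℓ * (A ^ 2 * (ρ * ℓ * θ)) * u := by
      calc A * e * ρ ^ g * θ ≤ A * e * (ρ * ℓ * (A * u)) * θ := by gcongr
        _ = 1 * (e * (A ^ 2 * (ρ * ℓ * θ)) * u) := by ring
        _ ≤ ℓ * (e * (A ^ 2 * (ρ * ℓ * θ)) * u) := by gcongr
        _ = _ := by ring
    have h5 := hEG' i
    linarith
  have hEfro2 : fro Err ≤ 1 / 2 := by
    refine hEfro.trans (le_trans ?_ hsmall)
    gcongr
    exact le_mul_of_one_le_right (by positivity) hℓ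
  -- the coefficient matrix is nearly orthogonal
  have hR0 : ∀ x, nrm ((D 0).mulVec x) ≤ 2 * nrm x ∧ nrm x ≤ 2 * nrm ((D 0).mulVec x) := by
    intro x
    have h1 : U.mulVec ((D 0).mulVec x) + Err.mulVec x = Uhat.mulVec x := by
      rw [hdec, Matrix.add_mulVec (U * D 0) Err, Matrix.mulVec_mulVec]
    have h2 := nrm_mulVec_of_orthonormal hU ((D 0).mulVec x)
    have h3 := nrm_mulVec_of_orthonormal hUo x
    have h4 : nrm (Err.mulVec x) ≤ 1 / 2 * nrm x :=
      (nrm_mulVec_le _ _).trans (mul_le_mul_of_nonneg_right hEfro2 (nrm_nonneg _))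
    have h5 := nrm_add_le (U.mulVec ((D 0).mulVec x)) (Err.mulVec x)
    have h6 := nrm_sub_le (Uhat.mulVec x) (Err.mulVec x)
    rw [← h1, add_sub_cancel_right, h1] at h6
    rw [h1] at h5
    have h7 := nrm_nonneg x
    constructor <;> linarith
  have hR0fro : fro (D 0) ≤ 2 * A := by
    refine (fro_le_of_mulVec (by norm_num) fun x => (hR0 x).1).trans ?_
    rw [Fintype.card_fin]
    linarith
  -- The lower bound in `hR0` makes the square matrix `D 0` injective, hence invertible, and the
  -- same bound controls its inverse.
  have hR0unit : IsUnit (D 0) := by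
    rw [← Matrix.mulVec_injective_iff_isUnit]
    intro x y hxy
    have hz := (hR0 (x - y)).2
    rw [Matrix.mulVec_sub, hxy, sub_self] at hz
    have h0 : nrm (0 : Fin k → ℝ) = 0 := by simp [nrm]
    rw [h0, mul_zero] at hz
    have : nrm (x - y) = 0 := le_antisymm hz (nrm_nonneg _)
    rw [nrm, norm_eq_zero] at this
    have h1 : x - y = 0 := (WithLp.toLp_eq_zero 2).1 this
    exact sub_eq_zero.1 h1
  have hR0inv : D 0 * (D 0)⁻¹ = 1 :=
    Matrix.mul_nonsing_inv _ ((Matrix.isUnit_iff_isUnit_det _).1 hR0unit)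
  have hR0invfro : fro (D 0)⁻¹ ≤ 2 * A := by
    refine (fro_le_of_mulVec (c := 2) (by norm_num) fun x => ?_).trans ?_
    · have := (hR0 ((D 0)⁻¹.mulVec x)).2
      rwa [Matrix.mulVec_mulVec, hR0inv, Matrix.one_mulVec] at this
    · rw [Fintype.card_fin]
      linarith
  have hUhatrow : ∀ i, nrm (Uhat i) ≤ 3 * A * u := by
    intro i
    have h1 : Uhat i = (U * D 0) i + Err i := by rw [hdec]; rfl
    have h2 : nrm ((U * D 0) i) ≤ u * (2 * A) := (nrm_mul_row_le _ _ _).trans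
      (mul_le_mul (hrow i) hR0fro (fro_nonneg _) hu.le)
    have h3 : nrm (Err i) ≤ 1 / 2 * u :=
      (hErow i).trans (mul_le_mul_of_nonneg_right hsmall hu.le)
    have h4 := nrm_add_le ((U * D 0) i) (Err i)
    rw [← h1] at h4
    nlinarith
  have hEUhat : ∀ i, nrm ((E * Uhat) i) ≤ 3 * A ^ 2 * (e * ℓ * u) := by
    intro i
    have h1 : (E * Uhat) i = (E * U * D 0) i + (E * Err) i := by
      rw [hdec, Matrix.mul_add, Matrix.mul_assoc]; rfl
    have h2 : nrm ((E * U * D 0) i) ≤ (A * e * ℓ * u) * (2 * A) := by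
      refine (nrm_mul_row_le _ _ _).trans (mul_le_mul ?_ hR0fro (fro_nonneg _) (by positivity))
      simpa using hEU 1 le_rfl hg i
    have h3 : nrm ((E * Err) i) ≤ e * ℓ * (1 / 2) * u := by
      refine (hEErow i).trans ?_
      gcongr
    have h4 := nrm_add_le ((E * U * D 0) i) ((E * Err) i)
    rw [← h1] at h4
    have h5 : 0 < e * ℓ * u := by positivity
    nlinarith
  -- the two error terms
  set W : Matrix (Fin n) (Fin k) ℝ := U - Uhat * (Uhat.transpose * U) with hW
  -- Symmetry of `E` moves it onto `Uhat`, and `M = U Λ Uᵀ` isolates the loss `W` of the signal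
  -- space under projection. Both products then pair two delocalized rows, which produces `u ^ 2`.
  have hsplit : Uhat * Uhat.transpose * (M + E) - M =
      Uhat * (E * Uhat).transpose - W * (U * Matrix.diagonal lam).transpose := by
    rw [hW, Matrix.transpose_mul, Matrix.transpose_mul, Matrix.diagonal_transpose, hE.eq,
      Matrix.sub_mul, Matrix.mul_add]
    have h1 : M = U * (Matrix.diagonal lam * U.transpose) := by rw [hM, Matrix.mul_assoc]
    rw [← h1]
    have h2 : Uhat * (Uhat.transpose * U) * (Matrix.diagonal lam * U.transpose) =
        Uhat * Uhat.transpose * M := by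
      rw [h1]; simp only [Matrix.mul_assoc]
    rw [h2, Matrix.mul_assoc Uhat Uhat.transpose E]
    abel
  -- The complementary projection annihilates `Uhat = U * D 0 + Err`, so on `U * D 0` it equals
  -- minus its value on `Err`.
  have hWeq : W = -((Err - Uhat * (Uhat.transpose * Err)) * (D 0)⁻¹) := by
    have h1 : W * D 0 = -(Err - Uhat * (Uhat.transpose * Err)) := by
      have h2 : U * D 0 = Uhat - Err := by rw [hdec]; abel
      rw [hW, Matrix.sub_mul, Matrix.mul_assoc, Matrix.mul_assoc, h2, Matrix.mul_sub, Matrix.mul_sub,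
        hUo, Matrix.mul_one]
      abel
    rw [← Matrix.neg_mul, ← h1, Matrix.mul_assoc, hR0inv, Matrix.mul_one]
  have hWrow : ∀ i, nrm (W i) ≤ 8 * A ^ 3 * (g * A ^ 2 * (ρ * ℓ * θ)) * u := by
    intro i
    have h1 : nrm (W i) = nrm (((Err - Uhat * (Uhat.transpose * Err)) * (D 0)⁻¹) i) := by
      rw [hWeq]
      exact nrm_neg _
    have hX : 0 ≤ g * A ^ 2 * (ρ * ℓ * θ) * u := by positivity
    have h2 : fro (Uhat.transpose * Err) ≤ A * (g * A ^ 2 * (ρ * ℓ * θ)) := by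
      refine (fro_mul_le _ _).trans (mul_le_mul ?_ (hEfro.trans ?_) (fro_nonneg _) hA0.le)
      · rw [fro_transpose, fro_of_orthonormal hUo, Fintype.card_fin]
        exact hkA
      · gcongr
        exact le_mul_of_one_le_right (by positivity) hℓ
    have h3 : nrm ((Uhat * (Uhat.transpose * Err)) i) ≤
        (3 * A * u) * (A * (g * A ^ 2 * (ρ * ℓ * θ))) :=
      (nrm_mul_row_le _ _ _).trans (mul_le_mul (hUhatrow i) h2 (fro_nonneg _) (by positivity))
    have h4 : nrm ((Err - Uhat * (Uhat.transpose * Err)) i) ≤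
        4 * A ^ 2 * (g * A ^ 2 * (ρ * ℓ * θ) * u) := by
      refine (nrm_sub_le (Err i) ((Uhat * (Uhat.transpose * Err)) i)).trans ?_
      have := hErow i
      nlinarith
    rw [h1]
    refine (nrm_mul_row_le _ _ _).trans
      ((mul_le_mul h4 hR0invfro (fro_nonneg _) (by positivity)).trans_eq ?_)
    ring
  have hULrow : ∀ j, nrm ((U * Matrix.diagonal lam) j) ≤ L * u := by
    intro j
    refine nrm_le_of_sq_le (by positivity) ?_
    calc _ = ∑ c, lam c ^ 2 * (U j c * U j c) := by
          simp only [dotProduct, Matrix.mul_diagonal]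
          exact Finset.sum_congr rfl fun c _ => by ring
      _ ≤ ∑ c, L ^ 2 * (U j c * U j c) := by
          refine Finset.sum_le_sum fun c _ => mul_le_mul_of_nonneg_right ?_ (mul_self_nonneg _)
          exact sq_le_sq' (by linarith [abs_le.1 (hlam c)]) (abs_le.1 (hlam c)).2
      _ = L ^ 2 * nrm (U j) ^ 2 := by rw [← Finset.mul_sum, nrm_sq]; rfl
      _ ≤ L ^ 2 * u ^ 2 := by gcongr; exacts [nrm_nonneg _, hrow j]
      _ = _ := by ring
  rw [hsplit, Matrix.sub_apply]
  have hdot : ∀ (X Y : Matrix (Fin n) (Fin k) ℝ), |(X * Y.transpose) i j| ≤ nrm (X i) * nrm (Y j) :=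
    fun X Y => abs_dotProduct_le (X i) (Y j)
  have hT1 : |(Uhat * (E * Uhat).transpose) i j| ≤ (3 * A * u) * (3 * A ^ 2 * (e * ℓ * u)) :=
    (hdot _ _).trans (mul_le_mul (hUhatrow i) (hEUhat j) (nrm_nonneg _) (by positivity))
  have hT2 : |(W * (U * Matrix.diagonal lam).transpose) i j| ≤
      (8 * A ^ 3 * (g * A ^ 2 * (ρ * ℓ * θ)) * u) * (L * u) :=
    (hdot _ _).trans (mul_le_mul (hWrow i) (hULrow j) (nrm_nonneg _) (by positivity))
  refine (abs_sub _ _).trans ((add_le_add hT1 hT2).trans ?_)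
  -- The eigenvalue size `L` cancels the denominator of `ρ`; the two terms contribute `8` and `9` to
  -- the constant `17`.
  have hρL : ρ * L = e := div_mul_cancel₀ _ hL.ne'
  have h1 : (8 * A ^ 3 * (g * A ^ 2 * (ρ * ℓ * θ)) * u) * (L * u) =
      8 * (g * A ^ 5) * (ℓ * θ * e * u ^ 2) := by
    rw [← hρL]; ring
  have h2 : (3 * A * u) * (3 * A ^ 2 * (e * ℓ * u)) ≤ 9 * (g * A ^ 5) * (ℓ * θ * e * u ^ 2) := by
    have h3 : A ^ 3 ≤ g * A ^ 5 :=
      (pow_le_pow_right₀ hA (by norm_num)).trans (le_mul_of_one_le_left (by positivity) hgr)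
    calc (3 * A * u) * (3 * A ^ 2 * (e * ℓ * u)) = 9 * A ^ 3 * (ℓ * 1 * e * u ^ 2) := by ring
      _ ≤ _ := by gcongr
  linarith

end Entrywise

/-! ### Operator bounds, perturbed powers and orthonormal factorization -/

section Bounds

variable {ι κ : Type*} [Fintype ι] [Fintype κ]

theorem expandsBy_sq_iff {Z : Matrix ι κ ℝ} {s : ℝ} (hs : 0 ≤ s) :
    ExpandsBy (s ^ 2) Z ↔ ∀ x, s * nrm x ≤ nrm (Z.transpose.mulVec x) := by
  refine forall_congr' fun x => ?_
  rw [← nrm_sq, ← nrm_sq, ← mul_pow]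
  exact pow_le_pow_iff_left₀ (mul_nonneg hs (nrm_nonneg _)) (nrm_nonneg _) two_ne_zero

/-- `A` has operator norm at most `c` for the Euclidean norms. -/
def OpBound (A : Matrix ι κ ℝ) (c : ℝ) : Prop := ∀ v, nrm (A.mulVec v) ≤ c * nrm v

theorem nrm_smul (c : ℝ) (v : ι → ℝ) : nrm (c • v) = |c| * nrm v := by
  rw [nrm, WithLp.toLp_smul, norm_smul, Real.norm_eq_abs, nrm]

theorem OpBound.add {A B : Matrix ι κ ℝ} {a b : ℝ} (hA : OpBound A a) (hB : OpBound B b) :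
    OpBound (A + B) (a + b) := fun v => by
  rw [Matrix.add_mulVec, add_mul]
  exact (nrm_add_le _ _).trans (add_le_add (hA v) (hB v))

theorem OpBound.pow [DecidableEq ι] {A : Matrix ι ι ℝ} {a : ℝ} (hA : OpBound A a) (ha : 0 ≤ a)
    (h : ℕ) : OpBound (A ^ h) (a ^ h) := by
  induction h with
  | zero => intro v; simp
  | succ h ih =>
    intro v
    rw [pow_succ', ← Matrix.mulVec_mulVec, pow_succ', mul_assoc]
    exact (hA _).trans (mul_le_mul_of_nonneg_left (ih v) ha)

/-- The recursion `(A + B)^(h+1) - A^(h+1) = (A + B)((A + B)^h - A^h) + B A^h` needs no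
commutativity and is satisfied exactly by the scalar bound. -/
theorem OpBound.add_pow_sub_pow [DecidableEq ι] {A B : Matrix ι ι ℝ} {a b : ℝ} (hA : OpBound A a)
    (hB : OpBound B b) (ha : 0 ≤ a) (hb : 0 ≤ b) (h : ℕ) :
    OpBound ((A + B) ^ h - A ^ h) ((a + b) ^ h - a ^ h) := by
  induction h with
  | zero => intro v; simp [nrm]
  | succ h ih =>
    intro v
    have h1 : (A + B) ^ (h + 1) - A ^ (h + 1) = (A + B) * ((A + B) ^ h - A ^ h) + B * A ^ h := by
      rw [pow_succ', pow_succ']; noncomm_ring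
    rw [h1, Matrix.add_mulVec, ← Matrix.mulVec_mulVec, ← Matrix.mulVec_mulVec]
    refine (nrm_add_le _ _).trans ?_
    have h2 := ((hA.add hB) (((A + B) ^ h - A ^ h).mulVec v)).trans
      (mul_le_mul_of_nonneg_left (ih v) (by positivity))
    have h3 := (hB ((A ^ h).mulVec v)).trans (mul_le_mul_of_nonneg_left (hA.pow ha h v) hb)
    calc _ ≤ _ := add_le_add h2 h3
      _ = _ := by ring

theorem opBound_of_specNorm_le {n : ℕ} {A : Matrix (Fin n) (Fin n) ℝ} {c : ℝ}
    (h : specNorm A ≤ c) : OpBound A c := fun v => by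
  have := (Matrix.toEuclideanCLM (n := Fin n) (𝕜 := ℝ) A).le_opNorm (WithLp.toLp 2 v)
  rw [Matrix.toEuclideanCLM_toLp] at this
  exact this.trans (mul_le_mul_of_nonneg_right h (norm_nonneg _))

theorem specNorm_le_of_opBound {n : ℕ} {A : Matrix (Fin n) (Fin n) ℝ} {c : ℝ} (hc : 0 ≤ c)
    (h : OpBound A c) : specNorm A ≤ c :=
  ContinuousLinearMap.opNorm_le_bound _ hc fun x => h x.ofLp

theorem opBound_transpose_of_orthonormal [DecidableEq κ] {U : Matrix ι κ ℝ}
    (hU : U.transpose * U = 1) : OpBound U.transpose 1 := by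
  intro v
  rw [one_mul]
  rcases (nrm_nonneg (U.transpose.mulVec v)).eq_or_lt with h | h
  · rw [← h]; exact nrm_nonneg v
  · refine le_of_mul_le_mul_left ?_ h
    have h1 : nrm (U.transpose.mulVec v) * nrm (U.transpose.mulVec v) =
        v ⬝ᵥ U.mulVec (U.transpose.mulVec v) := by
      rw [← pow_two, nrm_sq, Matrix.dotProduct_mulVec, ← Matrix.mulVec_transpose,
        Matrix.transpose_transpose, dotProduct_comm]
    rw [h1]
    refine (le_abs_self _).trans ((abs_dotProduct_le _ _).trans_eq ?_)
    rw [nrm_mulVec_of_orthonormal hU, mul_comm]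

theorem nrm_diagonal_mulVec_le [DecidableEq κ] {lam : κ → ℝ} {L : ℝ}
    (hlam : ∀ j, |lam j| ≤ L) (hL : 0 ≤ L) : OpBound (Matrix.diagonal lam) L := by
  intro v
  refine nrm_le_of_sq_le (mul_nonneg hL (nrm_nonneg _)) ?_
  rw [mul_pow, nrm_sq, dotProduct, dotProduct, Finset.mul_sum]
  refine Finset.sum_le_sum fun j _ => ?_
  rw [Matrix.mulVec_diagonal]
  have : lam j ^ 2 ≤ L ^ 2 := sq_le_sq' (by linarith [abs_le.1 (hlam j)]) (abs_le.1 (hlam j)).2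
  nlinarith [mul_self_nonneg (v j)]

theorem le_nrm_diagonal_mulVec [DecidableEq κ] {d : κ → ℝ} {c : ℝ} (hc : 0 ≤ c)
    (hd : ∀ j, c ≤ |d j|) (v : κ → ℝ) : c * nrm v ≤ nrm ((Matrix.diagonal d).mulVec v) := by
  refine (pow_le_pow_iff_left₀ (mul_nonneg hc (nrm_nonneg _)) (nrm_nonneg _) two_ne_zero).1 ?_
  rw [mul_pow, nrm_sq, nrm_sq, dotProduct, dotProduct, Finset.mul_sum]
  refine Finset.sum_le_sum fun j _ => ?_
  rw [Matrix.mulVec_diagonal]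
  have : c ^ 2 ≤ d j ^ 2 := by rw [← sq_abs (d j)]; exact pow_le_pow_left₀ hc (hd j) 2
  nlinarith [mul_self_nonneg (v j)]

theorem opBound_signal [DecidableEq κ] {U : Matrix ι κ ℝ} {lam : κ → ℝ} (hU : U.transpose * U = 1)
    {L : ℝ} (hlam : ∀ j, |lam j| ≤ L) (hL : 0 ≤ L) :
    OpBound (U * Matrix.diagonal lam * U.transpose) L := by
  intro v
  rw [← Matrix.mulVec_mulVec, ← Matrix.mulVec_mulVec, nrm_mulVec_of_orthonormal hU]
  refine (nrm_diagonal_mulVec_le hlam hL _).trans (mul_le_mul_of_nonneg_left ?_ hL)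
  simpa using opBound_transpose_of_orthonormal hU v

/-- A matrix with full row rank factors through orthonormal rows. -/
theorem exists_orthonormal_rows_factor {n k : ℕ} (W : Matrix (Fin k) (Fin n) ℝ) {w : ℝ}
    (hw : 0 < w) (hW : ∀ x, w * nrm x ≤ nrm (W.transpose.mulVec x)) :
    ∃ (O : Matrix (Fin k) (Fin n) ℝ) (R : Matrix (Fin k) (Fin k) ℝ), O * O.transpose = 1 ∧
      W = R * O ∧ ∀ x, w * nrm x ≤ nrm (R.transpose.mulVec x) := by
  set f : (Fin k → ℝ) →ₗ[ℝ] EuclideanSpace ℝ (Fin n) :=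
    (WithLp.linearEquiv 2 ℝ (Fin n → ℝ)).symm.toLinearMap ∘ₗ W.transpose.mulVecLin with hf
  have hfx : ∀ x, f x = WithLp.toLp 2 (W.transpose.mulVec x) := fun x => rfl
  have hinj : Function.Injective f := by
    rw [injective_iff_map_eq_zero]
    intro x hx
    have h1 := hW x
    have h2 : nrm (W.transpose.mulVec x) = 0 := by
      rw [nrm, ← hfx, hx, norm_zero]
    rw [h2] at h1
    have h3 : nrm x = 0 := le_antisymm (by nlinarith [nrm_nonneg x]) (nrm_nonneg x)
    rw [nrm, norm_eq_zero] at h3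
    exact (WithLp.toLp_eq_zero 2).1 h3
  set S := LinearMap.range f
  have hrank : Module.finrank ℝ S = k := by
    rw [LinearMap.finrank_range_of_inj hinj, Module.finrank_fin_fun]
  -- An orthonormal basis of the row space of `W` gives the rows of `O`; the coordinates of the rows
  -- of `W` in it form `R`.
  set b := (stdOrthonormalBasis ℝ S).reindex (finCongr hrank)
  set O : Matrix (Fin k) (Fin n) ℝ := Matrix.of fun i l => (b i : EuclideanSpace ℝ (Fin n)) l
  have hO : O * O.transpose = 1 := by
    ext i j
    have h1 : inner ℝ (b i) (b j) = if i = j then (1 : ℝ) else 0 :=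
      orthonormal_iff_ite.1 b.orthonormal i j
    rw [Submodule.coe_inner, EuclideanSpace.inner_eq_star_dotProduct, dotProduct_comm] at h1
    rw [Matrix.one_apply, ← h1]
    rfl
  have hrow : ∀ j, (WithLp.toLp 2 (W j) : EuclideanSpace ℝ (Fin n)) ∈ S := by
    intro j
    refine ⟨Pi.single j 1, ?_⟩
    rw [hfx, Matrix.mulVec_single_one]
    rfl
  set R : Matrix (Fin k) (Fin k) ℝ := Matrix.of fun j i => inner ℝ (b i) ⟨_, hrow j⟩
  have hWR : W = R * O := by
    ext j l
    have h1 := b.sum_repr' ⟨_, hrow j⟩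
    have h2 := congrArg (fun v : S => (v : EuclideanSpace ℝ (Fin n)) l) h1
    simp only [Submodule.coe_sum, Submodule.coe_smul, WithLp.ofLp_sum, Finset.sum_apply,
      WithLp.ofLp_smul, Pi.smul_apply, smul_eq_mul] at h2
    rw [Matrix.mul_apply]
    exact h2.symm
  refine ⟨O, R, hO, hWR, fun x => ?_⟩
  have h1 := hW x
  rw [hWR, Matrix.transpose_mul, ← Matrix.mulVec_mulVec,
    nrm_mulVec_of_orthonormal (U := O.transpose) (by rwa [Matrix.transpose_transpose])] at h1
  exact h1

end Bounds

/-! ### Singular values and leading left singular vectors -/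

section SVD

variable {n p k : ℕ}

/-- The max-min principle for the `k`-th singular value. -/
theorem IsSVD.le_of_expandsBy {Y : Matrix (Fin n) (Fin p) ℝ} {W : Matrix (Fin n) (Fin n) ℝ}
    {σ : ℕ → ℝ} {V : Matrix (Fin p) (Fin p) ℝ} (h : IsSVD Y W σ V) (hk : 1 ≤ k)
    {B : Matrix (Fin n) (Fin k) ℝ} (hB : B.transpose * B = 1) {s : ℝ} (hs : 0 ≤ s)
    (hexp : ExpandsBy (s ^ 2) (B.transpose * Y)) : s ≤ σ (k - 1) := by
  rw [expandsBy_sq_iff hs] at hexp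
  -- Dimension count: some nonzero `x` makes `B x` orthogonal to the first `k - 1` left singular
  -- vectors, so `Yᵀ` stretches it by at most `σ (k - 1)`. Indices `l ≥ n` receive the zero
  -- functional, which avoids comparing `k` with `n` here.
  set f : (Fin k → ℝ) →ₗ[ℝ] (Fin (k - 1) → ℝ) := LinearMap.pi fun l =>
    (if hl : (l : ℕ) < n then LinearMap.proj (⟨l, hl⟩ : Fin n) else 0) ∘ₗ
      (W.transpose * B).mulVecLin with hf
  have hker : LinearMap.ker f ≠ ⊥ := LinearMap.ker_ne_bot_of_finrank_lt (by
    rw [Module.finrank_fin_fun, Module.finrank_fin_fun]; omega)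
  obtain ⟨x, hx, hx0⟩ := (Submodule.ne_bot_iff _).1 hker
  rw [LinearMap.mem_ker] at hx
  set y := (W.transpose * B).mulVec x with hy
  have hy0 : ∀ i : Fin n, (i : ℕ) < k - 1 → y i = 0 := by
    intro i hi
    have : f x ⟨i, hi⟩ = 0 := congrFun hx ⟨i, hi⟩
    simpa only [hf, LinearMap.pi_apply, i.2, dif_pos, LinearMap.comp_apply, LinearMap.proj_apply,
      Matrix.mulVecLin_apply] using this
  have hWW : W * W.transpose = 1 := mul_eq_one_comm.1 h.left_orth
  have hynrm : nrm y = nrm x := by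
    rw [hy, ← Matrix.mulVec_mulVec, nrm_mulVec_of_orthonormal (U := W.transpose)
      (by rwa [Matrix.transpose_transpose]), nrm_mulVec_of_orthonormal hB]
  have hxpos : 0 < nrm x := by
    rcases (nrm_nonneg x).eq_or_lt with h0 | h0
    · exact absurd ((WithLp.toLp_eq_zero 2).1 (norm_eq_zero.1 h0.symm)) hx0
    · exact h0
  set D : Matrix (Fin n) (Fin p) ℝ :=
    Matrix.of fun (i : Fin n) (j : Fin p) => if (i : ℕ) = (j : ℕ) then σ i else 0 with hD
  have hYx : (B.transpose * Y).transpose.mulVec x = V.mulVec (D.transpose.mulVec y) := by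
    rw [h.decomp, hy, Matrix.mulVec_mulVec, Matrix.mulVec_mulVec]
    congr 1
    simp only [Matrix.transpose_mul, Matrix.transpose_transpose, Matrix.mul_assoc]
    rfl
  have hDy : nrm (D.transpose.mulVec y) ≤ σ (k - 1) * nrm y := by
    refine nrm_le_of_sq_le (mul_nonneg (h.nonneg _) (nrm_nonneg _)) ?_
    have hcoord : ∀ j : Fin p, D.transpose.mulVec y j =
        if hj : (j : ℕ) < n then σ j * y ⟨j, hj⟩ else 0 := by
      intro j
      simp only [Matrix.mulVec, dotProduct, Matrix.transpose_apply, hD, Matrix.of_apply]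
      split_ifs with hj
      · rw [Finset.sum_eq_single (⟨j, hj⟩ : Fin n)]
        · simp
        · intro i _ hi
          rw [if_neg, zero_mul]
          intro hij
          exact hi (Fin.ext hij)
        · simp
      · refine Finset.sum_eq_zero fun i _ => ?_
        rw [if_neg, zero_mul]
        have := i.2
        omega
    have hle : ∀ j : Fin p, D.transpose.mulVec y j * D.transpose.mulVec y j ≤
        σ (k - 1) ^ 2 * ∑ i : Fin n, if (i : ℕ) = (j : ℕ) then y i * y i else 0 := by
      intro j
      rw [hcoord]
      split_ifs with hj
      · rw [Finset.sum_eq_single (⟨j, hj⟩ : Fin n) (by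
          intro i _ hi
          rw [if_neg]
          intro hij
          exact hi (Fin.ext hij)) (by simp), if_pos rfl]
        by_cases hjk : (j : ℕ) < k - 1
        · rw [hy0 _ hjk]; simp
        · have h1 : σ j ≤ σ (k - 1) := h.ordered (by omega)
          have h2 := pow_le_pow_left₀ (h.nonneg j) h1 2
          nlinarith [mul_self_nonneg (y ⟨j, hj⟩)]
      · rw [mul_zero]
        refine mul_nonneg (sq_nonneg _) (Finset.sum_nonneg fun i _ => ?_)
        split_ifs
        · exact mul_self_nonneg _
        · exact le_rfl
    calc _ ≤ ∑ j : Fin p, σ (k - 1) ^ 2 *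
          ∑ i : Fin n, (if (i : ℕ) = (j : ℕ) then y i * y i else 0) :=
          Finset.sum_le_sum fun j _ => hle j
      _ = σ (k - 1) ^ 2 * ∑ i : Fin n, ∑ j : Fin p,
          (if (i : ℕ) = (j : ℕ) then y i * y i else 0) := by
          rw [← Finset.mul_sum, Finset.sum_comm]
      _ ≤ σ (k - 1) ^ 2 * ∑ i : Fin n, y i * y i := by
          refine mul_le_mul_of_nonneg_left (Finset.sum_le_sum fun i _ => ?_) (sq_nonneg _)
          by_cases hi : (i : ℕ) < p
          · rw [Finset.sum_eq_single (⟨i, hi⟩ : Fin p) (by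
              intro j _ hj
              rw [if_neg]
              intro hij
              exact hj (Fin.ext hij.symm)) (by simp), if_pos rfl]
          · rw [Finset.sum_eq_zero fun j _ => by
              rw [if_neg]
              have := j.2
              omega]
            exact mul_self_nonneg _
      _ = _ := by rw [mul_pow, nrm_sq]; rfl
  have h1 := hexp x
  rw [hYx, nrm_mulVec_of_orthonormal h.right_orth] at h1
  rw [hynrm] at hDy
  exact le_of_mul_le_mul_right (h1.trans hDy) hxpos

/-- The leading left singular vectors in terms of the right ones. -/
theorem IsSVD.exists_factor {Y : Matrix (Fin n) (Fin p) ℝ} {W : Matrix (Fin n) (Fin n) ℝ}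
    {σ : ℕ → ℝ} {V : Matrix (Fin p) (Fin p) ℝ} (h : IsSVD Y W σ V) (hkn : k ≤ n) (hkp : k ≤ p)
    {s : ℝ} (hs : 0 < s) (hsσ : s ≤ σ (k - 1)) {Uhat : Matrix (Fin n) (Fin k) ℝ}
    (hUhat : ∀ (i l : Fin n) (j : Fin k), (l : ℕ) = (j : ℕ) → Uhat i j = W i l) :
    ∃ F : Matrix (Fin p) (Fin k) ℝ, Uhat = Y * F ∧ Uhat.transpose * Uhat = 1 ∧
      ∀ r, nrm (Matrix.vecMul r F) ≤ nrm r / s := by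
  have hσ : ∀ j : Fin k, s ≤ σ j := fun j => hsσ.trans (h.ordered (by have := j.2; omega))
  have hUe : ∀ i j, Uhat i j = W i (Fin.castLE hkn j) := fun i j => hUhat _ _ _ rfl
  -- The leading right singular vectors divided by their singular values, all of which are at least
  -- `s`.
  set F : Matrix (Fin p) (Fin k) ℝ := Matrix.of fun c j => V c (Fin.castLE hkp j) * (σ j)⁻¹ with hF
  have hVF : V.transpose * F = Matrix.of fun (c : Fin p) (j : Fin k) =>
      if (c : ℕ) = (j : ℕ) then (σ j)⁻¹ else 0 := by
    ext c j
    have h1 := congrFun (congrFun h.right_orth c) (Fin.castLE hkp j)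
    rw [Matrix.mul_apply] at h1
    simp only [Matrix.mul_apply, hF, Matrix.of_apply, ← mul_assoc, ← Finset.sum_mul]
    rw [h1, Matrix.one_apply]
    simp only [Fin.ext_iff, Fin.val_castLE, ite_mul, one_mul, zero_mul]
  refine ⟨F, ?_, ?_, fun r => ?_⟩
  · rw [h.decomp, Matrix.mul_assoc, hVF]
    ext i j
    rw [hUe, Matrix.mul_apply, Finset.sum_eq_single (Fin.castLE hkp j) (by
      intro c _ hc
      rw [Matrix.of_apply, if_neg, mul_zero]
      intro hcj
      exact hc (Fin.ext hcj)) (by simp), Matrix.of_apply, if_pos (by simp), Matrix.mul_apply,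
      Finset.sum_eq_single (Fin.castLE hkn j) (by
      intro c _ hc
      rw [Matrix.of_apply, if_neg, mul_zero]
      intro hcj
      exact hc (Fin.ext hcj)) (by simp), Matrix.of_apply, if_pos (by simp)]
    rw [Fin.val_castLE, mul_assoc, mul_inv_cancel₀ (hs.trans_le (hσ j)).ne', mul_one]
  · ext i j
    have h1 := congrFun (congrFun h.left_orth (Fin.castLE hkn i)) (Fin.castLE hkn j)
    rw [Matrix.mul_apply] at h1
    rw [Matrix.mul_apply]
    simp only [Matrix.transpose_apply, hUe] at h1 ⊢
    rw [h1, Matrix.one_apply, Matrix.one_apply]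
    simp only [Fin.ext_iff, Fin.val_castLE]
  · have hVt := opBound_transpose_of_orthonormal h.right_orth r
    rw [one_mul] at hVt
    refine le_trans ?_ (div_le_div_of_nonneg_right hVt hs.le)
    refine nrm_le_of_sq_le (div_nonneg (nrm_nonneg _) hs.le) ?_
    rw [div_pow, nrm_sq]
    set z := V.transpose.mulVec r
    have hz : ∀ j, Matrix.vecMul r F j = z (Fin.castLE hkp j) * (σ j)⁻¹ := by
      intro j
      simp only [Matrix.vecMul, dotProduct, hF, Matrix.of_apply, z, Matrix.mulVec,
        Matrix.transpose_apply, Finset.sum_mul]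
      exact Finset.sum_congr rfl fun c _ => by ring
    calc Matrix.vecMul r F ⬝ᵥ Matrix.vecMul r F
        ≤ ∑ j : Fin k, z (Fin.castLE hkp j) * z (Fin.castLE hkp j) / s ^ 2 := by
          refine Finset.sum_le_sum fun j _ => ?_
          rw [hz, div_eq_mul_inv]
          have h1 : (σ j)⁻¹ ≤ s⁻¹ := inv_anti₀ hs (hσ j)
          have h2 : (σ j)⁻¹ ^ 2 ≤ s⁻¹ ^ 2 :=
            pow_le_pow_left₀ (inv_nonneg.2 (h.nonneg j)) h1 2
          rw [← inv_pow]
          nlinarith [mul_self_nonneg (z (Fin.castLE hkp j))]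
      _ = (∑ c ∈ Finset.univ.map (Fin.castLEEmb hkp), z c * z c) / s ^ 2 := by
          rw [Finset.sum_map, Finset.sum_div]
          rfl
      _ ≤ (z ⬝ᵥ z) / s ^ 2 := by
          refine div_le_div_of_nonneg_right ?_ (by positivity)
          exact Finset.sum_le_sum_of_subset_of_nonneg (Finset.subset_univ _)
            fun _ _ _ => mul_self_nonneg _

/-- The output of the algorithm, if one of the sketches has a large `k`-th singular value. -/
theorem IsOutput.exists_factor {N : ℕ} {Mhat : Matrix (Fin n) (Fin n) ℝ} {g : ℕ}
    {G : Fin N → Matrix (Fin n) (Fin p) ℝ} {Uhat : Matrix (Fin n) (Fin k) ℝ}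
    (h : IsOutput Mhat g G Uhat) (hk : 1 ≤ k) (hkn : k ≤ n) (hkp : k ≤ p)
    {B : Matrix (Fin n) (Fin k) ℝ} (hB : B.transpose * B = 1) {s : ℝ} (hs : 0 < s)
    (hexp : ∃ b, ExpandsBy (s ^ 2) (B.transpose * Mhat ^ g * G b)) :
    ∃ (t : Fin N) (F : Matrix (Fin p) (Fin k) ℝ), Uhat = Mhat ^ g * G t * F ∧
      Uhat.transpose * Uhat = 1 ∧ ∀ r, nrm (Matrix.vecMul r F) ≤ nrm r / s := by
  obtain ⟨W, σ, V, t, hsvd, hmax, hU⟩ := h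
  obtain ⟨b, hb⟩ := hexp
  rw [Matrix.mul_assoc] at hb
  have h1 := (hsvd b).le_of_expandsBy hk hB hs.le hb
  exact ⟨t, (hsvd t).exists_factor hkn hkp hs (h1.trans (hmax b)) hU⟩

end SVD

/-! ### The entrywise bound on a good event -/

section GoodEvent

variable {n k p N g : ℕ}

theorem nrm_row_le_twoInftyNorm {m q : ℕ} (A : Matrix (Fin m) (Fin q) ℝ) (i : Fin m) :
    nrm (A i) ≤ twoInftyNorm A := by
  have h : nrm (A i) = Real.sqrt (∑ j, A i j ^ 2) := by
    rw [nrm_eq_sqrt]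
    simp only [dotProduct, pow_two]
  rw [h]
  exact le_ciSup (f := fun i => Real.sqrt (∑ j, A i j ^ 2)) (Set.finite_range _).bddAbove i

theorem twoInftyNorm_nonneg {m q : ℕ} (A : Matrix (Fin m) (Fin q) ℝ) : 0 ≤ twoInftyNorm A :=
  Real.iSup_nonneg fun _ => Real.sqrt_nonneg _

theorem maxNorm_le {m q : ℕ} {A : Matrix (Fin m) (Fin q) ℝ} {c : ℝ} (hc : 0 ≤ c)
    (h : ∀ i j, |A i j| ≤ c) : maxNorm A ≤ c :=
  Real.iSup_le (fun i => Real.iSup_le (h i) hc) hc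

/-- The squared Frobenius norm `k ≥ 1` is spread over `n` rows. This lower bound lets a remainder of
order `n^(-1/2)` be measured in units of the row norm. -/
theorem one_le_sqrt_mul_twoInftyNorm {U : Matrix (Fin n) (Fin k) ℝ} (hU : U.transpose * U = 1)
    (hk : 1 ≤ k) : 1 ≤ Real.sqrt n * twoInftyNorm U := by
  have h1 := fro_le_of_rows (twoInftyNorm_nonneg U) (nrm_row_le_twoInftyNorm U)
  rw [fro_of_orthonormal hU, Fintype.card_fin, Fintype.card_fin] at h1
  refine le_trans ?_ h1
  rw [Real.one_le_sqrt]
  exact_mod_cast hk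

theorem le_of_orthonormal {U : Matrix (Fin n) (Fin k) ℝ} (hU : U.transpose * U = 1) : k ≤ n := by
  have hinj : Function.Injective U.mulVecLin := by
    intro x y hxy
    have h := congrArg U.transpose.mulVec hxy
    simpa only [Matrix.mulVecLin_apply, Matrix.mulVec_mulVec, hU, Matrix.one_mulVec] using h
  simpa using LinearMap.finrank_le_finrank_of_injective hinj

theorem IsSignalDecomposition.isSymm {M : Matrix (Fin n) (Fin n) ℝ} {U : Matrix (Fin n) (Fin k) ℝ}
    {lam : Fin k → ℝ} (h : IsSignalDecomposition M U lam) : M.IsSymm := by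
  rw [Matrix.IsSymm, h.decomp]
  simp only [Matrix.transpose_mul, Matrix.transpose_transpose, Matrix.diagonal_transpose,
    Matrix.mul_assoc]

theorem IsSignalDecomposition.pow_mul {M : Matrix (Fin n) (Fin n) ℝ}
    {U : Matrix (Fin n) (Fin k) ℝ} {lam : Fin k → ℝ} (h : IsSignalDecomposition M U lam) (g : ℕ) :
    M ^ g * U = U * Matrix.diagonal (fun j => lam j ^ g) := by
  induction g with
  | zero => simp
  | succ g ih =>
    have h1 : M * U = U * Matrix.diagonal lam := by
      rw [h.decomp, Matrix.mul_assoc, h.orthonormal, Matrix.mul_one]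
    rw [pow_succ', Matrix.mul_assoc, ih, ← Matrix.mul_assoc, h1, Matrix.mul_assoc,
      Matrix.diagonal_mul_diagonal]
    congr 2
    funext j
    rw [pow_succ']

/-- The power of the noisy matrix acts on the signal space almost as the power of the signal. -/
theorem IsSignalDecomposition.le_nrm_transpose_mulVec {M E : Matrix (Fin n) (Fin n) ℝ}
    {U : Matrix (Fin n) (Fin k) ℝ} {lam : Fin k → ℝ} (h : IsSignalDecomposition M U lam)
    (hE : E.IsSymm) {L e c : ℝ} (hL : 0 ≤ L) (he : 0 ≤ e) (hc : 0 ≤ c) (hlam : ∀ j, |lam j| ≤ L)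
    (hlam' : ∀ j, c ≤ |lam j|) (hEe : OpBound E e) (g : ℕ) (x : Fin k → ℝ) :
    (c ^ g - ((L + e) ^ g - L ^ g)) * nrm x ≤
      nrm ((U.transpose * (M + E) ^ g).transpose.mulVec x) := by
  have hM : OpBound M L := by rw [h.decomp]; exact opBound_signal h.orthonormal hlam hL
  have hsymm : ((M + E) ^ g).transpose = (M + E) ^ g := by
    rw [Matrix.transpose_pow, Matrix.transpose_add, h.isSymm.eq, hE.eq]
  have h1 : (U.transpose * (M + E) ^ g).transpose.mulVec x = (M ^ g).mulVec (U.mulVec x) +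
      ((M + E) ^ g - M ^ g).mulVec (U.mulVec x) := by
    rw [Matrix.transpose_mul, Matrix.transpose_transpose, hsymm, ← Matrix.add_mulVec,
      add_sub_cancel, Matrix.mulVec_mulVec]
  have h2 := hM.add_pow_sub_pow hEe hL he g (U.mulVec x)
  rw [nrm_mulVec_of_orthonormal h.orthonormal] at h2
  have h3 : c ^ g * nrm x ≤ nrm ((M ^ g).mulVec (U.mulVec x)) := by
    rw [Matrix.mulVec_mulVec, h.pow_mul, ← Matrix.mulVec_mulVec,
      nrm_mulVec_of_orthonormal h.orthonormal]
    refine le_nrm_diagonal_mulVec (by positivity) (fun j => ?_) x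
    rw [abs_pow]
    exact pow_le_pow_left₀ hc (hlam' j) g
  have h4 := nrm_sub_le ((U.transpose * (M + E) ^ g).transpose.mulVec x)
    (((M + E) ^ g - M ^ g).mulVec (U.mulVec x))
  nth_rewrite 1 [h1] at h4
  rw [add_sub_cancel_right] at h4
  linarith

/-- The entrywise error bound on the event that the noise is small, the rows of `E ^ h * U` are
small, the sketches are not too large in finitely many directions, and one of the sketches has a
large `k`-th singular value. -/
theorem maxNorm_proj_mul_sub_le {M E : Matrix (Fin n) (Fin n) ℝ} {U Uhat : Matrix (Fin n) (Fin k) ℝ}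
    {lam : Fin k → ℝ} {G : Fin N → Matrix (Fin n) (Fin p) ℝ} (h : IsSignalDecomposition M U lam)
    (hE : E.IsSymm) (hk : 1 ≤ k) (hkp : k ≤ p) (hg : 1 ≤ g)
    {L e ℓ θ T C c A : ℝ} (hL : 0 < L) (hlam : ∀ j, |lam j| ≤ L) (he : 0 < e) (heL : e ≤ L)
    (hℓ : 1 ≤ ℓ) (hθ : 1 ≤ θ) (hT : 0 < T) (hC : 0 ≤ C) (hc : 0 < c)
    (hspec : specNorm E ≤ e)
    (hrow : ∀ h, 1 ≤ h → h ≤ g → ∀ j i, |(E ^ h).mulVec (fun l => U l j) i| ≤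
      C * e ^ h * ℓ ^ h * ‖fun l => U l j‖)
    (hup : ∀ h, (h = g ∨ h = g + 1) → ∀ a i,
      nrm (Matrix.vecMul ((E ^ h) i) (G a)) ≤ nrm ((E ^ h) i) * T)
    (hup' : ∀ h < g, ∀ a j, nrm (Matrix.vecMul ((U.transpose * (M + E) ^ h) j) (G a)) ≤
      nrm ((U.transpose * (M + E) ^ h) j) * T)
    (hlow : ∃ a, ExpandsBy ((c * L ^ g * T / θ) ^ 2) (U.transpose * (M + E) ^ g * G a))
    (hout : IsOutput (M + E) g G Uhat)
    (hA : 1 ≤ A) (hkA : k ≤ A) (hcA : k * (2 ^ g / c) ≤ A) (hCA : k * C ≤ A)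
    (hρn : Real.sqrt n * (e / L) ^ (g - 1) ≤ A)
    (hsmall : g * A ^ 2 * (e / L * ℓ * θ) ≤ 1 / 2) :
    maxNorm (Uhat * Uhat.transpose * (M + E) - M) ≤
      17 * g * A ^ 5 * (ℓ * θ * e * twoInftyNorm U ^ 2) := by
  have hθ0 : 0 < θ := by linarith
  have hkr : (1 : ℝ) ≤ k := by exact_mod_cast hk
  have hsk : Real.sqrt k ≤ k := by
    rw [Real.sqrt_le_left (by linarith)]
    nlinarith
  have hu1 := one_le_sqrt_mul_twoInftyNorm h.orthonormal hk
  set u := twoInftyNorm U with hu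
  have hu0 : 0 < u := by
    by_contra hcon
    have : Real.sqrt n * u ≤ 0 := mul_nonpos_of_nonneg_of_nonpos (Real.sqrt_nonneg _) (not_lt.1 hcon)
    linarith
  have hEop := opBound_of_specNorm_le hspec
  have hMop : OpBound M L := by rw [h.decomp]; exact opBound_signal h.orthonormal hlam hL.le
  have hMEop : OpBound (M + E) (2 * L) := fun v =>
    (hMop.add hEop v).trans (mul_le_mul_of_nonneg_right (by linarith) (nrm_nonneg v))
  -- In the ratio `T / s` the sketch size `T` cancels, leaving `θ / (c L ^ g)`; this is the only
  -- trace of the sketches in the bounds below.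
  set s := c * L ^ g * T / θ with hs
  have hs0 : 0 < s := by positivity
  obtain ⟨t, F, hUF, hUo, hF⟩ :=
    hout.exists_factor hk (le_of_orthonormal h.orthonormal) hkp h.orthonormal hs0 hlow
  have hTs : T / s = θ / (c * L ^ g) := by rw [hs]; field_simp
  have hcinv : 1 / c ≤ A := by
    refine le_trans ?_ hcA
    have h2 : (1 : ℝ) ≤ 2 ^ g := one_le_pow₀ (by norm_num)
    calc 1 / c ≤ 2 ^ g / c := div_le_div_of_nonneg_right h2 hc.le
      _ ≤ _ := le_mul_of_one_le_left (by positivity) hkr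
  have hEsymm : ∀ h, (E ^ h).transpose = E ^ h := fun h => by rw [Matrix.transpose_pow, hE.eq]
  have hErow : ∀ h i, nrm ((E ^ h) i) ≤ e ^ h := by
    intro h i
    have h1 := hEop.pow he.le h (Pi.single i 1)
    have h2 : nrm (Pi.single i (1 : ℝ) : Fin n → ℝ) = 1 := by
      rw [nrm_eq_sqrt]; simp
    rw [h2, mul_one, Matrix.mulVec_single_one] at h1
    rw [← hEsymm]
    exact h1
  have hEGF : ∀ h, (h = g ∨ h = g + 1) → ∀ i,
      nrm ((E ^ h * G t * F) i) ≤ e ^ h * (θ / (c * L ^ g)) := by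
    intro h hh i
    rw [Matrix.mul_apply_eq_vecMul, Matrix.mul_apply_eq_vecMul, ← hTs, ← mul_div_assoc]
    refine (hF _).trans (div_le_div_of_nonneg_right ((hup h hh t i).trans ?_) hs0.le)
    exact mul_le_mul_of_nonneg_right (hErow h i) hT.le
  refine maxNorm_le (by positivity) fun i j => ?_
  refine abs_proj_mul_sub_le hg h.orthonormal h.decomp hE hUF hUo hL he hℓ hu0 hθ hA hlam
    (hsk.trans hkA) (nrm_row_le_twoInftyNorm U) ?_ ?_ ?_ ?_ ?_ ?_ hρn hsmall i j
  · intro q hq1 hq2 i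
    have hent : ∀ j, |(E ^ q * U) i j| ≤ C * e ^ q * ℓ ^ q * u := by
      intro j
      refine (hrow q hq1 hq2 j i).trans ?_
      have : ‖fun l => U l j‖ ≤ u := by
        refine (pi_norm_le_iff_of_nonneg hu0.le).2 fun l => ?_
        exact (abs_apply_le_nrm (U l) j).trans (nrm_row_le_twoInftyNorm U l)
      gcongr
    have h1 : nrm ((E ^ q * U) i) ≤ k * (C * e ^ q * ℓ ^ q * u) := by
      refine nrm_le_of_sq_le (by positivity) ?_
      calc _ ≤ ∑ _j : Fin k, (C * e ^ q * ℓ ^ q * u) ^ 2 := by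
            refine Finset.sum_le_sum fun j _ => ?_
            rw [← pow_two, ← sq_abs]
            exact pow_le_pow_left₀ (abs_nonneg _) (hent j) 2
        _ = k * (C * e ^ q * ℓ ^ q * u) ^ 2 := by simp
        _ ≤ k ^ 2 * (C * e ^ q * ℓ ^ q * u) ^ 2 := by gcongr; nlinarith
        _ = _ := by ring
    refine h1.trans ?_
    calc _ = (k * C) * (e ^ q * ℓ ^ q * u) := by ring
      _ ≤ A * (e ^ q * ℓ ^ q * u) := by gcongr
      _ = _ := by ring
  · intro q
    refine (fro_le_of_mulVec (c := e ^ q) (by positivity) fun x => ?_).trans ?_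
    · rw [← Matrix.mulVec_mulVec]
      refine (hEop.pow he.le q _).trans_eq ?_
      rw [nrm_mulVec_of_orthonormal h.orthonormal]
    · rw [Fintype.card_fin]
      exact mul_le_mul_of_nonneg_right (hsk.trans hkA) (by positivity)
  · intro q hq
    have hrows : ∀ j, nrm ((Matrix.diagonal lam * U.transpose * (M + E) ^ (g - 1 - q) * G t * F) j) ≤
        2 ^ g / c * (θ / L ^ q) := by
      intro j
      have h1 : (Matrix.diagonal lam * U.transpose * (M + E) ^ (g - 1 - q) * G t * F) j =
          lam j • Matrix.vecMul
            (Matrix.vecMul ((U.transpose * (M + E) ^ (g - 1 - q)) j) (G t)) F := by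
        rw [← Matrix.mul_apply_eq_vecMul, ← Matrix.mul_apply_eq_vecMul]
        ext l
        simp only [Matrix.mul_assoc, Pi.smul_apply, smul_eq_mul]
        rw [Matrix.diagonal_mul]
      have h2 : nrm ((U.transpose * (M + E) ^ (g - 1 - q)) j) ≤ (2 * L) ^ (g - 1 - q) := by
        have h3 : (U.transpose * (M + E) ^ (g - 1 - q)) j =
            ((M + E) ^ (g - 1 - q)).mulVec (U.transpose j) := by
          rw [Matrix.mul_apply_eq_vecMul, ← Matrix.mulVec_transpose, Matrix.transpose_pow,
            Matrix.transpose_add, h.isSymm.eq, hE.eq]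
        have h4 : nrm (U.transpose j) = 1 := by
          have h5 := nrm_mulVec_of_orthonormal h.orthonormal (Pi.single j 1)
          rw [Matrix.mulVec_single_one] at h5
          have h6 : nrm (Pi.single j (1 : ℝ) : Fin k → ℝ) = 1 := by
            rw [nrm_eq_sqrt]; simp
          rw [h6] at h5
          exact h5
        have h7 := hMEop.pow (by positivity) (g - 1 - q) (U.transpose j)
        rw [h4, mul_one] at h7
        rw [h3]
        exact h7
      have h3 := (hF _).trans (div_le_div_of_nonneg_right
        ((hup' (g - 1 - q) (by omega) t j).trans (mul_le_mul_of_nonneg_right h2 hT.le)) hs0.le)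
      rw [mul_div_assoc, hTs] at h3
      rw [h1, nrm_smul]
      refine (mul_le_mul (hlam j) h3 (nrm_nonneg _) hL.le).trans ?_
      have h8 : (2 : ℝ) ^ (g - 1 - q) ≤ 2 ^ g := pow_le_pow_right₀ (by norm_num) (by omega)
      have h9 : L ^ g = L * L ^ (g - 1 - q) * L ^ q := by
        rw [← pow_succ', ← pow_add]; congr 1; omega
      calc L * ((2 * L) ^ (g - 1 - q) * (θ / (c * L ^ g)))
          = 2 ^ (g - 1 - q) / c * (θ / L ^ q) := by rw [h9, mul_pow]; field_simp
        _ ≤ _ := by gcongr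
    refine (fro_le_of_rows (by positivity) hrows).trans ?_
    rw [Fintype.card_fin]
    calc Real.sqrt k * (2 ^ g / c * (θ / L ^ q)) ≤ k * (2 ^ g / c * (θ / L ^ q)) := by gcongr
      _ = (k * (2 ^ g / c)) * (θ / L ^ q) := by ring
      _ ≤ A * (θ / L ^ q) := by gcongr
      _ = _ := by ring
  · intro i
    refine (hEGF g (Or.inl rfl) i).trans ?_
    calc _ = 1 / c * (e / L) ^ g * θ := by rw [div_pow]; field_simp
      _ ≤ _ := by gcongr
  · intro i
    refine (hEGF (g + 1) (Or.inr rfl) i).trans ?_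
    calc _ = 1 / c * e * (e / L) ^ g * θ := by rw [div_pow, pow_succ]; field_simp
      _ ≤ _ := by gcongr
  · calc (e / L) ^ (g - 1) = 1 * (e / L) ^ (g - 1) := (one_mul _).symm
      _ ≤ Real.sqrt n * u * (e / L) ^ (g - 1) := by gcongr
      _ = Real.sqrt n * (e / L) ^ (g - 1) * u := by ring
      _ ≤ A * u := by gcongr

end GoodEvent

/-! ### Conditioning on the noise and the union bound -/

section Probability

/-- Failure events may be nonmeasurable, since the output is an arbitrary choice of singular
vectors. Union bounds are therefore made for the outer measure of the complement, and a measurable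
hull returns the required event. -/
theorem holdsWithProb_one_sub_iff {Ω : Type*} [MeasurableSpace Ω] (P : Measure Ω)
    [IsProbabilityMeasure P] {q : ℝ} (hq : 0 ≤ q) (s : Set Ω) :
    HoldsWithProb P (1 - q) s ↔ P sᶜ ≤ ENNReal.ofReal q := by
  constructor
  · rintro ⟨A, hA, hAs, hp⟩
    refine (measure_mono (Set.compl_subset_compl.2 hAs)).trans ?_
    rw [← ofReal_measureReal, probReal_compl_eq_one_sub hA]
    exact ENNReal.ofReal_le_ofReal (by linarith)
  · intro h
    refine ⟨(toMeasurable P sᶜ)ᶜ, (measurableSet_toMeasurable _ _).compl,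
      Set.compl_subset_comm.1 (subset_toMeasurable P sᶜ), ?_⟩
    rw [probReal_compl_eq_one_sub (measurableSet_toMeasurable _ _)]
    rw [← measure_toMeasurable] at h
    have := ENNReal.toReal_le_of_le_ofReal hq h
    have h2 : P.real (toMeasurable P sᶜ) ≤ q := this
    linarith

/-- A bound for the probability of an event given one of two independent variables. -/
theorem measure_indep_le {Ω X Y : Type*} [MeasurableSpace Ω] [MeasurableSpace X]
    [MeasurableSpace Y] {P : Measure Ω} [IsProbabilityMeasure P] {ν : Measure Y} [SFinite ν]
    {x : Ω → X} {y : Ω → Y} (hx : AEMeasurable x P) (hy : HasLaw y ν P) (hxy : IndepFun x y P)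
    {A : Set X} (hA : MeasurableSet A) {B : Set (X × Y)} (hB : MeasurableSet B) {q : ENNReal}
    (hq : ∀ a ∈ A, ν {b | (a, b) ∈ B} ≤ q) :
    P {ω | x ω ∈ A ∧ (x ω, y ω) ∈ B} ≤ q := by
  have hS : MeasurableSet (Prod.fst ⁻¹' A ∩ B) := (measurable_fst hA).inter hB
  have h1 : P {ω | x ω ∈ A ∧ (x ω, y ω) ∈ B} ≤
      P.map (fun ω => (x ω, y ω)) (Prod.fst ⁻¹' A ∩ B) :=
    Measure.le_map_apply (hx.prodMk hy.aemeasurable) _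
  refine h1.trans ?_
  have := Measure.isProbabilityMeasure_map hx
  rw [(indepFun_iff_map_prod_eq_prod_map_map hx hy.aemeasurable).1 hxy, hy.map_eq,
    Measure.prod_apply hS]
  calc ∫⁻ a, ν (Prod.mk a ⁻¹' (Prod.fst ⁻¹' A ∩ B)) ∂(P.map x) ≤ ∫⁻ _, q ∂(P.map x) := by
        refine lintegral_mono fun a => ?_
        by_cases ha : a ∈ A
        · exact (measure_mono fun b hb => hb.2).trans (hq a ha)
        · have : Prod.mk a ⁻¹' (Prod.fst ⁻¹' A ∩ B) = ∅ := by
            ext b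
            simp [ha]
          simp [this]
    _ = q := by simp

variable {n k p N g : ℕ}

theorem continuous_sketch (a : Fin N) :
    Continuous fun y : Fin N × Fin n × Fin p → ℝ => sketch y a :=
  continuous_matrix fun _ _ => continuous_apply _

theorem continuous_nrm {ι : Type*} [Fintype ι] : Continuous (nrm : (ι → ℝ) → ℝ) := by
  unfold nrm
  fun_prop

/-- A sketch is not too large in a fixed direction. -/
theorem stdPi_vecMul_sketch_tail (v : Fin n → ℝ) (a : Fin N) {T l : ℝ} (hT : 0 ≤ T)
    (hTl : T ^ 2 = 4 * ((p : ℝ) + l)) :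
    stdPi (Fin N × Fin n × Fin p) {y | nrm v * T < nrm (Matrix.vecMul v (sketch y a))} ≤
      ENNReal.ofReal (Real.exp (-l)) := by
  -- A zero direction cannot be normalized, but the strict inequality then makes the event empty.
  rcases (nrm_nonneg v).eq_or_lt with h0 | h0
  · have hv : v = 0 := (WithLp.toLp_eq_zero 2).1 (norm_eq_zero.1 h0.symm)
    have : {y : Fin N × Fin n × Fin p → ℝ | nrm v * T < nrm (Matrix.vecMul v (sketch y a))} = ∅ := by
      ext y
      simp [hv, nrm]
    simp [this]
  · set A : Matrix (Fin p) (Fin N × Fin n × Fin p) ℝ := Matrix.of fun s r =>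
      if a = r.1 then (if s = r.2.2 then (nrm v)⁻¹ * v r.2.1 else 0) else 0 with hA
    have hvv : ∑ l, ((nrm v)⁻¹ * v l) * ((nrm v)⁻¹ * v l) = 1 := by
      have h1 : ∑ l, v l * v l = nrm v ^ 2 := (nrm_sq v).symm
      calc _ = (nrm v)⁻¹ ^ 2 * ∑ l, v l * v l := by
            rw [Finset.mul_sum]; exact Finset.sum_congr rfl fun l _ => by ring
        _ = 1 := by rw [h1]; field_simp
    have hAA : A * A.transpose = 1 := by
      ext s s'
      simp only [Matrix.mul_apply, Matrix.transpose_apply, hA, Matrix.of_apply,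
        Fintype.sum_prod_type, Matrix.one_apply, ite_mul, zero_mul, mul_ite, mul_zero]
      rw [Finset.sum_eq_single a (by
        intro x _ hx
        simp [Ne.symm hx]) (by simp)]
      by_cases hs : s = s'
      · subst hs
        simp [hvv]
      · simp [hs]
    have hAy : ∀ y, A.mulVec y = (nrm v)⁻¹ • Matrix.vecMul v (sketch y a) := by
      intro y
      ext s
      simp only [Matrix.mulVec, dotProduct, hA, Matrix.of_apply, Fintype.sum_prod_type, ite_mul,
        zero_mul, Pi.smul_apply, smul_eq_mul, Matrix.vecMul, sketch, Finset.mul_sum]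
      rw [Finset.sum_eq_single a (by
        intro x _ hx
        simp [Ne.symm hx]) (by simp)]
      simp [mul_assoc]
    have hm : Measurable A.mulVec := by
      refine measurable_pi_lambda _ fun i => ?_
      simp only [Matrix.mulVec, dotProduct]
      fun_prop
    have h2 := stdPi_chiSquare_tail (κ := Fin p) l
    rw [← map_mulVec_stdPi A hAA, Fintype.card_fin] at h2
    refine le_trans (measure_mono ?_) ((Measure.le_map_apply hm.aemeasurable _).trans h2)
    intro y hy
    show 4 * ((p : ℝ) + l) ≤ A.mulVec y ⬝ᵥ A.mulVec y
    rw [← nrm_sq, ← hTl, hAy, nrm_smul, abs_of_pos (inv_pos.2 h0)]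
    refine pow_le_pow_left₀ hT ?_ 2
    rw [le_inv_mul_iff₀ h0]
    exact le_of_lt hy

/-- A sketch that is independent of the noise is not too large in a direction that depends on the
noise. -/
theorem measure_vecMul_sketch_le {Ω : Type*} [MeasurableSpace Ω] {P : Measure Ω}
    [IsProbabilityMeasure P] {x : Ω → Fin n × Fin n → ℝ} {y : Ω → Fin N × Fin n × Fin p → ℝ}
    (hx : Measurable x) (hy : HasLaw y (stdPi (Fin N × Fin n × Fin p)) P) (hxy : IndepFun x y P)
    {T l : ℝ} (hT : 0 ≤ T) (hTl : T ^ 2 = 4 * ((p : ℝ) + l))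
    {v : (Fin n × Fin n → ℝ) → Fin n → ℝ} (hv : Continuous v) (a : Fin N) :
    P {ω | ¬ nrm (Matrix.vecMul (v (x ω)) (sketch (y ω) a)) ≤ nrm (v (x ω)) * T} ≤
      ENNReal.ofReal (Real.exp (-l)) := by
  set B : Set ((Fin n × Fin n → ℝ) × (Fin N × Fin n × Fin p → ℝ)) :=
    {q | nrm (v q.1) * T < nrm (Matrix.vecMul (v q.1) (sketch q.2 a))} with hBdef
  have hB : MeasurableSet B := by
    refine (isOpen_lt ?_ ?_).measurableSet
    · exact (continuous_nrm.comp (hv.comp continuous_fst)).mul continuous_const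
    · refine continuous_nrm.comp ?_
      exact (hv.comp continuous_fst).matrix_vecMul ((continuous_sketch a).comp continuous_snd)
  refine le_trans (measure_mono ?_) (measure_indep_le hx.aemeasurable hy hxy MeasurableSet.univ hB
    fun b _ => stdPi_vecMul_sketch_tail (v b) a hT hTl)
  intro ω hω
  exact ⟨Set.mem_univ _, not_le.1 hω⟩

theorem ExpandsBy.mul_left {R : Matrix (Fin k) (Fin k) ℝ} {Z : Matrix (Fin k) (Fin p) ℝ} {t w : ℝ}
    (hZ : ExpandsBy t Z) (ht : 0 ≤ t) (hw : 0 ≤ w)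
    (hR : ∀ x, w * nrm x ≤ nrm (R.transpose.mulVec x)) : ExpandsBy (w ^ 2 * t) (R * Z) := by
  intro x
  rw [Matrix.transpose_mul, ← Matrix.mulVec_mulVec]
  refine le_trans ?_ (hZ (R.transpose.mulVec x))
  rw [← nrm_sq, ← nrm_sq]
  have h1 := pow_le_pow_left₀ (mul_nonneg hw (nrm_nonneg x)) (hR x) 2
  calc w ^ 2 * t * nrm x ^ 2 = t * (w * nrm x) ^ 2 := by ring
    _ ≤ _ := mul_le_mul_of_nonneg_left h1 ht

/-- One of the sketches, multiplied by the power of the noisy matrix and projected to the signal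
space, has a large `k`-th singular value. -/
theorem measure_not_expandsBy_le {Ω : Type*} [MeasurableSpace Ω] {P : Measure Ω}
    [IsProbabilityMeasure P] {x : Ω → Fin n × Fin n → ℝ} {y : Ω → Fin N × Fin n × Fin p → ℝ}
    (hx : Measurable x) (hy : HasLaw y (stdPi (Fin N × Fin n × Fin p)) P) (hxy : IndepFun x y P)
    {M : Matrix (Fin n) (Fin n) ℝ} {U : Matrix (Fin n) (Fin k) ℝ} {lam : Fin k → ℝ}
    (h : IsSignalDecomposition M U lam) {L e b w t : ℝ} (hL : 0 ≤ L) (he : 0 ≤ e) (hb : 0 ≤ b)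
    (hlam : ∀ j, |lam j| ≤ L) (hlam' : ∀ j, b ≤ |lam j|) (hw : 0 < w)
    (hwb : w ≤ b ^ g - ((L + e) ^ g - L ^ g)) (ht : 0 ≤ t) {q : ENNReal}
    (hlow : ∀ O : Matrix (Fin k) (Fin n) ℝ, O * O.transpose = 1 →
      stdPi (Fin N × Fin n × Fin p) {y | ¬ ∃ a, ExpandsBy t (O * sketch y a)} ≤ q) :
    P {ω | ((ofPairs (x ω)).IsSymm ∧ OpBound (ofPairs (x ω)) e) ∧
      ¬ ∃ a, ExpandsBy (w ^ 2 * t) (U.transpose * (M + ofPairs (x ω)) ^ g * sketch (y ω) a)} ≤ q := by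
  -- Only for noise in this set is the power invertible on the signal space; the Gaussian estimate
  -- is applied to each fixed such `z`.
  set A : Set (Fin n × Fin n → ℝ) := {z | (ofPairs z).IsSymm ∧ OpBound (ofPairs z) e} with hAdef
  have hA : MeasurableSet A := by
    refine IsClosed.measurableSet (IsClosed.inter ?_ ?_)
    · exact isClosed_eq continuous_ofPairs.matrix_transpose continuous_ofPairs
    · have : {z : Fin n × Fin n → ℝ | OpBound (ofPairs z) e} =
          ⋂ v, {z | nrm ((ofPairs z).mulVec v) ≤ e * nrm v} := by
        ext z; simp [OpBound]
      show IsClosed {z : Fin n × Fin n → ℝ | OpBound (ofPairs z) e}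
      rw [this]
      exact isClosed_iInter fun v => isClosed_le
        (continuous_nrm.comp (continuous_ofPairs.matrix_mulVec continuous_const)) continuous_const
  set B : Set ((Fin n × Fin n → ℝ) × (Fin N × Fin n × Fin p → ℝ)) :=
    {q | ¬ ∃ a, ExpandsBy (w ^ 2 * t) (U.transpose * (M + ofPairs q.1) ^ g * sketch q.2 a)}
  have hB : MeasurableSet B := by
    have : B = ⋂ a, {q | ExpandsBy (w ^ 2 * t)
        (U.transpose * (M + ofPairs q.1) ^ g * sketch q.2 a)}ᶜ := by
      ext q; simp [B]
    rw [this]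
    refine MeasurableSet.iInter fun a => (IsClosed.measurableSet ?_).compl
    refine isClosed_expandsBy _ _ ?_
    refine Continuous.matrix_mul (continuous_const.matrix_mul ?_)
      ((continuous_sketch a).comp continuous_snd)
    exact (continuous_const.add (continuous_ofPairs.comp continuous_fst)).pow g
  refine measure_indep_le hx.aemeasurable hy hxy hA hB fun z hz => ?_
  have h1 : ∀ v, w * nrm v ≤
      nrm ((U.transpose * (M + ofPairs z) ^ g).transpose.mulVec v) := fun v =>
    (mul_le_mul_of_nonneg_right hwb (nrm_nonneg v)).trans
      (h.le_nrm_transpose_mulVec hz.1 hL he hb hlam hlam' hz.2 g v)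
  obtain ⟨O, R, hO, hWR, hR⟩ := exists_orthonormal_rows_factor _ hw h1
  refine le_trans (measure_mono ?_) (hlow O hO)
  rintro y hy ⟨a, ha⟩
  refine hy ⟨a, ?_⟩
  show ExpandsBy (w ^ 2 * t) (U.transpose * (M + ofPairs z) ^ g * sketch y a)
  rw [hWR, Matrix.mul_assoc]
  exact ha.mul_left ht hw.le hR

/-- The probability that the entrywise error bound fails, for fixed `n`. -/
theorem measure_maxNorm_not_le {Ω : Type*} [MeasurableSpace Ω] {P : Measure Ω}
    [IsProbabilityMeasure P] {M : Matrix (Fin n) (Fin n) ℝ} {U : Matrix (Fin n) (Fin k) ℝ}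
    {lam : Fin k → ℝ} (h : IsSignalDecomposition M U lam) (hk : 1 ≤ k) (hkp : k ≤ p) (hg : 1 ≤ g)
    (hn : 1 ≤ n) (hN : 1 ≤ N)
    {E : Ω → Matrix (Fin n) (Fin n) ℝ} (hE_meas : ∀ i j, Measurable fun ω => E ω i j)
    (hE : ∀ ω, (E ω).IsSymm) {G : Fin N → Ω → Matrix (Fin n) (Fin p) ℝ}
    (hG : IsGaussianSketch P G)
    (hindep : IndepFun (fun ω (q : Fin n × Fin n) => E ω q.1 q.2)
      (fun ω (q : Fin N × Fin n × Fin p) => G q.1 ω q.2.1 q.2.2) P)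
    {Uhat : Ω → Matrix (Fin n) (Fin k) ℝ}
    (hout : ∀ ω, IsOutput (M + E ω) g (fun b => G b ω) (Uhat ω))
    {L e b ℓ θ T C c w A : ℝ} (hL : 0 < L) (hlam : ∀ j, |lam j| ≤ L) (hb : 0 ≤ b)
    (hlam' : ∀ j, b ≤ |lam j|) (he : 0 < e) (heL : e ≤ L)
    (hℓ : 1 ≤ ℓ) (hθ : 1 ≤ θ) (hT : 0 < T) (hC : 0 ≤ C) (hc : 0 < c) (hw : 0 < w)
    (hwb : w * L ^ g ≤ b ^ g - ((L + e) ^ g - L ^ g))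
    (hTr : T ^ 2 = sketchRadiusSq n N p)
    (hspec : P {ω | ¬ specNorm (E ω) ≤ e} ≤ ENNReal.ofReal (1 / (n : ℝ) ^ 6))
    (hrow : ∀ h, 1 ≤ h → h ≤ g → ∀ u : Fin n → ℝ, P {ω | ¬ ∀ i, |(E ω ^ h).mulVec u i| ≤
      C * e ^ h * ℓ ^ h * ‖u‖} ≤ ENNReal.ofReal (1 / (n : ℝ) ^ 8))
    (hlow : ∀ O : Matrix (Fin k) (Fin n) ℝ, O * O.transpose = 1 →
      stdPi (Fin N × Fin n × Fin p)
        {y | ¬ ∃ a, ExpandsBy (c ^ 2 * (T ^ 2 / θ ^ 2)) (O * sketch y a)} ≤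
        ENNReal.ofReal (1 / (n : ℝ) ^ 7))
    (hA : 1 ≤ A) (hkA : k ≤ A) (hcA : k * (2 ^ g / (w * c)) ≤ A) (hCA : k * C ≤ A)
    (hρn : Real.sqrt n * (e / L) ^ (g - 1) ≤ A)
    (hsmall : g * A ^ 2 * (e / L * ℓ * θ) ≤ 1 / 2) :
    P {ω | maxNorm (Uhat ω * (Uhat ω).transpose * (M + E ω) - M) ≤
      17 * g * A ^ 5 * (ℓ * θ * e * twoInftyNorm U ^ 2)}ᶜ ≤
      ENNReal.ofReal (1 / (n : ℝ) ^ 6 + g * k * (1 / (n : ℝ) ^ 8) + 1 / (n : ℝ) ^ 7 +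
        (2 * n + g * k) * (1 / (n : ℝ) ^ 9)) := by
  set x : Ω → Fin n × Fin n → ℝ := fun ω q => E ω q.1 q.2 with hxdef
  set y : Ω → Fin N × Fin n × Fin p → ℝ := fun ω q => G q.1 ω q.2.1 q.2.2 with hydef
  have hx : Measurable x := measurable_pi_lambda _ fun q => hE_meas q.1 q.2
  have hxE : ∀ ω, ofPairs (x ω) = E ω := fun ω => rfl
  have hyG : ∀ ω a, sketch (y ω) a = G a ω := fun ω a => rfl
  have hn0 : (0 : ℝ) < n := by exact_mod_cast hn
  have hN0 : (0 : ℝ) < N := by exact_mod_cast hN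
  -- The summand `log N` pays for the union over all sketches, leaving `n^(-9)` for each direction.
  set r : ℝ := Real.log N + 9 * Real.log n with hr
  have hTl : T ^ 2 = 4 * ((p : ℝ) + r) := hTr
  have hexp : Real.exp (-r) = 1 / (n : ℝ) ^ 9 / N := by
    rw [hr, Real.exp_neg, Real.exp_add, Real.exp_log hN0,
      show (9 : ℝ) * Real.log n = ((9 : ℕ) : ℝ) * Real.log n by norm_num,
      Real.exp_nat_mul, Real.exp_log hn0]
    field_simp
  set B1 : Set Ω := {ω | ¬ specNorm (E ω) ≤ e}
  set B2 : Set Ω := ⋃ q : Fin g × Fin k, {ω | ¬ ∀ i,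
    |(E ω ^ ((q.1 : ℕ) + 1)).mulVec (fun l => U l q.2) i| ≤
      C * e ^ ((q.1 : ℕ) + 1) * ℓ ^ ((q.1 : ℕ) + 1) * ‖fun l => U l q.2‖}
  set B3 : Set Ω := {ω | ((ofPairs (x ω)).IsSymm ∧ OpBound (ofPairs (x ω)) e) ∧
      ¬ ∃ a, ExpandsBy ((w * L ^ g) ^ 2 * (c ^ 2 * (T ^ 2 / θ ^ 2)))
        (U.transpose * (M + ofPairs (x ω)) ^ g * sketch (y ω) a)}
  -- The only directions in which a sketch must be bounded: the rows of `E ^ g` and `E ^ (g + 1)`,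
  -- and those of `Uᵀ (M + E) ^ h` for `h < g`. They depend on the noise but not on the sketches.
  set v : (Fin 2 × Fin n) ⊕ (Fin g × Fin k) → (Fin n × Fin n → ℝ) → Fin n → ℝ :=
    Sum.elim (fun q z => (ofPairs z ^ (g + (q.1 : ℕ))) q.2)
      (fun q z => (U.transpose * (M + ofPairs z) ^ (q.1 : ℕ)) q.2) with hv
  set B4 : Set Ω := ⋃ s : ((Fin 2 × Fin n) ⊕ (Fin g × Fin k)) × Fin N,
    {ω | ¬ nrm (Matrix.vecMul (v s.1 (x ω)) (sketch (y ω) s.2)) ≤ nrm (v s.1 (x ω)) * T}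
  have hvc : ∀ s, Continuous (v s) := by
    rintro (q | q)
    · exact (continuous_apply q.2).comp (continuous_ofPairs.pow _)
    · exact (continuous_apply q.2).comp
        (continuous_const.matrix_mul ((continuous_const.add continuous_ofPairs).pow _))
  have hsub : {ω | maxNorm (Uhat ω * (Uhat ω).transpose * (M + E ω) - M) ≤
      17 * g * A ^ 5 * (ℓ * θ * e * twoInftyNorm U ^ 2)}ᶜ ⊆ B1 ∪ B2 ∪ B3 ∪ B4 := by
    intro ω hω
    by_contra hcon
    simp only [Set.mem_union, not_or] at hcon
    obtain ⟨⟨⟨h1, h2⟩, h3⟩, h4⟩ := hcon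
    have h1' : specNorm (E ω) ≤ e := not_not.1 h1
    simp only [B2, Set.mem_iUnion, not_exists] at h2
    simp only [B4, Set.mem_iUnion, not_exists] at h4
    have h4' : ∀ s a, nrm (Matrix.vecMul (v s (x ω)) (G a ω)) ≤ nrm (v s (x ω)) * T :=
      fun s a => not_not.1 (h4 (s, a))
    refine hω (maxNorm_proj_mul_sub_le (G := fun b => G b ω) (C := C) (c := w * c) (T := T) h (hE ω)
      hk hkp hg hL hlam he heL hℓ hθ hT hC
      (by positivity) h1' ?_ ?_ ?_ ?_ (hout ω) hA hkA hcA hCA hρn hsmall)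
    · intro q hq1 hq2 j i
      have := not_not.1 (h2 (⟨q - 1, by omega⟩, j)) i
      simpa only [Nat.sub_add_cancel hq1] using this
    · rintro q (rfl | rfl) a i
      · exact h4' (Sum.inl (0, i)) a
      · exact h4' (Sum.inl (1, i)) a
    · intro q hq a j
      exact h4' (Sum.inr (⟨q, hq⟩, j)) a
    · have h3' : ∃ a, ExpandsBy ((w * L ^ g) ^ 2 * (c ^ 2 * (T ^ 2 / θ ^ 2)))
          (U.transpose * (M + E ω) ^ g * G a ω) := by
        by_contra hne
        exact h3 ⟨⟨hE ω, opBound_of_specNorm_le h1'⟩, hne⟩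
      obtain ⟨a, ha⟩ := h3'
      refine ⟨a, ha.mono (le_of_eq ?_)⟩
      rw [div_pow]
      ring
  have hb1 : P B1 ≤ ENNReal.ofReal (1 / (n : ℝ) ^ 6) := hspec
  have hb2 : P B2 ≤ ENNReal.ofReal (g * k * (1 / (n : ℝ) ^ 8)) := by
    refine (measure_iUnion_fintype_le _ _).trans ?_
    refine (Finset.sum_le_sum fun q _ => hrow (q.1 + 1) (by omega) q.1.2 _).trans_eq ?_
    rw [Finset.sum_const, Finset.card_univ, Fintype.card_prod, Fintype.card_fin, Fintype.card_fin,
      nsmul_eq_mul, ENNReal.ofReal_mul (by positivity), ← Nat.cast_mul, ENNReal.ofReal_natCast]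
  have hb3 : P B3 ≤ ENNReal.ofReal (1 / (n : ℝ) ^ 7) :=
    measure_not_expandsBy_le hx hG hindep h hL.le he.le hb hlam hlam' (by positivity) hwb
      (by positivity) hlow
  have hb4 : P B4 ≤ ENNReal.ofReal ((2 * n + g * k) * (1 / (n : ℝ) ^ 9)) := by
    refine (measure_iUnion_fintype_le _ _).trans ?_
    refine (Finset.sum_le_sum fun s _ =>
      measure_vecMul_sketch_le hx hG hindep hT.le hTl (hvc s.1) s.2).trans_eq ?_
    rw [Finset.sum_const, Finset.card_univ, Fintype.card_prod, Fintype.card_sum, Fintype.card_prod,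
      Fintype.card_prod, Fintype.card_fin, Fintype.card_fin, Fintype.card_fin, Fintype.card_fin,
      Fintype.card_fin, nsmul_eq_mul, ← ENNReal.ofReal_natCast,
      ← ENNReal.ofReal_mul (by positivity), hexp]
    congr 1
    push_cast
    field_simp
  calc _ ≤ P (B1 ∪ B2 ∪ B3 ∪ B4) := measure_mono hsub
    _ ≤ P B1 + P B2 + P B3 + P B4 := by
        refine (measure_union_le _ _).trans (add_le_add ?_ le_rfl)
        refine (measure_union_le _ _).trans (add_le_add ?_ le_rfl)
        exact measure_union_le _ _
    _ ≤ _ := add_le_add (add_le_add (add_le_add hb1 hb2) hb3) hb4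
    _ = _ := by
        rw [ENNReal.ofReal_add (by positivity) (by positivity),
          ENNReal.ofReal_add (by positivity) (by positivity),
          ENNReal.ofReal_add (by positivity) (by positivity)]

end Probability

/-! ### Comparison of powers of `n` and `log n` -/

section Asymptotics

theorem tendsto_log_natCast : Tendsto (fun n : ℕ => Real.log n) atTop atTop :=
  Real.tendsto_log_atTop.comp tendsto_natCast_atTop_atTop

theorem one_le_vartheta (p n : ℕ) : 1 ≤ vartheta p n := le_max_left _ _

theorem vartheta_le_log {p n : ℕ} (hp : 1 ≤ p) (hn : 1 ≤ Real.log n) :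
    vartheta p n ≤ Real.log n := by
  refine max_le hn ?_
  have h1 : 1 ≤ Real.sqrt p := Real.one_le_sqrt.2 (by exact_mod_cast hp)
  have h2 : Real.sqrt (Real.log n) ≤ Real.log n := by
    rw [Real.sqrt_le_left (by linarith)]
    nlinarith
  exact (div_le_self (Real.sqrt_nonneg _) h1).trans h2

theorem eventually_mul_rpow_log_le {β : ℝ} (hβ : 0 < β) (δ : ℝ) {ε : ℝ} (hε : 0 < ε) :
    ∀ᶠ n : ℕ in atTop, (n : ℝ) ^ (-β) * Real.log n ^ δ ≤ ε := by
  have h := ((isLittleO_log_rpow_rpow_atTop δ hβ).comp_tendsto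
    tendsto_natCast_atTop_atTop).bound hε
  filter_upwards [h, eventually_ge_atTop 1] with n h hn
  have hn0 : (0 : ℝ) < n := by exact_mod_cast hn
  have hl : 0 ≤ Real.log n := Real.log_nonneg (by exact_mod_cast hn)
  simp only [Function.comp, Real.norm_eq_abs] at h
  rw [abs_of_nonneg (Real.rpow_nonneg hl _), abs_of_nonneg (Real.rpow_nonneg hn0.le _)] at h
  rw [Real.rpow_neg hn0.le, inv_mul_le_iff₀ (Real.rpow_pos_of_pos hn0 _)]
  linarith

/-- The lower bound is all that the error estimate needs of `δ*`, so its case distinction plays no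
role there. -/
theorem le_deltaStar {k : ℕ → ℕ} (U : ∀ n : ℕ, Matrix (Fin n) (Fin (k n)) ℝ) (β : ℝ) {δ : ℝ}
    (hδ : 0 ≤ δ) {g : ℕ} (hg : 1 ≤ g) :
    δ ≤ deltaStar U β δ g ∧ deltaStar U β δ g ≤ δ * g + 1 / 2 := by
  have hgr : (1 : ℝ) ≤ g := by exact_mod_cast hg
  have h : δ ≤ δ * g + 1 / 2 := by nlinarith
  rw [deltaStar]
  split_ifs
  · exact ⟨le_rfl, h⟩
  · exact ⟨h, le_rfl⟩

theorem condNumber_facts {k : ℕ} (hk : 1 ≤ k) {lam : Fin k → ℝ} (hlam : ∀ i, lam i ≠ 0) :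
    0 < (⨅ i, |lam i|) ∧ (∀ i, (⨅ i, |lam i|) ≤ |lam i|) ∧ (∀ i, |lam i| ≤ ⨆ i, |lam i|) ∧
      1 ≤ condNumber lam := by
  have hne : Nonempty (Fin k) := ⟨⟨0, hk⟩⟩
  have hinf : ∀ i, (⨅ i, |lam i|) ≤ |lam i| := ciInf_le (Set.finite_range _).bddBelow
  have hsup : ∀ i, |lam i| ≤ ⨆ i, |lam i| :=
    le_ciSup (f := fun i => |lam i|) (Set.finite_range _).bddAbove
  have hpos : 0 < ⨅ i, |lam i| := by
    obtain ⟨i, hi⟩ := exists_eq_ciInf_of_finite (f := fun i => |lam i|)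
    rw [← hi]
    exact abs_pos.2 (hlam i)
  refine ⟨hpos, hinf, hsup, ?_⟩
  rw [condNumber, one_le_div hpos]
  exact (hinf ⟨0, hk⟩).trans (hsup _)

theorem Theta_lesssim {k : ℕ → ℕ} {U : ∀ n : ℕ, Matrix (Fin n) (Fin (k n)) ℝ}
    {lam : ∀ n, Fin (k n) → ℝ} (kt : ℕ → ℕ) {β δ : ℝ} {g : ℕ}
    (hlam : ∀ᶠ n in atTop, 1 ≤ condNumber (lam n))
    (hk : ∃ K : ℕ, ∀ᶠ n in atTop, k n ≤ K) (hψ : ∃ B : ℝ, ∀ᶠ n in atTop, condNumber (lam n) ≤ B)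
    {d : ℝ} (hd : deltaStar U β δ g ≤ d) :
    Lesssim (Theta U lam kt β δ g) (fun n => Real.log n ^ d * vartheta (kt n) n) := by
  obtain ⟨K, hK⟩ := hk
  obtain ⟨B, hB⟩ := hψ
  refine ⟨max B 1 ^ g * (Real.sqrt K + 1), by positivity, ?_⟩
  filter_upwards [hK, hB, hlam, tendsto_log_natCast.eventually_ge_atTop 1] with n h1 h2 h3 h4
  have h5 : Real.log n ^ deltaStar U β δ g ≤ Real.log n ^ d := Real.rpow_le_rpow_of_exponent_le h4 hd
  have h6 : condNumber (lam n) ^ g ≤ max B 1 ^ g :=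
    pow_le_pow_left₀ (by linarith) (h2.trans (le_max_left _ _)) g
  have h7 : Real.sqrt (k n) ≤ Real.sqrt K + 1 := by
    have : Real.sqrt (k n) ≤ Real.sqrt K := Real.sqrt_le_sqrt (by exact_mod_cast h1)
    linarith
  have h8 : 0 ≤ vartheta (kt n) n := by linarith [one_le_vartheta (kt n) n]
  have h9 : 0 ≤ condNumber (lam n) := by linarith
  rw [Theta]
  calc _ ≤ Real.log n ^ d * vartheta (kt n) n * max B 1 ^ g * (Real.sqrt K + 1) := by gcongr
    _ = _ := by ring

theorem exists_one_add_pow_sub_one_le (g : ℕ) {w : ℝ} (hw : 0 < w) :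
    ∃ ε : ℝ, 0 < ε ∧ ∀ ρ, 0 ≤ ρ → ρ ≤ ε → (1 + ρ) ^ g - 1 ≤ w := by
  have h : ContinuousAt (fun ρ : ℝ => (1 + ρ) ^ g - 1) 0 := by fun_prop
  obtain ⟨ε, hε, h⟩ := Metric.continuousAt_iff.1 h w hw
  refine ⟨ε / 2, by positivity, fun ρ h0 h1 => ?_⟩
  have h2 := h (x := ρ) (by rw [Real.dist_eq, sub_zero, abs_of_nonneg h0]; linarith)
  rw [Real.dist_eq] at h2
  have h3 := (abs_lt.1 h2).2
  norm_num at h3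
  linarith

/-- The condition on `g` says exactly `β (g - 1) ≥ 1/2`, so `g - 1` factors of the noise-to-signal
ratio compensate `√n`. -/
theorem sqrt_mul_pow_le {n g : ℕ} (hn : 1 ≤ n) (hg1 : 1 ≤ g) {β c₀ ρ : ℝ} (hβ : 0 < β)
    (hg : 1 + (2 * β)⁻¹ ≤ (g : ℝ)) (hc₀ : 0 ≤ c₀) (hρ0 : 0 ≤ ρ) (hρ : ρ ≤ c₀ * (n : ℝ) ^ (-β)) :
    Real.sqrt n * ρ ^ (g - 1) ≤ c₀ ^ (g - 1) := by
  have hn1 : (1 : ℝ) ≤ n := by exact_mod_cast hn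
  have hn0 : (0 : ℝ) < n := by linarith
  have h1 : ρ ^ (g - 1) ≤ c₀ ^ (g - 1) * ((n : ℝ) ^ (-β)) ^ (g - 1) := by
    rw [← mul_pow]
    exact pow_le_pow_left₀ hρ0 hρ _
  have h2 : ((n : ℝ) ^ (-β)) ^ (g - 1) = (n : ℝ) ^ (-β * ((g : ℝ) - 1)) := by
    rw [← Real.rpow_mul_natCast hn0.le, Nat.cast_sub hg1, Nat.cast_one]
  have h3 : (1 : ℝ) / 2 ≤ β * ((g : ℝ) - 1) := by
    have h4 : (2 * β)⁻¹ ≤ (g : ℝ) - 1 := by linarith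
    calc (1 : ℝ) / 2 = β * (2 * β)⁻¹ := by field_simp
      _ ≤ _ := mul_le_mul_of_nonneg_left h4 hβ.le
  have h5 : Real.sqrt n * (n : ℝ) ^ (-β * ((g : ℝ) - 1)) ≤ 1 := by
    rw [Real.sqrt_eq_rpow, ← Real.rpow_add hn0]
    exact Real.rpow_le_one_of_one_le_of_nonpos hn1 (by linarith)
  calc Real.sqrt n * ρ ^ (g - 1)
      ≤ Real.sqrt n * (c₀ ^ (g - 1) * (n : ℝ) ^ (-β * ((g : ℝ) - 1))) := by
        rw [← h2]
        exact mul_le_mul_of_nonneg_left h1 (Real.sqrt_nonneg _)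
    _ = c₀ ^ (g - 1) * (Real.sqrt n * (n : ℝ) ^ (-β * ((g : ℝ) - 1))) := by ring
    _ ≤ c₀ ^ (g - 1) * 1 := mul_le_mul_of_nonneg_left h5 (by positivity)
    _ = _ := mul_one _

theorem sum_failure_le {n : ℕ} {m : ℝ} (hm : 0 ≤ m) (hn : 4 ≤ n) (hmn : m ≤ n) :
    1 / (n : ℝ) ^ 6 + m * (1 / (n : ℝ) ^ 8) + 1 / (n : ℝ) ^ 7 + (2 * n + m) * (1 / (n : ℝ) ^ 9) ≤
      1 / (n : ℝ) ^ 5 := by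
  have hn4r : (4 : ℝ) ≤ n := by exact_mod_cast hn
  have hn0 : (0 : ℝ) < n := by linarith
  have hpoly : (n : ℝ) ^ 3 + m * n + n ^ 2 + (2 * n + m) ≤ n ^ 4 := by
    have h1 : m * n ≤ n ^ 2 := by nlinarith
    have h2 : 2 * n + m ≤ n ^ 2 := by nlinarith
    have h3 : 4 * (n : ℝ) ^ 2 ≤ n ^ 3 := by nlinarith [sq_nonneg (n : ℝ)]
    have h4 : 4 * (n : ℝ) ^ 3 ≤ n ^ 4 := by
      have h5 : 0 ≤ (n : ℝ) ^ 3 := by positivity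
      nlinarith
    have h6 : 0 ≤ (n : ℝ) ^ 3 := by positivity
    linarith
  calc 1 / (n : ℝ) ^ 6 + m * (1 / (n : ℝ) ^ 8) + 1 / (n : ℝ) ^ 7 + (2 * n + m) * (1 / (n : ℝ) ^ 9)
      = ((n : ℝ) ^ 3 + m * n + n ^ 2 + (2 * n + m)) / n ^ 9 := by field_simp
    _ ≤ (n : ℝ) ^ 4 / n ^ 9 := div_le_div_of_nonneg_right hpoly (by positivity)
    _ = 1 / (n : ℝ) ^ 5 := by field_simp

end Asymptotics

end RSRSVD

/-! ### The theorem: choice of constants and assembly -/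

theorem corollary2
    {Ω : ℕ → Type*} [∀ n, MeasurableSpace (Ω n)]
    (P : ∀ n, Measure (Ω n)) [∀ n, IsProbabilityMeasure (P n)]
    -- signal matrices with their eigendecompositions, of bounded rank and condition number
    (k : ℕ → ℕ) (M : ∀ n : ℕ, Matrix (Fin n) (Fin n) ℝ)
    (U : ∀ n : ℕ, Matrix (Fin n) (Fin (k n)) ℝ) (lam : ∀ n, Fin (k n) → ℝ)
    (hM : ∀ᶠ n in atTop, 1 ≤ k n ∧ RSRSVD.IsSignalDecomposition (M n) (U n) (lam n))
    (hk : ∃ K : ℕ, ∀ᶠ n in atTop, k n ≤ K)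
    (hψ : ∃ B : ℝ, ∀ᶠ n in atTop, RSRSVD.condNumber (lam n) ≤ B)
    -- symmetric random noise matrices
    (E : ∀ n, Ω n → Matrix (Fin n) (Fin n) ℝ)
    (hE_meas : ∀ n i j, Measurable fun ω => E n ω i j)
    (hE_symm : ∀ n ω, (E n ω).IsSymm)
    (Elev : ℕ → ℝ) (β : ℝ) (hβ : 0 < β) (hSNR : RSRSVD.SNRAssumption P M E Elev β)
    (δ : ℝ) (hδ : 1 < δ) (hrow : RSRSVD.RowAssumption P E Elev δ)
    -- sketching dimension, number of sketches, and the Gaussian sketching matrices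
    (kt a : ℕ → ℕ) (hkt : ∀ᶠ n in atTop, k n ≤ kt n)
    (C : ℝ) (hC : 0 < C) (ha : ∀ᶠ n : ℕ in atTop, ⌈C * (kt n : ℝ)⁻¹ * Real.log n⌉₊ ≤ a n)
    (G : ∀ n : ℕ, Fin (a n) → Ω n → Matrix (Fin n) (Fin (kt n)) ℝ)
    (hG : ∀ n, RSRSVD.IsGaussianSketch (P n) (G n))
    (hindep : ∀ n, IndepFun (fun ω (q : Fin n × Fin n) => E n ω q.1 q.2)
      (fun ω (q : Fin (a n) × Fin n × Fin (kt n)) => G n q.1 ω q.2.1 q.2.2) (P n))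
    -- the output of the algorithm applied to `M + E`
    (g : ℕ) (hg : 1 + (2 * β)⁻¹ ≤ (g : ℝ))
    (Uhat : ∀ n : ℕ, Ω n → Matrix (Fin n) (Fin (k n)) ℝ)
    (hUhat : ∀ᶠ n in atTop, ∀ ω, RSRSVD.IsOutput (M n + E n ω) g (fun b => G n b ω) (Uhat n ω)) :
    (∃ c : ℝ, 0 < c ∧ ∀ᶠ n : ℕ in atTop,
      RSRSVD.HoldsWithProb (P n) (1 - 1 / (n : ℝ) ^ 5)
        {ω | RSRSVD.maxNorm (Uhat n ω * (Uhat n ω).transpose * (M n + E n ω) - M n) ≤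
          c * (RSRSVD.Theta U lam kt β δ g n * Elev n * RSRSVD.twoInftyNorm (U n) ^ 2)}) ∧
    ((g : ℝ) > 1 + (2 * β)⁻¹ →
      RSRSVD.Lesssim (RSRSVD.Theta U lam kt β δ g)
        (fun n => Real.log n ^ δ * RSRSVD.vartheta (kt n) n)) ∧
    (¬ (g : ℝ) > 1 + (2 * β)⁻¹ →
      RSRSVD.Lesssim (RSRSVD.Theta U lam kt β δ g)
        (fun n => Real.log n ^ (δ * g + 1 / 2) * RSRSVD.vartheta (kt n) n)) := by
  obtain ⟨K, hK⟩ := hk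
  obtain ⟨B, hB⟩ := hψ
  have hg1 : 1 ≤ g := by
    have h1 : (0 : ℝ) < (2 * β)⁻¹ := by positivity
    have h2 : (1 : ℝ) ≤ g := by linarith
    exact_mod_cast h2
  have hδs := RSRSVD.le_deltaStar U β (by linarith : 0 ≤ δ) hg1
  have hcond : ∀ᶠ n in atTop, 1 ≤ RSRSVD.condNumber (lam n) := by
    filter_upwards [hM] with n hn
    exact (RSRSVD.condNumber_facts hn.1 hn.2.ne_zero).2.2.2
  refine ⟨?_, fun hgt => ?_, fun _ => RSRSVD.Theta_lesssim kt hcond ⟨K, hK⟩ ⟨B, hB⟩ hδs.2⟩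
  swap
  · refine RSRSVD.Theta_lesssim kt hcond ⟨K, hK⟩ ⟨B, hB⟩ (le_of_eq ?_)
    rw [RSRSVD.deltaStar, if_pos (Or.inl hgt)]
  obtain ⟨⟨c₀, hc₀, hsnr⟩, hspec⟩ := hSNR
  obtain ⟨Cr, hCr, hrow⟩ := hrow
  -- The bound `K` is not known to be positive, hence `K + 1`.
  obtain ⟨c₁, hc₁, hsketch⟩ := RSRSVD.exists_expanding_sketch (K + 1) (by omega) hC
  set B₁ := max B 1 with hB₁
  have hB₁1 : 1 ≤ B₁ := le_max_right _ _
  -- The smallest signal eigenvalue satisfies `b ^ g ≥ L ^ g / B₁ ^ g = 2 w L ^ g`; one half is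
  -- given up to the perturbation of the power by the noise.
  set w : ℝ := (B₁ ^ g)⁻¹ / 2 with hw
  have hw0 : 0 < w := by positivity
  obtain ⟨ε, hε, hεw⟩ := RSRSVD.exists_one_add_pow_sub_one_le g hw0
  set A : ℝ := 1 + K + K * (2 ^ g / (w * Real.sqrt c₁)) + K * Cr + c₀ ^ (g - 1) with hA
  have hA0 : 0 < A := by positivity
  have hsc : 0 < Real.sqrt c₁ := Real.sqrt_pos.2 hc₁
  have hgr : (1 : ℝ) ≤ g := by exact_mod_cast hg1
  refine ⟨17 * g * A ^ 5, by positivity, ?_⟩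
  filter_upwards [hM, hK, hB, hsnr, hspec, hrow, hkt, ha, hUhat, hsketch,
    -- This admits all powers `h ≤ g` in the row assumption and gives `log n ≥ 1`.
    RSRSVD.tendsto_log_natCast.eventually_ge_atTop ((g : ℝ) + 1),
    -- The exponent is `δ + 1` because `ϑ ≤ log n`. The first entry of the minimum makes `e / L` at
    -- most `ε` and `1`; the second gives the smallness condition with right side `1/2`.
    RSRSVD.eventually_mul_rpow_log_le hβ (δ + 1)
      (show 0 < min (min ε 1 / c₀) ((2 * (g * A ^ 2 * c₀))⁻¹) by positivity),
    eventually_ge_atTop (g * K + 4)] with n hMn hKn hBn hsnrn hspecn hrown hktn han hUn hskn hlogn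
    hsmalln hnn
  obtain ⟨hk1, hdec⟩ := hMn
  obtain ⟨hb0, hbl, hlL, hψ1⟩ := RSRSVD.condNumber_facts hk1 hdec.ne_zero
  set L := ⨆ i, |lam n i| with hL
  set b := ⨅ i, |lam n i| with hb
  have hL0 : 0 < L := hb0.trans_le ((hbl ⟨0, hk1⟩).trans (hlL _))
  have hLb : L ≤ B₁ * b := by
    have h1 : L / b ≤ B₁ := hBn.trans (le_max_left _ _)
    rwa [div_le_iff₀ hb0] at h1
  have hn4 : 4 ≤ n := by omega
  have hn1r : (1 : ℝ) ≤ n := by exact_mod_cast (by omega : 1 ≤ n)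
  have hn0 : (0 : ℝ) < n := by linarith
  have hlog1 : 1 ≤ Real.log n := by linarith
  have hkr : (1 : ℝ) ≤ k n := by exact_mod_cast hk1
  have hKr : (k n : ℝ) ≤ K := by exact_mod_cast hKn
  have hkt1 : 1 ≤ kt n := hk1.trans hktn
  have hkt0 : (0 : ℝ) < kt n := by exact_mod_cast hkt1
  have hMop : RSRSVD.OpBound (M n) L := by
    rw [hdec.decomp]
    exact RSRSVD.opBound_signal hdec.orthonormal hlL hL0.le
  have hSL : RSRSVD.specNorm (M n) ≤ L := RSRSVD.specNorm_le_of_opBound hL0.le hMop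
  have hS0 : 0 ≤ RSRSVD.specNorm (M n) := norm_nonneg _
  have hnβ : 0 < (n : ℝ) ^ β := Real.rpow_pos_of_pos hn0 β
  set e := Elev n with he
  -- Positivity of the noise level is forced by the signal-to-noise bound; the value `0` is excluded
  -- as well, since division by zero gives zero.
  have he0 : 0 < e := by
    by_contra hcon
    have h1 : RSRSVD.specNorm (M n) / e ≤ 0 :=
      div_nonpos_of_nonneg_of_nonpos hS0 (not_lt.1 hcon)
    nlinarith
  have hρ : e / L ≤ c₀ * (n : ℝ) ^ (-β) := by
    have h1 : (n : ℝ) ^ β ≤ c₀ * (L / e) := hsnrn.trans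
      (mul_le_mul_of_nonneg_left (div_le_div_of_nonneg_right hSL he0.le) hc₀.le)
    rw [Real.rpow_neg hn0.le, div_le_iff₀ hL0, ← div_eq_mul_inv, div_mul_eq_mul_div,
      le_div_iff₀ hnβ]
    calc e * (n : ℝ) ^ β ≤ e * (c₀ * (L / e)) := mul_le_mul_of_nonneg_left h1 he0.le
      _ = c₀ * L := by field_simp
  have hρ0 : 0 < e / L := div_pos he0 hL0
  have hρℓ : e / L * Real.log n ^ (δ + 1) ≤
      c₀ * min (min ε 1 / c₀) ((2 * (g * A ^ 2 * c₀))⁻¹) := by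
    refine (mul_le_mul_of_nonneg_right hρ (Real.rpow_nonneg (by linarith) _)).trans ?_
    rw [mul_assoc]
    exact mul_le_mul_of_nonneg_left hsmalln hc₀.le
  have hρε : e / L ≤ min ε 1 := by
    calc e / L ≤ e / L * Real.log n ^ (δ + 1) :=
          le_mul_of_one_le_right hρ0.le (Real.one_le_rpow hlog1 (by linarith))
      _ ≤ c₀ * (min ε 1 / c₀) :=
          hρℓ.trans (mul_le_mul_of_nonneg_left (min_le_left _ _) hc₀.le)
      _ = min ε 1 := by field_simp
  have heL : e ≤ L := by
    have h1 := hρε.trans (min_le_right _ _)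
    rwa [div_le_one hL0] at h1
  set θ := RSRSVD.vartheta (kt n) n with hθ
  have hθ1 : 1 ≤ θ := RSRSVD.one_le_vartheta _ _
  set ℓ := Real.log n ^ δ with hℓ
  have hℓ1 : 1 ≤ ℓ := Real.one_le_rpow hlog1 (by linarith)
  have hNr : C * (kt n : ℝ)⁻¹ * Real.log n ≤ a n := Nat.ceil_le.1 han
  have hN1 : 1 ≤ a n := by
    have h1 : (0 : ℝ) < a n := lt_of_lt_of_le (by positivity) hNr
    exact_mod_cast h1
  have hR0 : 0 < RSRSVD.sketchRadiusSq n (a n) (kt n) := by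
    have h1 : 0 ≤ Real.log (a n) := Real.log_nonneg (by exact_mod_cast hN1)
    rw [RSRSVD.sketchRadiusSq]
    linarith
  have hwb : w * L ^ g ≤ b ^ g - ((L + e) ^ g - L ^ g) := by
    have h1 : (L + e) ^ g = L ^ g * (1 + e / L) ^ g := by
      rw [← mul_pow]; congr 1; field_simp
    have h2 := hεw (e / L) hρ0.le (hρε.trans (min_le_left _ _))
    have h3 : L ^ g ≤ B₁ ^ g * b ^ g := by
      rw [← mul_pow]; exact pow_le_pow_left₀ hL0.le hLb g
    have h4 : 2 * w * L ^ g ≤ b ^ g := by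
      rw [hw, mul_div_cancel₀ _ (two_ne_zero), inv_mul_le_iff₀ (by positivity)]
      exact h3
    have h5 : L ^ g * ((1 + e / L) ^ g - 1) ≤ L ^ g * w :=
      mul_le_mul_of_nonneg_left h2 (by positivity)
    rw [h1]
    linarith
  have hcA0 : 0 ≤ (K : ℝ) * (2 ^ g / (w * Real.sqrt c₁)) := by positivity
  have hCA0 : 0 ≤ (K : ℝ) * Cr := by positivity
  have hcg0 : 0 ≤ c₀ ^ (g - 1) := by positivity
  have hK0 : (0 : ℝ) ≤ K := by positivity
  have hmain := RSRSVD.measure_maxNorm_not_le (P := P n) hdec hk1 hktn hg1 (by omega) hN1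
    (hE_meas n) (hE_symm n) (hG n) (hindep n) hUn (L := L) (e := e) (b := b) (ℓ := ℓ) (θ := θ)
    (T := Real.sqrt (RSRSVD.sketchRadiusSq n (a n) (kt n))) (C := Cr) (c := Real.sqrt c₁) (w := w)
    (A := A) hL0 hlL hb0.le hbl he0 heL hℓ1 hθ1 (Real.sqrt_pos.2 hR0) hCr.le hsc hw0 hwb
    (Real.sq_sqrt hR0.le)
    ((RSRSVD.holdsWithProb_one_sub_iff (P n) (by positivity) _).1 hspecn)
    (fun h hh1 hh2 u => by
      have hhr : (h : ℝ) ≤ g := by exact_mod_cast hh2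
      have h1 := (RSRSVD.holdsWithProb_one_sub_iff (P n) (by positivity) _).1
        (hrown h hh1 (by linarith) u)
      rw [Real.rpow_mul_natCast (by linarith)] at h1
      exact h1)
    (fun O hO => by
      rw [Real.sq_sqrt hc₁.le, Real.sq_sqrt hR0.le]
      exact hskn (k n) (a n) (kt n) hk1 (by omega) hktn hNr O hO)
    (by linarith) (by linarith)
    (by
      refine le_trans (mul_le_mul_of_nonneg_right hKr (by positivity)) ?_
      linarith)
    (by
      refine le_trans (mul_le_mul_of_nonneg_right hKr hCr.le) ?_
      linarith)
    ((RSRSVD.sqrt_mul_pow_le (by omega) hg1 hβ hg hc₀.le hρ0.le hρ).trans (by linarith))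
    (by
      have h1 : ℓ * θ ≤ Real.log n ^ (δ + 1) := by
        rw [Real.rpow_add (by linarith), Real.rpow_one]
        exact mul_le_mul_of_nonneg_left (RSRSVD.vartheta_le_log hkt1 hlog1) (by linarith)
      have h2 : e / L * ℓ * θ ≤ c₀ * (2 * (g * A ^ 2 * c₀))⁻¹ := by
        rw [mul_assoc]
        refine (mul_le_mul_of_nonneg_left h1 hρ0.le).trans (hρℓ.trans ?_)
        exact mul_le_mul_of_nonneg_left (min_le_right _ _) hc₀.le
      calc g * A ^ 2 * (e / L * ℓ * θ) ≤ g * A ^ 2 * (c₀ * (2 * (g * A ^ 2 * c₀))⁻¹) :=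
            mul_le_mul_of_nonneg_left h2 (by positivity)
        _ = 1 / 2 := by field_simp)
  rw [RSRSVD.holdsWithProb_one_sub_iff (P n) (by positivity)]
  refine le_trans (measure_mono (Set.compl_subset_compl.2 ?_))
    (hmain.trans (ENNReal.ofReal_le_ofReal ?_))
  · intro ω hω
    refine le_trans (show RSRSVD.maxNorm _ ≤ _ from hω)
      (mul_le_mul_of_nonneg_left ?_ (by positivity))
    have h1 : ℓ * θ ≤ RSRSVD.Theta U lam kt β δ g n := by
      have h2 : ℓ ≤ Real.log n ^ RSRSVD.deltaStar U β δ g :=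
        Real.rpow_le_rpow_of_exponent_le hlog1 hδs.1
      have h3 : 1 ≤ RSRSVD.condNumber (lam n) ^ g := one_le_pow₀ hψ1
      have h4 : 1 ≤ Real.sqrt (k n) := Real.one_le_sqrt.2 hkr
      rw [RSRSVD.Theta]
      calc ℓ * θ = ℓ * θ * 1 * 1 := by ring
        _ ≤ _ := by gcongr
    gcongr
  · refine RSRSVD.sum_failure_le (by positivity) hn4 ?_
    have h1 : g * k n ≤ n := by
      have := Nat.mul_le_mul_left g hKn
      omega
    exact_mod_cast h1
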